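/- Let $k,m\ge 2$, $n=km$, $\Omega_n=\{1,\dots,n\}$ and $I_i=\{(i-1)m+1,\dots,im\}$ for $1\le i\le k$; for $x\in\Omega_n$ let $i_x$ be the index with $x\in I_{i_x}$. Maps are written on the right and composed from left to right. Let $\mathcal{POI}_{k\times m}$ be the monoid of all partial permutations $\alpha$ of $\Omega_n$ such that $I_{i_x}\subseteq\mathrm{Dom}(\alpha)$ and $I_{i_x}\alpha=I_{i_{x\alpha}}$ for all $x\in\mathrm{Dom}(\alpha)$, and such that $i_x\le i_y$ implies $i_{x\alpha}\le i_{y\alpha}$ for all $x,y\in\mathrm{Dom}(\alpha)$. Let $B=\{b_1,\dots,b_k\}$, $C=\{c_1,\dots,c_k\}$, $X=\{x_0,\dots,x_{k-1}\}$ be pairwise disjoint alphabets with $k$ letters each. Let $U$ be the set of relations - $(c_ib_i^{m-1})^2=1$, $\ b_i^m=1$, $\ (b_ic_ib_i^{m-1})^{m-1}=1$, $\ (c_ib_i^{m-2}c_i)^3=1$, for $1\le i\le k$; - $(c_ib_i^{m-j-1}c_ib_i^{j-1})^2=1$, for $2\le j\le m-2$, $1\le i\le k$; - $b_ib_j=b_jb_i$,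 $c_ic_j=c_jc_i$, for $1\le i<j\le k$; $\ b_ic_j=c_jb_i$, for $1\le i,j\le k$, $i\ne j$; let $W$ be the set of relations - $x_ix_0=x_0x_{i+1}$, for $1\le i\le k-2$; $\ x_jx_i=x_ix_j$, for $2\le i+1<j\le k-1$; - $x_0^2x_1=x_0^2=x_{k-1}x_0^2$; $\ x_{i+1}x_ix_{i+1}=x_{i+1}x_i=x_ix_{i+1}x_i$, for $1\le i\le k-2$; - $x_ix_{i+1}\cdots x_{k-1}x_0x_1\cdots x_{i-1}x_i=x_i$, for $0\le i\le k-1$; - $x_{i+1}\cdots x_{k-1}x_0x_1\cdots x_{i-1}x_i^2=x_i^2$, for $1\le i\le k-1$; and let $U'$ be the set of relations - $c_1b_1^{m-1}x_0=x_0$, $\ b_1x_0=x_0$; - $x_0c_ib_i^{m-1}=c_{i+1}b_{i+1}^{m-1}x_0$, $\ x_0b_i=b_{i+1}x_0$, for $1\le i\le k-1$; - $x_ic_{k-i}b_{k-i}^{m-1}=x_i$, $\ x_ib_{k-i}=x_i$, for $0\le i\le k-1$; - $c_ib_i^{m-1}x_{k-i+1}=x_{k-i+1}$, $\ b_ix_{k-i+1}=x_{k-i+1}$,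 for $2\le i\le k$; - $x_ic_{k-i+1}b_{k-i+1}^{m-1}=c_{k-i}b_{k-i}^{m-1}x_i$, $\ x_ib_{k-i+1}=b_{k-i}x_i$, for $1\le i\le k-1$; - $x_ic_jb_j^{m-1}=c_jb_j^{m-1}x_i$, $\ x_ib_j=b_jx_i$, for $1\le i\le k-1$, $1\le j\le k$, $j\notin\{k-i,k-i+1\}$. Then the monoid $\mathcal{POI}_{k\times m}$ is defined by the presentation $\langle B\cup C\cup X\mid U\cup W\cup U'\rangle$, i.e. it is isomorphic to the quotient of the free monoid $(B\cup C\cup X)^*$ by the smallest congruence containing $U\cup W\cup U'$. More precisely, there is an isomorphism from this quotient onto $\mathcal{POI}_{k\times m}$ which sends (the class of) $b_i,c_i,x_i$ to $\bar b_i,\bar c_i,\bar x_i$, where - $\bar b_i$ and $\bar c_i$ are the permutations of $\Omega_n$ that fix all points outside $I_i$ and act on $I_i$, identified with $\{1,\dots,m\}$ by $x\mapsto x-(i-1)m$, as $b=(1\,2\cdots m)$ and as $c=(1\,2)(1\,2\cdots m)$ (first $(1\,2)$, then $(1\,2\cdots m)$), respectively; - $\bar x_0$ has domain $I_2\cup\dots\cup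 I_k$ and maps $I_j$ onto $I_{j-1}$ by $x\mapsto x-m$; for $1\le i\le k-1$, $\bar x_i$ has domain $\Omega_n\setminus I_{k-i+1}$, maps $I_{k-i}$ onto $I_{k-i+1}$ by $x\mapsto x+m$, and fixes all other points of its domain. The presentation has $3k$ generators. The number of its relations is $\frac12\bigl(9k^2+(2m+7)k-4\bigr)$ if $m\ge3$, and $\frac12\bigl(9k^2+13k-4\bigr)$ if $m=2$. -/

import Mathlib

namespace POIPresentation

/-! ### Partial permutations -/

/-- The symmetric inverse monoid on `Ω`: partial permutations of `Ω`. They act on the right, so that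
the product `α * β` is "first `α`, then `β`". -/
def SymInv (Ω : Type) : Type := Ω ≃. Ω

instance (Ω : Type) : Monoid (SymInv Ω) where
  mul α β := PEquiv.trans α β
  one := PEquiv.refl Ω
  mul_assoc α β γ := PEquiv.trans_assoc α β γ
  one_mul α := PEquiv.refl_trans α
  mul_one α := PEquiv.trans_refl α

/-- `α.Maps x y` means that `x` lies in the domain of `α` and that `xα = y`. -/
def SymInv.Maps {Ω : Type} (α : SymInv Ω) (x y : Ω) : Prop := PEquiv.toFun α x = some y

theorem SymInv.maps_mul {Ω : Type} (α β : SymInv Ω) (x z : Ω) :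
    (α * β).Maps x z ↔ ∃ y, α.Maps x y ∧ β.Maps y z :=
  PEquiv.trans_eq_some α β x z

theorem SymInv.maps_one {Ω : Type} (x y : Ω) : (1 : SymInv Ω).Maps x y ↔ x = y := by
  change some x = some y ↔ x = y
  simp

/-- The domain of a partial permutation. -/
def SymInv.dom {Ω : Type} (α : SymInv Ω) : Set Ω := {x | ∃ y, α.Maps x y}

/-- The image `Sα` of a set under a partial permutation. -/
def SymInv.image {Ω : Type} (α : SymInv Ω) (S : Set Ω) : Set Ω := {y | ∃ x ∈ S, α.Maps x y}

/-- An ordered partition of `Ω` is encoded by the map `blk` which sends `x` to the index `i_x` of its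
block, so that the block of index `i` is `{y | blk y = i}`. This is the stability of `α` with respect
to the partition: if `x` lies in the domain, then so does the whole block of `x`, and `α` maps the
block of `x` onto the block of `xα`. -/
def IsStable {Ω ι : Type} (blk : Ω → ι) (α : SymInv Ω) : Prop :=
  ∀ x y, α.Maps x y →
    {z | blk z = blk x} ⊆ α.dom ∧ α.image {z | blk z = blk x} = {z | blk z = blk y}

/-- `α` preserves the order of the blocks. -/
def IsBlockMono {Ω ι : Type} [LE ι] (blk : Ω → ι) (α : SymInv Ω) : Prop :=
  ∀ x y x' y', α.Maps x x' → α.Maps y y' → blk x ≤ blk y → blk x' ≤ blk y'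

/-- The monoid of all stable, block order preserving partial permutations of `Ω`. -/
def POIPart {Ω ι : Type} [LE ι] (blk : Ω → ι) : Submonoid (SymInv Ω) where
  carrier := {α | IsStable blk α ∧ IsBlockMono blk α}
  one_mem' := by
    refine ⟨fun x y h => ?_, fun x y x' y' hx hy h => ?_⟩
    · rw [SymInv.maps_one] at h
      subst h
      refine ⟨fun z _ => ⟨z, (SymInv.maps_one z z).2 rfl⟩, ?_⟩
      ext z
      simp [SymInv.image, SymInv.maps_one]
    · rw [SymInv.maps_one] at hx hy
      subst hx hy
      exact h
  mul_mem' := by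
    rintro α β ⟨hα, hα'⟩ ⟨hβ, hβ'⟩
    refine ⟨fun x z h => ?_, fun x y x' y' hx hy h => ?_⟩
    · obtain ⟨y, hxy, hyz⟩ := (SymInv.maps_mul α β x z).1 h
      obtain ⟨h1, h2⟩ := hα x y hxy
      obtain ⟨h3, h4⟩ := hβ y z hyz
      refine ⟨fun u hu => ?_, ?_⟩
      · obtain ⟨v, hv⟩ := h1 hu
        have hvb : v ∈ {w | blk w = blk y} := by rw [← h2]; exact ⟨u, hu, hv⟩
        obtain ⟨w, hw⟩ := h3 hvb
        exact ⟨w, (SymInv.maps_mul α β u w).2 ⟨v, hv, hw⟩⟩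
      · rw [← h4, ← h2]
        ext w
        constructor
        · rintro ⟨u, hu, huw⟩
          obtain ⟨v, hv, hw⟩ := (SymInv.maps_mul α β u w).1 huw
          exact ⟨v, ⟨u, hu, hv⟩, hw⟩
        · rintro ⟨v, ⟨u, hu, hv⟩, hw⟩
          exact ⟨u, hu, (SymInv.maps_mul α β u w).2 ⟨v, hv, hw⟩⟩
    · obtain ⟨a, ha, ha'⟩ := (SymInv.maps_mul α β x x').1 hx
      obtain ⟨b, hb, hb'⟩ := (SymInv.maps_mul α β y y').1 hy
      exact hβ' a b x' y' ha' hb' (hα' x y a b ha hb h)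

/-- `POI_{k×m}`: the case where `Ω` is the chain of `km` elements, partitioned into the `k`
consecutive intervals of size `m`. With `Fin (k * m) = {0, …, km - 1}`, the element `x` lies in the
interval of (zero-based) index `x / m`, which is `Fin.divNat x`. -/
def POI (k m : ℕ) : Submonoid (SymInv (Fin (k * m))) :=
  POIPart (fun x : Fin (k * m) => (Fin.divNat x : Fin k))

/-! ### The standard generators of `POI_{k×m}` -/

/-- The element of the group of units of `POI_{k×m}` which acts on the `i`-th interval as the
permutation `z i` of its `m` points. -/
def unitBar {k m : ℕ} (z : Fin k → Equiv.Perm (Fin m)) : SymInv (Fin (k * m)) :=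
  Equiv.toPEquiv
    ((finProdFinEquiv.symm.trans (Equiv.prodCongrRight z)).trans finProdFinEquiv)

/-- The transposition `a = (1 2)`. -/
def permA {m : ℕ} (hm : 2 ≤ m) : Equiv.Perm (Fin m) :=
  Equiv.swap ⟨0, by omega⟩ ⟨1, by omega⟩

/-- The cycle `b = (1 2 … m)`. -/
def permB (m : ℕ) : Equiv.Perm (Fin m) := finRotate m

/-- The product `c = ab` of `(1 2)` and `(1 2 … m)`: first `a`, then `b`. -/
def permC {m : ℕ} (hm : 2 ≤ m) : Equiv.Perm (Fin m) := (permA hm).trans (permB m)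

/-- The generator `b̄_i` (with `i` zero-based). -/
def bBar (k m : ℕ) (i : Fin k) : SymInv (Fin (k * m)) :=
  unitBar (Function.update (fun _ => 1) i (permB m))

/-- The generator `c̄_i` (with `i` zero-based). -/
def cBar (k : ℕ) {m : ℕ} (hm : 2 ≤ m) (i : Fin k) : SymInv (Fin (k * m)) :=
  unitBar (Function.update (fun _ => 1) i (permC hm))

/-- The graph of the partial permutation `x_i` of `{1, …, k}`, for `0 ≤ i ≤ k - 1`, in terms of
one-based points `p, q`. For `i = 0` it maps `p` to `p - 1`, for `2 ≤ p ≤ k`. For `i ≥ 1` it maps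
`k - i` to `k - i + 1`, is not defined at `k - i + 1`, and fixes all other points. -/
def XGraph (k i p q : ℕ) : Prop :=
  if i = 0 then p = q + 1
  else (p + i = k ∧ q = p + 1) ∨ (p + i ≠ k ∧ p + i ≠ k + 1 ∧ q = p)

theorem XGraph.right_unique {k i p q q' : ℕ} (h : XGraph k i p q) (h' : XGraph k i p q') :
    q = q' := by
  unfold XGraph at h h'
  split_ifs at h h' <;> omega

theorem XGraph.left_unique {k i p p' q : ℕ} (h : XGraph k i p q) (h' : XGraph k i p' q) :
    p = p' := by
  unfold XGraph at h h'
  split_ifs at h h' <;> omega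

open Classical in
/-- The partial permutation with a given graph, for a functional and injective relation `r`. -/
noncomputable def ofGraph {Ω : Type} (r : Ω → Ω → Prop)
    (h₁ : ∀ p q q', r p q → r p q' → q = q') (h₂ : ∀ p p' q, r p q → r p' q → p = p') :
    SymInv Ω where
  toFun p := if h : ∃ q, r p q then some h.choose else none
  invFun q := if h : ∃ p, r p q then some h.choose else none
  inv p q := by
    have hl : q ∈ (if h : ∃ q, r p q then some h.choose else none) ↔ r p q := by
      constructor
      · intro h
        split_ifs at h with hp
        · rw [Option.mem_some_iff] at h
          exact h ▸ hp.choose_spec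
        · simp at h
      · intro hr
        have hp : ∃ q, r p q := ⟨q, hr⟩
        rw [dif_pos hp, Option.mem_some_iff]
        exact h₁ p _ _ hp.choose_spec hr
    have hr : p ∈ (if h : ∃ p, r p q then some h.choose else none) ↔ r p q := by
      constructor
      · intro h
        split_ifs at h with hq
        · rw [Option.mem_some_iff] at h
          exact h ▸ hq.choose_spec
        · simp at h
      · intro hr
        have hq : ∃ p, r p q := ⟨p, hr⟩
        rw [dif_pos hq, Option.mem_some_iff]
        exact h₂ _ _ q hq.choose_spec hr
    exact hr.trans hl.symm

theorem ofGraph_maps {Ω : Type} (r : Ω → Ω → Prop)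
    (h₁ : ∀ p q q', r p q → r p q' → q = q') (h₂ : ∀ p p' q, r p q → r p' q → p = p') (p q : Ω) :
    (ofGraph r h₁ h₂).Maps p q ↔ r p q := by
  classical
  change (if h : ∃ q, r p q then some h.choose else none) = some q ↔ r p q
  constructor
  · intro h
    split_ifs at h with hp
    rw [Option.some_inj] at h
    exact h ▸ hp.choose_spec
  · intro hr
    have hp : ∃ q, r p q := ⟨q, hr⟩
    rw [dif_pos hp, Option.some_inj]
    exact h₁ p _ _ hp.choose_spec hr

/-- The generator `x̄_i`: it maps intervals onto intervals as `x_i` maps points to points, and is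
order preserving on each interval (it keeps the position `x % m = Fin.modNat x` in the interval). -/
noncomputable def xBar (k m : ℕ) (i : Fin k) : SymInv (Fin (k * m)) :=
  ofGraph
    (fun p q => XGraph k i ((Fin.divNat p : Fin k) + 1) ((Fin.divNat q : Fin k) + 1) ∧
      (Fin.modNat p : Fin m) = Fin.modNat q)
    (fun _ _ _ h h' => finProdFinEquiv.symm.injective (Prod.ext
      (Fin.ext (Nat.succ_injective (h.1.right_unique h'.1))) (h.2.symm.trans h'.2)))
    (fun _ _ _ h h' => finProdFinEquiv.symm.injective (Prod.ext
      (Fin.ext (Nat.succ_injective (h.1.left_unique h'.1))) (h.2.trans h'.2.symm)))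

/-! ### The presentation -/

/-- The alphabet `B ∪ C ∪ X`, where `B`, `C` and `X` have `k` letters each. The letter `b_i` with
`1 ≤ i ≤ k` is `Letter.b (i - 1)`, likewise for `c_i`, and `x_i` with `0 ≤ i ≤ k - 1` is
`Letter.x i`. -/
inductive Letter (k : ℕ) : Type
  | b (i : Fin k)
  | c (i : Fin k)
  | x (i : Fin k)

/-- The words over the alphabet `B ∪ C ∪ X`. -/
abbrev Word (k : ℕ) : Type := FreeMonoid (Letter k)

/-- The letter `b_i`, `1 ≤ i ≤ k`, as a word. -/
def b {k : ℕ} (i : ℕ) (h : 1 ≤ i ∧ i ≤ k := by omega) : Word k :=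
  FreeMonoid.of (Letter.b ⟨i - 1, by omega⟩)

/-- The letter `c_i`, `1 ≤ i ≤ k`, as a word. -/
def c {k : ℕ} (i : ℕ) (h : 1 ≤ i ∧ i ≤ k := by omega) : Word k :=
  FreeMonoid.of (Letter.c ⟨i - 1, by omega⟩)

/-- The letter `x_i`, `0 ≤ i ≤ k - 1`, as a word. -/
def x {k : ℕ} (i : ℕ) (h : i < k := by omega) : Word k :=
  FreeMonoid.of (Letter.x ⟨i, h⟩)

/-- The word `x_s x_{s+1} ⋯ x_{t-1}` (empty if `t ≤ s`), for `t ≤ k`. -/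
def xs (k s t : ℕ) : Word k :=
  (((List.finRange k).filter (fun j => s ≤ j.val ∧ j.val < t)).map
    (fun j => FreeMonoid.of (Letter.x j))).prod

/-- The relations `U`, on the letters `b_i`, `c_i`. -/
inductive RelU (k m : ℕ) : Word k → Word k → Prop
  | u1 (i : ℕ) (h : 1 ≤ i ∧ i ≤ k) : RelU k m ((c i * b i ^ (m - 1)) ^ 2) 1
  | u2 (i : ℕ) (h : 1 ≤ i ∧ i ≤ k) : RelU k m (b i ^ m) 1
  | u3 (i : ℕ) (h : 1 ≤ i ∧ i ≤ k) : RelU k m ((b i * c i * b i ^ (m - 1)) ^ (m - 1)) 1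
  | u4 (i : ℕ) (h : 1 ≤ i ∧ i ≤ k) : RelU k m ((c i * b i ^ (m - 2) * c i) ^ 3) 1
  | u5 (i j : ℕ) (h : 1 ≤ i ∧ i ≤ k) (hj : 2 ≤ j ∧ j + 2 ≤ m) :
      RelU k m ((c i * b i ^ (m - j - 1) * c i * b i ^ (j - 1)) ^ 2) 1
  | u6_bb (i j : ℕ) (h : 1 ≤ i ∧ i < j ∧ j ≤ k) : RelU k m (b i * b j) (b j * b i)
  | u6_cc (i j : ℕ) (h : 1 ≤ i ∧ i < j ∧ j ≤ k) : RelU k m (c i * c j) (c j * c i)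
  | u6_bc (i j : ℕ) (hi : 1 ≤ i ∧ i ≤ k) (hj : 1 ≤ j ∧ j ≤ k) (hij : i ≠ j) :
      RelU k m (b i * c j) (c j * b i)

/-- The relations `W`, on the letters `x_i`. -/
inductive RelW (k : ℕ) : Word k → Word k → Prop
  | w1 (i : ℕ) (h : 1 ≤ i ∧ i + 2 ≤ k) : RelW k (x i * x 0) (x 0 * x (i + 1))
  | w2 (i j : ℕ) (h : 2 ≤ i + 1 ∧ i + 1 < j ∧ j + 1 ≤ k) : RelW k (x j * x i) (x i * x j)
  | w3_left (hk : 2 ≤ k) : RelW k (x 0 ^ 2 * x 1) (x 0 ^ 2)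
  | w3_right (hk : 2 ≤ k) : RelW k (x 0 ^ 2) (x (k - 1) * x 0 ^ 2)
  | w4_left (i : ℕ) (h : 1 ≤ i ∧ i + 2 ≤ k) :
      RelW k (x (i + 1) * x i * x (i + 1)) (x (i + 1) * x i)
  | w4_right (i : ℕ) (h : 1 ≤ i ∧ i + 2 ≤ k) :
      RelW k (x (i + 1) * x i) (x i * x (i + 1) * x i)
  | w5 (i : ℕ) (h : i + 1 ≤ k) : RelW k (xs k i k * xs k 0 i * x i) (x i)
  | w6 (i : ℕ) (h : 1 ≤ i ∧ i + 1 ≤ k) : RelW k (xs k (i + 1) k * xs k 0 i * x i ^ 2) (x i ^ 2)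

/-- The relations `U'`, on all letters. -/
inductive RelU' (k m : ℕ) : Word k → Word k → Prop
  | u1_c (hk : 1 ≤ k) : RelU' k m (c 1 * b 1 ^ (m - 1) * x 0) (x 0)
  | u1_b (hk : 1 ≤ k) : RelU' k m (b 1 * x 0) (x 0)
  | u2_c (i : ℕ) (h : 1 ≤ i ∧ i + 1 ≤ k) :
      RelU' k m (x 0 * c i * b i ^ (m - 1)) (c (i + 1) * b (i + 1) ^ (m - 1) * x 0)
  | u2_b (i : ℕ) (h : 1 ≤ i ∧ i + 1 ≤ k) : RelU' k m (x 0 * b i) (b (i + 1) * x 0)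
  | u3_c (i : ℕ) (h : i + 1 ≤ k) :
      RelU' k m (x i * c (k - i) * b (k - i) ^ (m - 1)) (x i)
  | u3_b (i : ℕ) (h : i + 1 ≤ k) : RelU' k m (x i * b (k - i)) (x i)
  | u4_c (i : ℕ) (h : 2 ≤ i ∧ i ≤ k) :
      RelU' k m (c i * b i ^ (m - 1) * x (k - i + 1)) (x (k - i + 1))
  | u4_b (i : ℕ) (h : 2 ≤ i ∧ i ≤ k) : RelU' k m (b i * x (k - i + 1)) (x (k - i + 1))
  | u5_c (i : ℕ) (h : 1 ≤ i ∧ i + 1 ≤ k) :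
      RelU' k m (x i * c (k - i + 1) * b (k - i + 1) ^ (m - 1))
        (c (k - i) * b (k - i) ^ (m - 1) * x i)
  | u5_b (i : ℕ) (h : 1 ≤ i ∧ i + 1 ≤ k) : RelU' k m (x i * b (k - i + 1)) (b (k - i) * x i)
  | u6_c (i j : ℕ) (hi : 1 ≤ i ∧ i + 1 ≤ k) (hj : 1 ≤ j ∧ j ≤ k)
      (hij : j ≠ k - i ∧ j ≠ k - i + 1) :
      RelU' k m (x i * c j * b j ^ (m - 1)) (c j * b j ^ (m - 1) * x i)
  | u6_b (i j : ℕ) (hi : 1 ≤ i ∧ i + 1 ≤ k) (hj : 1 ≤ j ∧ j ≤ k)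
      (hij : j ≠ k - i ∧ j ≠ k - i + 1) : RelU' k m (x i * b j) (b j * x i)

/-- The relations `U ∪ W ∪ U'` of the presentation. -/
def Rel (k m : ℕ) (u v : Word k) : Prop := RelU k m u v ∨ RelW k u v ∨ RelU' k m u v

end POIPresentation

/-!
Every element of `POI_{k×m}` acts on the intervals as an order preserving partial permutation of a
chain of `k` points, and within the intervals as a family of permutations of `m` points. The
presentation glues a presentation of the group of units, `k` copies of the symmetric group, to one of
the monoid of the chain.

*The chain.* The letters `x_i` are recoded so that their action on points does not depend on `k`
(`chainStep`), and `ChainRels` states the relations `W` in any monoid. These make the words `killer`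
into idempotents, one for each point, and a word which is undefined at a point absorbs the idempotent of
that point (`ChainRels.killer_mul_val`). Hence every word can be cancelled from the left in front of
words whose domain lies in its image (`ChainRels.exists_left_inverse`). Words which map the `r` largest
points onto some `r` points have a normal form `ontoWord`, which is preserved when a letter defined on
these points is appended (`ChainRels.onto_mul`). Together, words with the same action have the same
value (`ChainRels.val_eq_of_act_eq`).

*The units.* For fixed `i`, the relations `U` are Moore's relations for `(1 2)` and `(1 2 ⋯ m)`. They
give the Coxeter relations for the conjugates of the transposition, and enumeration of the cosets of
parabolic subgroups shows that the Coxeter relations define the symmetric group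
(`MooreRels.exists_hom`). So the direct power of the symmetric group maps to the presented monoid.

*Gluing.* By `U'`, units can be moved to the left past the letters `x_i`, and a word in the `x_i`
absorbs the units supported outside of its domain. Every element is thus a unit times a word in the
`x_i`; the action on the intervals determines the value of the word, and the action on the positions
determines the unit up to absorbed factors. So the presented monoid embeds into the symmetric inverse
monoid, and its image is all of `POI_{k×m}` because the `x_i` generate the monoid of the chain
(`exists_mulEquiv`).

*The number of relations.* As a relation is a pair of words, it is to be shown that different choices of
the parameters give different pairs. Numbers of letters and sums of their indices separate almost all of
them; for the others the order of the letters is compared.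
-/

namespace POIPresentation

/-! ### Words in the generators of the monoid of the chain -/

/-- The action of the generator of code `j` on the points `1, …, k` of the chain, with `0` standing
for "undefined". The code `0` is that of `x_0`, which maps `p` to `p - 1`, and the code `j ≥ 1` is
that of `x_{k-j}`, which maps `j` to `j + 1` and is undefined at `j + 1`; so coded, the action does
not depend on `k`. -/
def chainStep (j p : ℕ) : ℕ :=
  if j = 0 then p - 1 else if p = j then j + 1 else if p = j + 1 then 0 else p

/-- The action of a word in the codes of the generators, read from left to right. -/
def chainAct (w : List ℕ) (p : ℕ) : ℕ := w.foldl (fun q j => chainStep j q) p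

/-- The word `(t-1) (t-2) ⋯ s`. -/
def descWord (s t : ℕ) : List ℕ := (List.range' s (t - s)).reverse

/-- The word `s (s+1) ⋯ (t-1)`. -/
def ascWord (s t : ℕ) : List ℕ := List.range' s (t - s)

/-- The value of a word. -/
def val {M : Type*} [Monoid M] (g : ℕ → M) (w : List ℕ) : M := (w.map g).prod

@[simp] theorem chainAct_nil (p : ℕ) : chainAct [] p = p := rfl

@[simp] theorem chainAct_cons (j : ℕ) (w : List ℕ) (p : ℕ) :
    chainAct (j :: w) p = chainAct w (chainStep j p) := rfl

theorem chainAct_append (u w : List ℕ) (p : ℕ) :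
    chainAct (u ++ w) p = chainAct w (chainAct u p) := List.foldl_append

@[simp] theorem chainStep_zero_right (j : ℕ) : chainStep j 0 = 0 := by
  unfold chainStep; split_ifs <;> omega

@[simp] theorem chainAct_zero (w : List ℕ) : chainAct w 0 = 0 := by
  induction w with
  | nil => rfl
  | cons j w ih => simpa using ih

theorem chainStep_inj {j p q : ℕ} (h : chainStep j p = chainStep j q) (h0 : chainStep j p ≠ 0) :
    p = q := by
  unfold chainStep at *; split_ifs at * <;> omega

theorem chainAct_inj {w : List ℕ} {p q : ℕ} (h : chainAct w p = chainAct w q)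
    (h0 : chainAct w p ≠ 0) : p = q := by
  induction w generalizing p q with
  | nil => exact h
  | cons j w ih =>
    refine chainStep_inj (ih h h0) fun h1 => ?_
    rw [chainAct_cons, h1, chainAct_zero] at h0
    exact h0 rfl

theorem chainStep_le {k j p : ℕ} (hj : j < k) (hp : p ≤ k) : chainStep j p ≤ k := by
  unfold chainStep; split_ifs <;> omega

theorem chainAct_le {k : ℕ} {w : List ℕ} {p : ℕ} (hw : ∀ j ∈ w, j < k) (hp : p ≤ k) :
    chainAct w p ≤ k := by
  induction w generalizing p with
  | nil => exact hp
  | cons j w ih =>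
    exact ih (fun i hi => hw i (List.mem_cons_of_mem _ hi)) (chainStep_le (hw j (by simp)) hp)

theorem chainStep_lt {j p q : ℕ} (h : p < q) (hq : chainStep j q ≠ 0) :
    chainStep j p < chainStep j q := by
  unfold chainStep at *; split_ifs at * <;> omega

theorem chainAct_lt {w : List ℕ} {p q : ℕ} (h : p < q) (hq : chainAct w q ≠ 0) :
    chainAct w p < chainAct w q := by
  induction w generalizing p q with
  | nil => exact h
  | cons j w ih =>
    refine ih (chainStep_lt h fun h0 => hq ?_) hq
    rw [chainAct_cons, h0, chainAct_zero]

theorem mem_descWord {s t j : ℕ} : j ∈ descWord s t ↔ s ≤ j ∧ j < t := by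
  simp only [descWord, List.mem_reverse, List.mem_range'_1]; omega

theorem mem_ascWord {s t j : ℕ} : j ∈ ascWord s t ↔ s ≤ j ∧ j < t := by
  simp only [ascWord, List.mem_range'_1]; omega

theorem descWord_self (s : ℕ) : descWord s s = [] := by simp [descWord]

theorem ascWord_self (s : ℕ) : ascWord s s = [] := by simp [ascWord]

theorem ascWord_append {s i t : ℕ} (h : s ≤ i) (h' : i ≤ t) :
    ascWord s t = ascWord s i ++ ascWord i t := by
  have := List.range'_append_1 (s := s) (m := i - s) (n := t - i)
  rw [show s + (i - s) = i by omega, show i - s + (t - i) = t - s by omega] at this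
  exact this.symm

theorem descWord_append {s i t : ℕ} (h : s ≤ i) (h' : i ≤ t) :
    descWord s t = descWord i t ++ descWord s i := by
  have := congrArg List.reverse (ascWord_append h h')
  rwa [List.reverse_append] at this

theorem descWord_succ (s : ℕ) : descWord s (s + 1) = [s] := by simp [descWord]

theorem ascWord_succ (s : ℕ) : ascWord s (s + 1) = [s] := by simp [ascWord]

theorem descWord_cons {s t : ℕ} (h : s ≤ t) : descWord s (t + 1) = t :: descWord s t := by
  rw [descWord_append h (Nat.le_succ t), descWord_succ, List.singleton_append]

theorem descWord_concat {s t : ℕ} (h : s < t) : descWord s t = descWord (s + 1) t ++ [s] := by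
  rw [descWord_append (Nat.le_succ s) h, descWord_succ]

section Val

variable {M : Type*} [Monoid M] (g : ℕ → M)

@[simp] theorem val_nil : val g [] = 1 := rfl

@[simp] theorem val_cons (j : ℕ) (w : List ℕ) : val g (j :: w) = g j * val g w := by simp [val]

@[simp] theorem val_append (u w : List ℕ) : val g (u ++ w) = val g u * val g w := by simp [val]

theorem val_replicate_zero (n : ℕ) : val g (List.replicate n 0) = g 0 ^ n := by simp [val]

theorem commute_val {x : M} {w : List ℕ} (h : ∀ j ∈ w, Commute x (g j)) : Commute x (val g w) := by
  induction w with
  | nil => exact Commute.one_right x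
  | cons j w ih =>
    rw [val_cons]
    exact (h j (by simp)).mul_right (ih fun i hi => h i (List.mem_cons_of_mem _ hi))

/-- The idempotent which is undefined at `j` and fixes all other points. -/
def killer (k j : ℕ) : M := val g (descWord 1 j) * g 0 * val g (descWord j k)

/-- The relations `W` in terms of the codes of the generators. -/
structure ChainRels (k : ℕ) : Prop where
  shift : ∀ j, 2 ≤ j → j < k → g j * g 0 = g 0 * g (j - 1)
  comm : ∀ i j, 1 ≤ i → i + 2 ≤ j → j < k → Commute (g i) (g j)
  zero_last : g 0 * g 0 * g (k - 1) = g 0 * g 0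
  one_zero : g 1 * (g 0 * g 0) = g 0 * g 0
  braid_left : ∀ j, 1 ≤ j → j + 1 < k → g j * g (j + 1) * g j = g j * g (j + 1)
  braid_right : ∀ j, 1 ≤ j → j + 1 < k → g (j + 1) * g j * g (j + 1) = g j * g (j + 1)
  zero_desc : g 0 * val g (descWord 1 k) * g 0 = g 0
  killer_succ : ∀ j, 1 ≤ j → j < k → val g (descWord 1 (j + 1)) * g 0 * val g (descWord j k) = g j
  killer_self : ∀ j, 1 ≤ j → j < k → killer g k j * g j = g j * g j

namespace ChainRels

variable {g} {k : ℕ} (h : ChainRels g k)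

include h

theorem commute {i j : ℕ} (hi : 1 ≤ i) (hj : 1 ≤ j) (hik : i < k) (hjk : j < k)
    (hij : i + 2 ≤ j ∨ j + 2 ≤ i) : Commute (g i) (g j) := by
  rcases hij with hij | hij
  · exact h.comm i j hi hij hjk
  · exact (h.comm j i hj hij hik).symm

theorem commute_desc {i s t : ℕ} (hi : 1 ≤ i) (hik : i < k) (hs : 1 ≤ s) (ht : t ≤ k)
    (hij : i + 2 ≤ s ∨ t < i) : Commute (g i) (val g (descWord s t)) :=
  commute_val g fun j hj => by
    rw [mem_descWord] at hj
    exact h.commute hi (by omega) hik (by omega) (by omega)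

theorem commute_asc {i s t : ℕ} (hi : 1 ≤ i) (hik : i < k) (hs : 1 ≤ s) (ht : t ≤ k)
    (hij : i + 2 ≤ s ∨ t < i) : Commute (g i) (val g (ascWord s t)) :=
  commute_val g fun j hj => by
    rw [mem_ascWord] at hj
    exact h.commute hi (by omega) hik (by omega) (by omega)

theorem desc_mul {i s t : ℕ} (hs : 1 ≤ s) (hsi : s < i) (hit : i < t) (ht : t ≤ k) :
    val g (descWord s t) * g i = g (i - 1) * val g (descWord s t) := by
  obtain ⟨i, rfl⟩ : ∃ n, i = n + 1 := ⟨i - 1, by omega⟩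
  have h1 : descWord s t = descWord (i + 2) t ++ (i + 1) :: i :: descWord s i := by
    rw [descWord_append (show s ≤ i + 2 by omega) (show i + 2 ≤ t by omega),
      descWord_cons (by omega), descWord_cons (by omega)]
  have c1 := h.commute_desc (i := i + 1) (s := s) (t := i) (by omega) (by omega) hs (by omega)
    (by omega)
  have c2 := h.commute_desc (i := i) (s := i + 2) (t := t) (by omega) (by omega) (by omega) ht
    (by omega)
  have b1 := h.braid_left i (by omega) (by omega)
  have b2 := h.braid_right i (by omega) (by omega)
  simp only [h1, val_append, val_cons, Nat.add_sub_cancel]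
  calc val g (descWord (i + 2) t) * (g (i + 1) * (g i * val g (descWord s i))) * g (i + 1)
      = val g (descWord (i + 2) t) * (g (i + 1) * g i) * (val g (descWord s i) * g (i + 1)) := by
        simp only [mul_assoc]
    _ = val g (descWord (i + 2) t) * (g (i + 1) * g i * g (i + 1)) * val g (descWord s i) := by
        rw [← c1.eq]; simp only [mul_assoc]
    _ = val g (descWord (i + 2) t) * g i * (g (i + 1) * g i * val g (descWord s i)) := by
        rw [b2, ← b1]; simp only [mul_assoc]
    _ = _ := by rw [← c2.eq]; simp only [mul_assoc]

theorem shift' {j : ℕ} (hj : 1 ≤ j) (hjk : j + 1 < k) : g 0 * g j = g (j + 1) * g 0 :=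
  (h.shift (j + 1) (by omega) hjk).symm

theorem killer_commute {i j : ℕ} (hi : 1 ≤ i) (hik : i < k) (hj : 1 ≤ j) (hjk : j ≤ k)
    (h1 : i ≠ j) (h2 : i + 1 ≠ j) : killer g k j * g i = g i * killer g k j := by
  unfold killer
  rcases lt_or_gt_of_ne h1 with hlt | hgt
  · have c1 := h.commute_desc (i := i) (s := j) (t := k) hi hik hj le_rfl (by omega)
    rw [mul_assoc, ← c1.eq, mul_assoc, ← mul_assoc (g 0), h.shift' hi (by omega), mul_assoc,
      ← mul_assoc, h.desc_mul le_rfl (by omega) (by omega) (by omega), Nat.add_sub_cancel]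
    simp only [mul_assoc]
  · have c1 := h.commute_desc (i := i) (s := 1) (t := j) hi hik le_rfl (by omega) (by omega)
    rw [mul_assoc, h.desc_mul hj hgt hik le_rfl, mul_assoc, ← mul_assoc (g 0),
      h.shift' (by omega) (by omega), Nat.sub_add_cancel hi, mul_assoc, ← mul_assoc, ← c1.eq]
    simp only [mul_assoc]

theorem killer_succ_mul {j : ℕ} (hj : 1 ≤ j) (hjk : j < k) : killer g k (j + 1) * g j = g j := by
  conv_rhs => rw [← h.killer_succ j hj hjk]
  rw [killer, mul_assoc _ _ (g j), descWord_concat hjk]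
  simp

omit h in
theorem mul_desc_succ {j : ℕ} (hj : 1 ≤ j) :
    g j * (val g (descWord 1 j) * g 0 * val g (descWord (j + 1) k)) = killer g k (j + 1) := by
  rw [killer, descWord_cons hj]
  simp [mul_assoc]

omit h in
theorem desc_mul_self {j : ℕ} (hjk : j < k) :
    val g (descWord 1 j) * g 0 * val g (descWord (j + 1) k) * g j = killer g k j := by
  rw [killer, descWord_concat hjk]
  simp [mul_assoc]

theorem killer_mul_killer {j : ℕ} (hj : 1 ≤ j) (hjk : j < k) :
    killer g k j * killer g k j = killer g k j := by
  have h1 := h.killer_succ_mul hj hjk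
  rw [← mul_desc_succ hj] at h1
  conv_lhs => rw [← desc_mul_self hjk, mul_assoc, ← mul_assoc (g j), h1]
  exact desc_mul_self hjk

theorem cube {j : ℕ} (hj : 1 ≤ j) (hjk : j < k) : g j * g j * g j = g j * g j := by
  have h1 := h.killer_self j hj hjk
  calc g j * g j * g j = killer g k j * (killer g k j * g j) := by
        rw [h1, ← mul_assoc, h1]
    _ = g j * g j := by rw [← mul_assoc, h.killer_mul_killer hj hjk, h1]

theorem sq_killer {j : ℕ} (hj : 1 ≤ j) (hjk : j < k) :
    g j * g j * killer g k (j + 1) = g j * killer g k (j + 1) := by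
  rw [← mul_desc_succ hj, ← mul_assoc (g j * g j), h.cube hj hjk, mul_assoc]

theorem killer_one_zero : killer g k 1 * g 0 = g 0 := by
  rw [killer, descWord_self, val_nil, one_mul, h.zero_desc]

theorem desc_shift {s t : ℕ} (hs : 1 ≤ s) (ht : t < k) :
    val g (descWord (s + 1) (t + 1)) * g 0 = g 0 * val g (descWord s t) := by
  rcases le_or_gt t s with hst | hst
  · simp [descWord, Nat.sub_eq_zero_of_le hst]
  · induction t, hst using Nat.le_induction with
    | base => simpa [descWord_succ] using h.shift (s + 1) (by omega) (by omega)
    | succ t hst ih =>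
      rw [descWord_cons (show s + 1 ≤ t + 1 by omega), descWord_cons (show s ≤ t by omega),
        val_cons, val_cons, mul_assoc, ih (by omega), ← mul_assoc, h.shift (t + 1) (by omega) ht, Nat.add_sub_cancel, mul_assoc]

theorem asc_shift {s t : ℕ} (hs : 1 ≤ s) (ht : t < k) :
    val g (ascWord (s + 1) (t + 1)) * g 0 = g 0 * val g (ascWord s t) := by
  rcases le_or_gt t s with hst | hst
  · simp [ascWord, Nat.sub_eq_zero_of_le hst]
  · induction t, hst using Nat.le_induction with
    | base => simpa [ascWord_succ] using h.shift (s + 1) (by omega) (by omega)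
    | succ t hst ih =>
      rw [ascWord_append (show s + 1 ≤ t + 1 by omega) (Nat.le_succ _),
        ascWord_append (show s ≤ t by omega) (Nat.le_succ _),
        ascWord_succ, ascWord_succ, val_append, val_append, val_cons, val_cons, val_nil, mul_one,
        mul_one, mul_assoc, h.shift (t + 1) (by omega) ht, ← mul_assoc, ih (by omega),
        Nat.add_sub_cancel, mul_assoc]

theorem killer_zero {j : ℕ} (hj : 1 ≤ j) (hjk : j < k) :
    killer g k (j + 1) * g 0 = g 0 * killer g k j := by
  have h1 : val g (descWord 1 (j + 1)) * (g 0 * g 0) = val g (descWord 2 (j + 1)) * (g 0 * g 0) := by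
    rw [descWord_concat (show 1 < j + 1 by omega), val_append, val_cons, val_nil, mul_one,
      mul_assoc, h.one_zero]
  have h2 : g 0 * g 0 * val g (descWord j k) = g 0 * g 0 * val g (descWord j (k - 1)) := by
    obtain ⟨n, rfl⟩ : ∃ n, k = n + 1 := ⟨k - 1, by omega⟩
    rw [descWord_cons (by omega), val_cons, ← mul_assoc]
    have := h.zero_last
    simp only [Nat.add_sub_cancel] at *
    rw [this]
  have h3 := h.desc_shift (s := j) (t := k - 1) hj (by omega)
  rw [Nat.sub_add_cancel (by omega)] at h3
  have h4 := h.desc_shift (s := 1) (t := j) le_rfl hjk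
  calc killer g k (j + 1) * g 0
      = val g (descWord 1 (j + 1)) * (g 0 * g 0) * val g (descWord j (k - 1)) := by
        rw [killer, mul_assoc, h3]; simp only [mul_assoc]
    _ = val g (descWord 2 (j + 1)) * (g 0 * g 0 * val g (descWord j k)) := by
        rw [h1, h2, mul_assoc]
    _ = g 0 * killer g k j := by
        rw [← mul_assoc, ← mul_assoc, h4, killer]; simp only [mul_assoc]

/-- A word which is undefined at `j` absorbs the idempotent `killer g k j`. -/
theorem killer_mul_val {w : List ℕ} (hw : ∀ i ∈ w, i < k) {j : ℕ} (hj : 1 ≤ j) (hjk : j ≤ k)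
    (h0 : chainAct w j = 0) : killer g k j * val g w = val g w := by
  induction w generalizing j with
  | nil => simp at h0; omega
  | cons i w ih =>
    have hik : i < k := hw i (by simp)
    replace ih := @ih fun i hi => hw i (List.mem_cons_of_mem _ hi)
    rw [val_cons, ← mul_assoc]
    rw [chainAct_cons, chainStep] at h0
    by_cases hi : i = 0
    · subst hi
      rw [if_pos rfl] at h0
      rcases eq_or_lt_of_le hj with rfl | hj1
      · rw [h.killer_one_zero]
      · obtain ⟨j, rfl⟩ : ∃ n, j = n + 1 := ⟨j - 1, by omega⟩
        rw [Nat.add_sub_cancel] at h0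
        rw [h.killer_zero (by omega) (by omega), mul_assoc, ih (by omega) (by omega) h0]
    · rw [if_neg hi] at h0
      by_cases h1 : j = i
      · subst h1
        rw [if_pos rfl] at h0
        -- Since `(g j)³ = (g j)²`, also `(g j)² * killer (j + 1) = g j * killer (j + 1)`.
        have h2 := ih (by omega) (by omega) h0
        rw [h.killer_self j hj hik, ← h2, ← mul_assoc, h.sq_killer hj hik, mul_assoc]
      · rw [if_neg h1] at h0
        by_cases h2 : j = i + 1
        · subst h2
          rw [h.killer_succ_mul (by omega) hik]
        · rw [if_neg h2] at h0
          rw [h.killer_commute (by omega) hik hj hjk (Ne.symm h1) (Ne.symm h2), mul_assoc,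
            ih hj hjk h0]

/-- Each word `u` has a left inverse on the words whose domain lies in the image of `u`. -/
theorem exists_left_inverse {u : List ℕ} (hu : ∀ j ∈ u, j < k) :
    ∃ K : M, ∀ w : List ℕ, (∀ j ∈ w, j < k) →
      (∀ p, 1 ≤ p → p ≤ k → chainAct w p ≠ 0 → ∃ q ≤ k, chainAct u q = p) →
      K * (val g u * val g w) = val g w := by
  induction u with
  | nil => exact ⟨1, fun w _ _ => by simp⟩
  | cons j u ih =>
    have hjk : j < k := hu j (by simp)
    have hu' : ∀ j ∈ u, j < k := fun i hi => hu i (List.mem_cons_of_mem _ hi)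
    obtain ⟨K, hK⟩ := ih hu'
    -- The point `n` is the one outside the image of the first letter.
    obtain ⟨z, n, hn1, hnk, hz, hn⟩ : ∃ (z : M) (n : ℕ), 1 ≤ n ∧ n ≤ k ∧
        z * g j = killer g k n ∧ ∀ q ≤ k, chainStep j q ≠ n := by
      by_cases hj : j = 0
      · subst hj
        refine ⟨val g (descWord 1 k), k, hjk, le_rfl, ?_, fun q hq => ?_⟩
        · rw [killer, descWord_self, val_nil, mul_one]
        · simp only [chainStep, if_true]; omega
      · refine ⟨_, j, by omega, hjk.le, desc_mul_self hjk, fun q hq => ?_⟩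
        unfold chainStep; split_ifs <;> omega
    refine ⟨K * z, fun w hw hd => ?_⟩
    have hd' : ∀ p, 1 ≤ p → p ≤ k → chainAct w p ≠ 0 → ∃ q ≤ k, chainAct u q = p := by
      intro p hp1 hpk hp
      obtain ⟨q, hq, hqp⟩ := hd p hp1 hpk hp
      exact ⟨chainStep j q, chainStep_le hjk hq, hqp⟩
    have hzero : chainAct (u ++ w) n = 0 := by
      by_contra hne
      rw [chainAct_append] at hne
      have h1 : chainAct u n ≠ 0 := fun h1 => hne (by rw [h1, chainAct_zero])
      obtain ⟨q, hq, hqp⟩ := hd (chainAct u n) (by omega) (chainAct_le hu' hnk) hne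
      exact hn q hq (chainAct_inj hqp.symm h1).symm
    have hkill := h.killer_mul_val (w := u ++ w)
      (fun i hi => (List.mem_append.1 hi).elim (hu' i) (hw i)) hn1 hnk hzero
    rw [val_append] at hkill
    calc K * z * (val g (j :: u) * val g w) = K * (z * g j * (val g u * val g w)) := by
          rw [val_cons]; simp only [mul_assoc]
      _ = val g w := by rw [hz, hkill, hK w hw hd']

end ChainRels
end Val

/-! ### The presentation of the monoid of the chain -/

/-- For a decreasing list `l = [a_r, …, a_1]`, the word whose value maps `s - 1 + i` to `a_i`, as the
product of the words `(s - 1 + i) ⋯ (a_i - 1)` for `i = r, …, 1`: the largest point moves first. -/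
def upWord (s : ℕ) : List ℕ → List ℕ
  | [] => []
  | a :: l => ascWord (l.length + s) a ++ upWord s l

/-- For a decreasing list `l` of `r` points of the chain of length `k`, the word whose value is the
order preserving bijection from the `r` largest points onto the points of `l`. -/
def ontoWord (k : ℕ) (l : List ℕ) : List ℕ := List.replicate (k - l.length) 0 ++ upWord 1 l

theorem mem_upWord {s i : ℕ} {l : List ℕ} (hi : i ∈ upWord s l) : s ≤ i ∧ ∃ a ∈ l, i < a := by
  induction l with
  | nil => simp [upWord] at hi
  | cons a l ih =>
    rcases List.mem_append.1 hi with hi | hi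
    · rw [mem_ascWord] at hi
      exact ⟨by omega, a, by simp, hi.2⟩
    · obtain ⟨h1, b, hb, hib⟩ := ih hi
      exact ⟨h1, b, List.mem_cons_of_mem _ hb, hib⟩

/-- A decreasing list of points in the interval `[s, t)` has at most `t - s` entries. -/
theorem length_add_le {l : List ℕ} (hl : l.Pairwise (· > ·)) {s t : ℕ} (hst : s ≤ t)
    (h : ∀ a ∈ l, s ≤ a ∧ a < t) : l.length + s ≤ t := by
  induction l generalizing t with
  | nil => simpa using hst
  | cons a l ih =>
    rw [List.pairwise_cons] at hl
    have ha := h a (by simp)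
    have := ih hl.2 (t := a) ha.1
      fun b hb => ⟨(h b (List.mem_cons_of_mem _ hb)).1, hl.1 b hb⟩
    simp only [List.length_cons]
    omega

theorem ontoWord_lt {k : ℕ} (hk : 0 < k) {l : List ℕ} (h : ∀ a ∈ l, a ≤ k) :
    ∀ j ∈ ontoWord k l, j < k := by
  intro j hj
  rcases List.mem_append.1 hj with hj | hj
  · rw [List.eq_of_mem_replicate hj]; exact hk
  · obtain ⟨-, a, ha, hja⟩ := mem_upWord hj
    exact hja.trans_le (h a ha)

theorem chainAct_replicate (n p : ℕ) : chainAct (List.replicate n 0) p = p - n := by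
  induction n generalizing p with
  | zero => rfl
  | succ n ih =>
    rw [List.replicate_succ, chainAct_cons, ih, chainStep, if_pos rfl]; omega

theorem chainAct_eq_self {w : List ℕ} {p : ℕ} (h : ∀ j ∈ w, j ≠ 0 ∧ p ≠ j ∧ p ≠ j + 1) :
    chainAct w p = p := by
  induction w with
  | nil => rfl
  | cons j w ih =>
    have hj := h j (by simp)
    rw [chainAct_cons, chainStep, if_neg hj.1, if_neg hj.2.1, if_neg hj.2.2]
    exact ih fun i hi => h i (List.mem_cons_of_mem _ hi)

theorem chainAct_ascWord {s t : ℕ} (hs : 1 ≤ s) (hst : s ≤ t) : chainAct (ascWord s t) s = t := by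
  induction t, hst using Nat.le_induction with
  | base => simp [ascWord_self]
  | succ t hst ih =>
    rw [ascWord_append hst (Nat.le_succ t), chainAct_append, ih, ascWord_succ, chainAct_cons,
      chainStep, if_neg (by omega), if_pos rfl, chainAct_nil]

theorem chainAct_descWord {s t p : ℕ} (hs : 1 ≤ s) (hst : s ≤ t) : chainAct (descWord s t) p =
    if s ≤ p ∧ p < t then p + 1 else if p = t ∧ s < t then 0 else p := by
  induction t, hst using Nat.le_induction generalizing p with
  | base => rw [descWord_self]; simp
  | succ t hst ih =>
    rw [descWord_cons hst, chainAct_cons, ih, chainStep]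
    split_ifs <;> omega

theorem map_chainAct_upWord {l : List ℕ} (hl : l.Pairwise (· > ·)) (h : ∀ a ∈ l, 1 ≤ a) :
    (descWord 1 (l.length + 1)).map (chainAct (upWord 1 l)) = l := by
  induction l with
  | nil => rfl
  | cons a l ih =>
    rw [List.pairwise_cons] at hl
    have h' : ∀ b ∈ l, 1 ≤ b := fun b hb => h b (List.mem_cons_of_mem _ hb)
    have ha : l.length + 1 ≤ a :=
      length_add_le hl.2 (h a (by simp)) fun b hb => ⟨h' b hb, hl.1 b hb⟩
    rw [List.length_cons, descWord_cons (by omega), List.map_cons]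
    congr 1
    · rw [upWord, chainAct_append, chainAct_ascWord (by omega) ha]
      refine chainAct_eq_self fun j hj => ?_
      obtain ⟨h1, b, hb, hjb⟩ := mem_upWord hj
      have := hl.1 b hb
      omega
    · conv_rhs => rw [← ih hl.2 h']
      refine List.map_congr_left fun p hp => ?_
      rw [mem_descWord] at hp
      rw [upWord, chainAct_append]
      congr 1
      refine chainAct_eq_self fun j hj => ?_
      rw [mem_ascWord] at hj
      omega

theorem map_chainAct_ontoWord {k : ℕ} {l : List ℕ} (hl : l.Pairwise (· > ·))
    (h : ∀ a ∈ l, 1 ≤ a ∧ a ≤ k) :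
    ((descWord 1 (l.length + 1)).map (· + (k - l.length))).map (chainAct (ontoWord k l)) = l := by
  conv_rhs => rw [← map_chainAct_upWord hl fun a ha => (h a ha).1]
  rw [List.map_map]
  refine List.map_congr_left fun p _ => ?_
  rw [Function.comp_apply, ontoWord, chainAct_append, chainAct_replicate, Nat.add_sub_cancel]

/-- Every word has an inverse word. -/
theorem exists_inverse_word {k : ℕ} (hk : 2 ≤ k) {u : List ℕ} (hu : ∀ j ∈ u, j < k) :
    ∃ v : List ℕ, (∀ j ∈ v, j < k) ∧ ∀ p q, p ≤ k → q ≤ k → p ≠ 0 → q ≠ 0 →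
      (chainAct v q = p ↔ chainAct u p = q) := by
  induction u with
  | nil => exact ⟨[], by simp, fun p q _ _ _ _ => by simp [eq_comm]⟩
  | cons j u ih =>
    have hjk : j < k := hu j (by simp)
    obtain ⟨v, hv, hvu⟩ := ih fun i hi => hu i (List.mem_cons_of_mem _ hi)
    obtain ⟨z, hz, hzj⟩ : ∃ z : List ℕ, (∀ i ∈ z, i < k) ∧ ∀ p q, p ≤ k → q ≤ k → p ≠ 0 → q ≠ 0 →
        (chainAct z q = p ↔ chainStep j p = q) := by
      by_cases hj : j = 0
      · subst hj
        refine ⟨descWord 1 k, fun i hi => (mem_descWord.1 hi).2, fun p q hp hq hp0 hq0 => ?_⟩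
        rw [chainAct_descWord le_rfl hjk, chainStep, if_pos rfl]
        split_ifs <;> omega
      · refine ⟨descWord 1 j ++ 0 :: descWord (j + 1) k, fun i hi => ?_,
          fun p q hp hq hp0 hq0 => ?_⟩
        · simp only [List.mem_append, List.mem_cons, mem_descWord] at hi
          omega
        · rw [chainAct_append, chainAct_cons, chainAct_descWord le_rfl (by omega),
            chainAct_descWord (by omega) hjk, chainStep, chainStep, if_pos rfl, if_neg hj]
          split_ifs <;> omega
    refine ⟨v ++ z, fun i hi => (List.mem_append.1 hi).elim (hv i) (hz i),
      fun p q hp hq hp0 hq0 => ?_⟩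
    rw [chainAct_append, chainAct_cons]
    constructor
    · intro h1
      have hne : chainAct v q ≠ 0 := fun h0 => hp0 (by rw [← h1, h0, chainAct_zero])
      have hle := chainAct_le hv hq
      rw [(hzj p _ hp hle hp0 hne).1 h1]
      exact (hvu _ q hle hq hne hq0).1 rfl
    · intro h1
      have hne : chainStep j p ≠ 0 := fun h0 => hq0 (by rw [← h1, h0, chainAct_zero])
      have hle := chainStep_le hjk hp
      rw [(hvu _ q hle hq hne hq0).2 h1]
      exact (hzj p _ hp hle hp0 hne).2 rfl

/-- The points of the chain at which `f` is defined, in decreasing order. -/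
def support (k : ℕ) (f : ℕ → ℕ) : List ℕ := (descWord 1 (k + 1)).filter (f · ≠ 0)

theorem mem_support {k : ℕ} {f : ℕ → ℕ} {p : ℕ} :
    p ∈ support k f ↔ (1 ≤ p ∧ p ≤ k) ∧ f p ≠ 0 := by
  simp only [support, List.mem_filter, mem_descWord, Nat.lt_succ_iff, decide_eq_true_eq]

theorem pairwise_support (k : ℕ) (f : ℕ → ℕ) : (support k f).Pairwise (· > ·) := by
  refine List.Pairwise.filter _ ?_
  rw [descWord, List.pairwise_reverse]
  exact List.pairwise_lt_range'

/-- The generators generate the monoid of the order preserving partial permutations. -/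
theorem exists_word {k : ℕ} (hk : 2 ≤ k) {f : ℕ → ℕ} (hf : ∀ p, 1 ≤ p → p ≤ k → f p ≤ k)
    (hmono : ∀ p q, 1 ≤ p → q ≤ k → p < q → f p ≠ 0 → f q ≠ 0 → f p < f q) :
    ∃ w : List ℕ, (∀ j ∈ w, j < k) ∧ ∀ p, 1 ≤ p → p ≤ k → chainAct w p = f p := by
  have hl : (support k f).Pairwise (· > ·) := pairwise_support k f
  have hl' : ((support k f).map f).Pairwise (· > ·) := by
    rw [List.pairwise_map]
    refine hl.imp_of_mem fun {a b} ha hb hab => ?_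
    rw [mem_support] at ha hb
    exact hmono b a hb.1.1 ha.1.2 hab hb.2 ha.2
  have hm : ∀ a ∈ support k f, 1 ≤ a ∧ a ≤ k := fun a ha => (mem_support.1 ha).1
  have hm' : ∀ a ∈ (support k f).map f, 1 ≤ a ∧ a ≤ k := by
    intro a ha
    obtain ⟨p, hp, rfl⟩ := List.mem_map.1 ha
    rw [mem_support] at hp
    exact ⟨Nat.one_le_iff_ne_zero.2 hp.2, hf p hp.1.1 hp.1.2⟩
  have hu := ontoWord_lt (k := k) (by omega) fun a ha => (hm a ha).2
  have hv := ontoWord_lt (k := k) (by omega) fun a ha => (hm' a ha).2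
  obtain ⟨u', hu', huu'⟩ := exists_inverse_word hk hu
  have e1 := map_chainAct_ontoWord hl hm
  have e2 := map_chainAct_ontoWord hl' hm'
  have hlen : (support k f).length + 1 ≤ k + 1 :=
    length_add_le hl (by omega) fun a ha => ⟨(hm a ha).1, Nat.lt_succ_of_le (hm a ha).2⟩
  set u := ontoWord k (support k f)
  set v := ontoWord k ((support k f).map f)
  rw [List.length_map] at e2
  set base := (descWord 1 ((support k f).length + 1)).map (· + (k - (support k f).length))
  have e3 : base.map (chainAct v) = base.map (f ∘ chainAct u) := by
    rw [e2, ← List.map_map, e1]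
  rw [List.map_inj_left] at e3
  have hbase : ∀ q ≤ k, chainAct u q ≠ 0 → q ∈ base := by
    intro q hq hne
    change chainAct (List.replicate _ 0 ++ upWord 1 (support k f)) q ≠ 0 at hne
    rw [chainAct_append, chainAct_replicate] at hne
    have hq' : q - (k - (support k f).length) ≠ 0 := fun h0 => hne (by rw [h0, chainAct_zero])
    refine List.mem_map.2 ⟨q - (k - (support k f).length), ?_, by omega⟩
    rw [mem_descWord]
    omega
  refine ⟨u' ++ v, fun i hi => (List.mem_append.1 hi).elim (hu' i) (hv i), fun p hp1 hpk => ?_⟩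
  rw [chainAct_append]
  by_cases hp : f p = 0
  · rw [hp]
    by_contra hne
    have hne' : chainAct u' p ≠ 0 := fun h0 => hne (by rw [h0, chainAct_zero])
    have hle := chainAct_le hu' hpk
    have h1 := (huu' _ p hle hpk hne' (by omega)).1 rfl
    have h2 := hbase _ hle (by omega)
    have h3 : chainAct u (chainAct u' p) ∈ base.map (chainAct u) := List.mem_map_of_mem h2
    rw [e1, h1, mem_support] at h3
    exact h3.2 hp
  · have h1 : p ∈ base.map (chainAct u) := by rw [e1, mem_support]; exact ⟨⟨hp1, hpk⟩, hp⟩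
    obtain ⟨q, hq, rfl⟩ := List.mem_map.1 h1
    have hq' : 1 ≤ q ∧ q ≤ k := by
      obtain ⟨i, hi, rfl⟩ := List.mem_map.1 hq
      rw [mem_descWord] at hi
      omega
    rw [(huu' q _ hq'.2 hpk (by omega) (by omega)).2 rfl]
    exact e3 q hq

namespace ChainRels

variable {M : Type*} [Monoid M] {g : ℕ → M} {k : ℕ} (h : ChainRels g k)

include h

theorem zero_pow_mul {n j : ℕ} (hn : 2 ≤ n) (hj : 1 ≤ j) (hjk : j < k) (hjn : k + 1 ≤ j + n) :
    g 0 ^ n * g j = g 0 ^ n := by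
  induction n, hn using Nat.le_induction generalizing j with
  | base =>
    obtain rfl : j = k - 1 := by omega
    rw [pow_two, h.zero_last]
  | succ n hn ih =>
    by_cases hj' : j + 1 < k
    · rw [pow_succ, mul_assoc, h.shift' hj hj', ← mul_assoc, ih (by omega) hj' (by omega)]
    · obtain rfl : j = k - 1 := by omega
      obtain ⟨n, rfl⟩ : ∃ i, n = i + 1 := ⟨n - 1, by omega⟩
      rw [pow_succ, pow_succ, mul_assoc (g 0 ^ n), mul_assoc, h.zero_last]

theorem zero_pow_desc {r : ℕ} (hr : r < k) :
    g 0 ^ (k - r) * (val g (descWord 1 (r + 1)) * g 0) = g 0 ^ (k - r) := by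
  have h1 : g 0 ^ (k - r) * val g (descWord (r + 1) k) = g 0 ^ (k - r) := by
    have : ∀ w : List ℕ, (∀ j ∈ w, r + 1 ≤ j ∧ j < k) → g 0 ^ (k - r) * val g w = g 0 ^ (k - r) := by
      intro w hw
      induction w with
      | nil => simp
      | cons j w ih =>
        have hj := hw j (by simp)
        rw [val_cons, ← mul_assoc, h.zero_pow_mul (by omega) (by omega) hj.2 (by omega),
          ih fun i hi => hw i (List.mem_cons_of_mem _ hi)]
    exact this _ fun j hj => mem_descWord.1 hj
  have h2 := h.zero_desc
  rw [descWord_append (show 1 ≤ r + 1 by omega) hr, val_append] at h2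
  obtain ⟨n, hn⟩ : ∃ n, k - r = n + 1 := ⟨k - r - 1, by omega⟩
  conv_lhs => rw [← h1]
  rw [hn, pow_succ]
  simp only [mul_assoc] at h2 ⊢
  rw [h2]

theorem up_split {l : List ℕ} (hl : l.Pairwise (· > ·)) (hm : ∀ a ∈ l, 2 ≤ a ∧ a ≤ k) :
    val g (upWord 1 l) = val g (descWord 1 (l.length + 1)) * val g (upWord 2 l) := by
  induction l with
  | nil => simp [upWord, descWord_self]
  | cons a l ih =>
    rw [List.pairwise_cons] at hl
    have hm' : ∀ b ∈ l, 2 ≤ b ∧ b ≤ k := fun b hb => hm b (List.mem_cons_of_mem _ hb)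
    have ha := hm a (by simp)
    have hlen : l.length + 2 ≤ a :=
      length_add_le hl.2 ha.1 fun b hb => ⟨(hm' b hb).1, hl.1 b hb⟩
    have hc : Commute (val g (ascWord (l.length + 2) a)) (val g (descWord 1 (l.length + 1))) := by
      refine commute_val g fun j hj => ?_
      rw [mem_descWord] at hj
      exact (h.commute_asc (s := l.length + 2) (t := a) hj.1 (by omega) (by omega) ha.2
        (by omega)).symm
    rw [upWord, val_append, ih hl.2 hm', ascWord_append (Nat.le_succ _) hlen, ascWord_succ,
      List.length_cons, descWord_cons (show 1 ≤ l.length + 1 by omega), upWord]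
    simp only [val_append, val_cons, val_nil, mul_one]
    calc g (l.length + 1) * val g (ascWord (l.length + 2) a) *
          (val g (descWord 1 (l.length + 1)) * val g (upWord 2 l))
        = g (l.length + 1) * (val g (ascWord (l.length + 2) a) *
          val g (descWord 1 (l.length + 1))) * val g (upWord 2 l) := by simp only [mul_assoc]
      _ = _ := by rw [hc.eq]; simp only [mul_assoc]

theorem up_shift {l : List ℕ} (hm : ∀ a ∈ l, 1 ≤ a ∧ a ≤ k) :
    val g (upWord 2 l) * g 0 = g 0 * val g (upWord 1 (l.map (· - 1))) := by
  induction l with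
  | nil => simp [upWord]
  | cons a l ih =>
    have ha := hm a (by simp)
    obtain ⟨a, rfl⟩ : ∃ n, a = n + 1 := ⟨a - 1, by omega⟩
    rw [upWord, List.map_cons, upWord, val_append, val_append, mul_assoc,
      ih fun b hb => hm b (List.mem_cons_of_mem _ hb), ← mul_assoc,
      h.asc_shift (s := l.length + 1) (by omega) (by omega), mul_assoc, List.length_map,
      Nat.add_sub_cancel]

theorem up_commute {l : List ℕ} {j : ℕ} (hj : 1 ≤ j) (hjk : j < k) (hm : ∀ a ∈ l, a < j) :
    Commute (g j) (val g (upWord 1 l)) := by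
  refine commute_val g fun i hi => ?_
  obtain ⟨h1, a, ha, hia⟩ := mem_upWord hi
  have := hm a ha
  exact h.commute hj h1 hjk (by omega) (by omega)

theorem asc_absorb {j s t : ℕ} (hs : 1 ≤ s) (hsj : s ≤ j) (hjt : j + 1 < t) (ht : t ≤ k) :
    val g (ascWord s t) * g j = val g (ascWord s t) := by
  have hc := h.commute_asc (i := j) (s := j + 2) (t := t) (by omega) (by omega) (by omega) ht
    (by omega)
  have hw : ascWord s t = ascWord s j ++ (ascWord j (j + 2) ++ ascWord (j + 2) t) := by
    rw [← ascWord_append (by omega) (by omega), ← ascWord_append (by omega) (by omega)]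
  have hw' : ascWord j (j + 2) = [j, j + 1] := by
    rw [ascWord_append (Nat.le_succ j) (Nat.le_succ (j + 1)), ascWord_succ, ascWord_succ]
    rfl
  have hb := h.braid_left j (by omega) (by omega)
  simp only [hw, hw', val_append, val_cons, val_nil, mul_one]
  rw [mul_assoc, mul_assoc _ _ (g j), ← hc.eq, ← mul_assoc _ (g j), hb]

/-- A letter `j ≥ 1` which is defined on `l`, where some point of `l` is at least `j`. -/
theorem up_mul {l : List ℕ} (hl : l.Pairwise (· > ·)) (hm : ∀ a ∈ l, 1 ≤ a ∧ a ≤ k) {j : ℕ}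
    (hj : 1 ≤ j) (hjk : j < k) (hd : j + 1 ∉ l) (hex : ∃ a ∈ l, j ≤ a) :
    val g (upWord 1 l) * g j = val g (upWord 1 (l.map (chainStep j))) := by
  induction l with
  | nil => simp at hex
  | cons a l ih =>
    rw [List.pairwise_cons] at hl
    have hm' : ∀ b ∈ l, 1 ≤ b ∧ b ≤ k := fun b hb => hm b (List.mem_cons_of_mem _ hb)
    have ha := hm a (by simp)
    have hd1 : j + 1 ≠ a := fun e => hd (by simp [e])
    have hd2 : j + 1 ∉ l := fun e => hd (List.mem_cons_of_mem _ e)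
    rw [List.map_cons, upWord, upWord, val_append, val_append, List.length_map]
    by_cases hex' : ∃ b ∈ l, j ≤ b
    · have hja : j < a := by
        obtain ⟨b, hb, hjb⟩ := hex'
        exact hjb.trans_lt (hl.1 b hb)
      rw [mul_assoc, ih hl.2 hm' hd2 hex', chainStep, if_neg (by omega), if_neg (by omega),
        if_neg (by omega)]
    · push Not at hex'
      have hja : j ≤ a := by
        obtain ⟨b, hb, hjb⟩ := hex
        rcases List.mem_cons.1 hb with rfl | hb
        · exact hjb
        · exact absurd (hex' b hb) (by omega)
      have hlen : l.length + 1 ≤ j := length_add_le hl.2 hj fun b hb => ⟨(hm' b hb).1, hex' b hb⟩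
      have hmap : l.map (chainStep j) = l := by
        conv_rhs => rw [← List.map_id l]
        refine List.map_congr_left fun b hb => ?_
        have := hex' b hb
        rw [chainStep, if_neg (by omega), if_neg (by omega), if_neg (by omega), id]
      rw [mul_assoc, ← (h.up_commute hj hjk hex').eq, ← mul_assoc, hmap]
      congr 1
      rcases eq_or_lt_of_le hja with rfl | hja
      · rw [chainStep, if_neg (by omega), if_pos rfl, ascWord_append hlen (Nat.le_succ _),
          ascWord_succ]
        simp
      · rw [chainStep, if_neg (by omega), if_neg (by omega), if_neg (by omega),
          h.asc_absorb (by omega) hlen (by omega) ha.2]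

theorem onto_mul {l : List ℕ} (hl : l.Pairwise (· > ·)) (hm : ∀ a ∈ l, 1 ≤ a ∧ a ≤ k) {j : ℕ}
    (hjk : j < k) (hd : ∀ a ∈ l, chainStep j a ≠ 0) :
    val g (ontoWord k l) * g j = val g (ontoWord k (l.map (chainStep j))) := by
  rw [ontoWord, ontoWord, val_append, val_append, List.length_map, val_replicate_zero, mul_assoc]
  by_cases hj : j = 0
  · subst hj
    have hm' : ∀ a ∈ l, 2 ≤ a ∧ a ≤ k := by
      intro a ha
      have := hd a ha
      rw [chainStep, if_pos rfl] at this
      exact ⟨by omega, (hm a ha).2⟩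
    have hlen : l.length + 2 ≤ k + 1 :=
      length_add_le hl (by omega) fun a ha => ⟨(hm' a ha).1, Nat.lt_succ_of_le (hm a ha).2⟩
    have hstep : chainStep 0 = (· - 1) := funext fun p => by rw [chainStep, if_pos rfl]
    rw [h.up_split hl hm', mul_assoc, h.up_shift hm, ← mul_assoc (val g _) (g 0), ← mul_assoc,
      h.zero_pow_desc (by omega), hstep]
  · by_cases hex : ∃ a ∈ l, j ≤ a
    · rw [h.up_mul hl hm (by omega) hjk (fun hmem => hd _ hmem ?_) hex]
      rw [chainStep, if_neg hj, if_neg (by omega), if_pos rfl]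
    · push Not at hex
      have hlen : l.length + 1 ≤ j :=
        length_add_le hl (by omega) fun b hb => ⟨(hm b hb).1, hex b hb⟩
      have hmap : l.map (chainStep j) = l := by
        conv_rhs => rw [← List.map_id l]
        refine List.map_congr_left fun b hb => ?_
        have := hex b hb
        rw [chainStep, if_neg (by omega), if_neg (by omega), if_neg (by omega), id]
      rw [hmap, ← (h.up_commute (by omega) hjk hex).eq, ← mul_assoc,
        h.zero_pow_mul (by omega) (by omega) hjk (by omega)]

theorem onto_mul_val {l : List ℕ} (hl : l.Pairwise (· > ·)) (hm : ∀ a ∈ l, 1 ≤ a ∧ a ≤ k)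
    {w : List ℕ} (hw : ∀ j ∈ w, j < k) (hd : ∀ a ∈ l, chainAct w a ≠ 0) :
    val g (ontoWord k l) * val g w = val g (ontoWord k (l.map (chainAct w))) := by
  induction w generalizing l with
  | nil =>
    rw [val_nil, mul_one, show chainAct [] = id from rfl, List.map_id]
  | cons j w ih =>
    have hjk := hw j (by simp)
    have hd' : ∀ a ∈ l, chainStep j a ≠ 0 := fun a ha h0 =>
      hd a ha (by rw [chainAct_cons, h0, chainAct_zero])
    rw [val_cons, ← mul_assoc, h.onto_mul hl hm hjk hd', ih _ _ _ _, List.map_map]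
    · rfl
    · rw [List.pairwise_map]
      exact hl.imp_of_mem fun {a b} ha _ hab => chainStep_lt hab (hd' a ha)
    · intro b hb
      obtain ⟨a, ha, rfl⟩ := List.mem_map.1 hb
      exact ⟨Nat.one_le_iff_ne_zero.2 (hd' a ha), chainStep_le hjk (hm a ha).2⟩
    · exact fun i hi => hw i (List.mem_cons_of_mem _ hi)
    · intro b hb
      obtain ⟨a, ha, rfl⟩ := List.mem_map.1 hb
      exact hd a ha

/-- Words with the same action have the same value: with `u` the word of the order preserving
bijection from the largest points onto the common domain, `u w` and `u w'` have the same normal form,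
and `u` can be cancelled. -/
theorem val_eq_of_act_eq (hk : 0 < k) {w w' : List ℕ} (hw : ∀ j ∈ w, j < k) (hw' : ∀ j ∈ w', j < k)
    (heq : ∀ p, 1 ≤ p → p ≤ k → chainAct w p = chainAct w' p) : val g w = val g w' := by
  set l := support k (chainAct w) with hl_def
  have hl : l.Pairwise (· > ·) := pairwise_support _ _
  have hm : ∀ a ∈ l, 1 ≤ a ∧ a ≤ k := fun a ha => (mem_support.1 ha).1
  have hd : ∀ a ∈ l, chainAct w a ≠ 0 := fun a ha => (mem_support.1 ha).2
  have hmap : l.map (chainAct w) = l.map (chainAct w') :=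
    List.map_congr_left fun a ha => heq a (hm a ha).1 (hm a ha).2
  have hu := ontoWord_lt hk fun a ha => (hm a ha).2
  obtain ⟨K, hK⟩ := h.exists_left_inverse hu
  have himg : ∀ p, 1 ≤ p → p ≤ k → chainAct w p ≠ 0 → ∃ q ≤ k, chainAct (ontoWord k l) q = p := by
    intro p hp1 hpk hp
    have hp' : p ∈ l := mem_support.2 ⟨⟨hp1, hpk⟩, hp⟩
    have hlen : l.length + 1 ≤ k + 1 :=
      length_add_le hl (by omega) fun a ha => ⟨(hm a ha).1, Nat.lt_succ_of_le (hm a ha).2⟩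
    rw [← map_chainAct_ontoWord hl hm] at hp'
    obtain ⟨q, hq, hqp⟩ := List.mem_map.1 hp'
    obtain ⟨i, hi, rfl⟩ := List.mem_map.1 hq
    rw [mem_descWord] at hi
    exact ⟨_, by omega, hqp⟩
  rw [← hK w hw himg, h.onto_mul_val hl hm hw hd, hmap,
    ← h.onto_mul_val hl hm hw' fun a ha => by
      rw [← heq a (hm a ha).1 (hm a ha).2]; exact hd a ha]
  exact hK w' hw' fun p hp1 hpk hp => himg p hp1 hpk (by rwa [heq p hp1 hpk])

end ChainRels

/-! ### Moore's presentation of the symmetric group -/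

/-- Moore's relations for the transposition `a = (1 2)` and the cycle `b = (1 2 ⋯ m)`. -/
structure MooreRels {G : Type*} [Group G] (m : ℕ) (a b : G) : Prop where
  sq : a ^ 2 = 1
  pow : b ^ m = 1
  mul_pow : (b * a) ^ (m - 1) = 1
  cube : (a * (b⁻¹ * a * b)) ^ 3 = 1
  comm : ∀ j, 2 ≤ j → j + 2 ≤ m → (a * ((b ^ j)⁻¹ * a * b ^ j)) ^ 2 = 1

/-- The element which corresponds to the adjacent transposition `(i+1 i+2)`. -/
def adjSwap {G : Type*} [Group G] (a b : G) (i : ℕ) : G := (b ^ i)⁻¹ * a * b ^ i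

/-- The Coxeter relations of type `A_N`. -/
structure CoxeterRels {G : Type*} [Group G] (N : ℕ) (d : ℕ → G) : Prop where
  sq : ∀ i < N, d i * d i = 1
  braid : ∀ i, i + 1 < N → d (i + 1) * d i * d (i + 1) = d i * d (i + 1) * d i
  comm : ∀ i j, i + 2 ≤ j → j < N → Commute (d i) (d j)

section Group

variable {G : Type*} [Group G]

theorem adjSwap_add (a b : G) (i j : ℕ) :
    adjSwap a b (j + i) = (b ^ i)⁻¹ * adjSwap a b j * b ^ i := by
  simp only [adjSwap, pow_add, mul_inv_rev, mul_assoc]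

theorem MooreRels.coxeterRels {m : ℕ} {a b : G} (h : MooreRels m a b) :
    CoxeterRels (m - 1) (adjSwap a b) := by
  have ha : a * a = 1 := by rw [← pow_two]; exact h.sq
  have hd : ∀ i, adjSwap a b i * adjSwap a b i = 1 := by
    intro i
    simp only [adjSwap]
    calc _ = (b ^ i)⁻¹ * (a * a) * b ^ i := by group
      _ = 1 := by rw [ha]; group
  have h0 : adjSwap a b 0 = a := by simp [adjSwap]
  have hbraid : adjSwap a b 1 * a * adjSwap a b 1 = a * adjSwap a b 1 * a := by
    have h3 := h.cube
    rw [show b⁻¹ * a * b = adjSwap a b 1 by simp [adjSwap]] at h3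
    have hd1 := hd 1
    generalize adjSwap a b 1 = d at *
    have e1 : a * d * a * (d * a * d) = 1 := by
      rw [← h3, pow_succ, pow_two]; simp only [mul_assoc]
    have e2 : a * d * a * (a * d * a) = 1 := by
      calc a * d * a * (a * d * a) = a * d * (a * a) * d * a := by simp only [mul_assoc]
        _ = a * (d * d) * a := by rw [ha]; simp only [mul_assoc, mul_one]
        _ = 1 := by rw [hd1, mul_one, ha]
    exact mul_left_cancel (e1.trans e2.symm)
  refine ⟨fun i _ => hd i, fun i hi => ?_, fun i j hij hj => ?_⟩
  · have e0 := adjSwap_add a b i 0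
    have e1 := adjSwap_add a b i 1
    rw [zero_add, h0] at e0
    rw [add_comm i 1, e0, e1]
    calc _ = (b ^ i)⁻¹ * (adjSwap a b 1 * a * adjSwap a b 1) * b ^ i := by group
      _ = _ := by rw [hbraid]; group
  · obtain ⟨j, rfl⟩ : ∃ n, j = n + i := ⟨j - i, by omega⟩
    have e0 := adjSwap_add a b i 0
    rw [zero_add, h0] at e0
    have hc := h.comm j (by omega) (by omega)
    change (a * adjSwap a b j) ^ 2 = 1 at hc
    have hc' : a * adjSwap a b j = adjSwap a b j * a := by
      have e1 : a * adjSwap a b j * (a * adjSwap a b j) = 1 := by rw [← pow_two]; exact hc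
      have e2 : a * adjSwap a b j * (adjSwap a b j * a) = 1 := by
        rw [mul_assoc, ← mul_assoc _ _ a, hd j, one_mul, ha]
      exact mul_left_cancel (e1.trans e2.symm)
    rw [adjSwap_add a b i j, e0]
    change _ * _ = _ * _
    calc _ = (b ^ i)⁻¹ * (a * adjSwap a b j) * b ^ i := by group
      _ = _ := by rw [hc']; group

theorem val_adjSwap (a b : G) (n : ℕ) :
    val (adjSwap a b) (descWord 0 n) = (b ^ n)⁻¹ * (b * a) ^ n := by
  induction n with
  | zero => simp [descWord]
  | succ n ih =>
    rw [descWord_cons (Nat.zero_le n), val_cons, ih, adjSwap, pow_succ' (b * a), pow_succ' b]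
    simp only [mul_inv_rev, mul_assoc, mul_inv_cancel_left, inv_mul_cancel_left]

theorem MooreRels.val_adjSwap {m : ℕ} {a b : G} (h : MooreRels m a b) (hm : 1 ≤ m) :
    val (adjSwap a b) (descWord 0 (m - 1)) = b := by
  rw [POIPresentation.val_adjSwap, h.mul_pow, mul_one, inv_eq_iff_mul_eq_one, ← pow_succ,
    Nat.sub_add_cancel hm, h.pow]

/-- The parabolic subgroup generated by the first `n` Coxeter generators. -/
def parabolic (d : ℕ → G) (n : ℕ) : Subgroup G := Subgroup.closure (d '' Set.Iio n)

theorem mem_parabolic (d : ℕ → G) {n i : ℕ} (h : i < n) : d i ∈ parabolic d n :=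
  Subgroup.subset_closure ⟨i, h, rfl⟩

namespace CoxeterRels

variable {N : ℕ} {d : ℕ → G} (h : CoxeterRels N d)

include h

/-- The elements `d_n d_{n-1} ⋯ d_p` represent the right cosets of the parabolic subgroup generated
by `d_0, …, d_{n-1}` in the one generated by `d_0, …, d_n`. -/
theorem coset_mul {n i p : ℕ} (hn : n < N) (hi : i < n + 1) (hp : p ≤ n + 1) :
    ∃ y ∈ parabolic d n, ∃ q ≤ n + 1,
      val d (descWord p (n + 1)) * d i = y * val d (descWord q (n + 1)) := by
  have hcomm : ∀ i s t, i < N → t ≤ N → i + 2 ≤ s ∨ t < i → Commute (d i) (val d (descWord s t)) := by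
    intro i s t hi ht hij
    refine commute_val d fun j hj => ?_
    rw [mem_descWord] at hj
    rcases hij with hij | hij
    · exact h.comm i j (by omega) (by omega)
    · exact (h.comm j i (by omega) hi).symm
  rcases lt_trichotomy i p with hlt | rfl | hgt
  · rcases eq_or_lt_of_le (Nat.succ_le_of_lt hlt) with rfl | hlt'
    · refine ⟨1, one_mem _, i, by omega, ?_⟩
      rw [descWord_concat (s := i) (by omega)]
      simp
    · exact ⟨d i, mem_parabolic d (by omega), p, hp,
        (hcomm i p (n + 1) (by omega) (by omega) (by omega)).eq.symm⟩
  · refine ⟨1, one_mem _, i + 1, by omega, ?_⟩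
    rw [descWord_concat (s := i) (by omega), val_append, mul_assoc]
    simp [h.sq i (by omega)]
  · obtain ⟨i, rfl⟩ : ∃ j, i = j + 1 := ⟨i - 1, by omega⟩
    refine ⟨d i, mem_parabolic d (by omega), p, hp, ?_⟩
    have hw : descWord p (n + 1) = descWord (i + 2) (n + 1) ++ (i + 1) :: i :: descWord p i := by
      rw [descWord_append (show p ≤ i + 2 by omega) (show i + 2 ≤ n + 1 by omega),
        descWord_cons (show p ≤ i + 1 by omega), descWord_cons (show p ≤ i by omega)]
    have c1 := hcomm (i + 1) p i (by omega) (by omega) (by omega)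
    have c2 := hcomm i (i + 2) (n + 1) (by omega) (by omega) (by omega)
    simp only [hw, val_append, val_cons]
    calc val d (descWord (i + 2) (n + 1)) * (d (i + 1) * (d i * val d (descWord p i))) * d (i + 1)
        = val d (descWord (i + 2) (n + 1)) * (d (i + 1) * d i) *
          (val d (descWord p i) * d (i + 1)) := by simp only [mul_assoc]
      _ = val d (descWord (i + 2) (n + 1)) * (d (i + 1) * d i * d (i + 1)) *
          val d (descWord p i) := by rw [← c1.eq]; simp only [mul_assoc]
      _ = val d (descWord (i + 2) (n + 1)) * d i * (d (i + 1) * d i * val d (descWord p i)) := by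
          rw [h.braid i (by omega)]; simp only [mul_assoc]
      _ = _ := by rw [← c2.eq]; simp only [mul_assoc]

theorem exists_coset {n : ℕ} (hn : n < N) {x : G} (hx : x ∈ parabolic d (n + 1)) :
    ∃ y ∈ parabolic d n, ∃ q ≤ n + 1, x = y * val d (descWord q (n + 1)) := by
  have step : ∀ x i, i < n + 1 →
      (∃ y ∈ parabolic d n, ∃ q ≤ n + 1, x = y * val d (descWord q (n + 1))) →
      ∃ y ∈ parabolic d n, ∃ q ≤ n + 1, x * d i = y * val d (descWord q (n + 1)) := by
    rintro _ i hi ⟨y, hy, q, hq, rfl⟩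
    obtain ⟨z, hz, r, hr, e⟩ := h.coset_mul hn hi hq
    exact ⟨y * z, mul_mem hy hz, r, hr, by rw [mul_assoc, e, mul_assoc]⟩
  refine Subgroup.closure_induction_right
    (p := fun x _ => ∃ y ∈ parabolic d n, ∃ q ≤ n + 1, x = y * val d (descWord q (n + 1)))
    ⟨1, one_mem _, n + 1, le_rfl, by simp [descWord_self]⟩ ?_ ?_ hx
  · rintro x _ _ ⟨i, hi, rfl⟩ ih
    exact step x i hi ih
  · rintro x _ _ ⟨i, hi, rfl⟩ ih
    have hi' : i < n + 1 := hi
    rw [inv_eq_of_mul_eq_one_left (h.sq i (by omega))]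
    exact step x i hi ih

/-- If the generators act on the right as the adjacent transpositions of `0, …, N`, then the action
on the subgroup they generate is faithful: an element which fixes the largest point lies in the
parabolic subgroup on the remaining ones. -/
theorem eq_one_of_map_eq_one (π : G →* (Equiv.Perm (Fin (N + 1)))ᵐᵒᵖ)
    (hπ : ∀ i (hi : i < N), π (d i) =
      MulOpposite.op (Equiv.swap ⟨i, by omega⟩ ⟨i + 1, by omega⟩)) :
    ∀ n ≤ N, ∀ x ∈ parabolic d n, π x = 1 → x = 1 := by
  intro n
  induction n with
  | zero =>
    intro _ x hx _
    simpa [parabolic] using hx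
  | succ n ih =>
    intro hn x hx hx1
    obtain ⟨y, hy, q, hq, rfl⟩ := h.exists_coset hn hx
    have hfix : ∀ z ∈ parabolic d n, (π z).unop ⟨n + 1, by omega⟩ = ⟨n + 1, by omega⟩ := by
      intro z hz
      refine Subgroup.closure_induction (p := fun z _ =>
        (π z).unop ⟨n + 1, by omega⟩ = ⟨n + 1, by omega⟩) ?_ (by simp) ?_ ?_ hz
      · rintro _ ⟨i, hi, rfl⟩
        have hi' : i < n := hi
        rw [hπ i (by omega), MulOpposite.unop_op]
        refine Equiv.swap_apply_of_ne_of_ne ?_ ?_ <;>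
        · rw [Ne, Fin.mk.injEq]; omega
      · intro u v _ _ hu hv
        rw [map_mul, MulOpposite.unop_mul, Equiv.Perm.mul_apply, hu, hv]
      · intro u _ hu
        rw [map_inv, MulOpposite.unop_inv, Equiv.Perm.inv_eq_iff_eq, hu]
    have hdesc : ∀ t, q ≤ t → ∀ ht : t ≤ N, (π (val d (descWord q t))).unop ⟨t, by omega⟩ =
        ⟨q, by omega⟩ := by
      intro t hqt
      induction t, hqt using Nat.le_induction with
      | base => intro ht; simp [descWord_self]
      | succ t hqt iht =>
        intro ht
        rw [descWord_cons hqt, val_cons, map_mul, MulOpposite.unop_mul, Equiv.Perm.mul_apply,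
          hπ t (by omega), MulOpposite.unop_op, Equiv.swap_apply_right, iht (by omega)]
    have h1 := congrArg (fun σ => σ.unop ⟨n + 1, by omega⟩) hx1
    simp only [map_mul, MulOpposite.unop_mul, Equiv.Perm.mul_apply, hfix y hy, hdesc _ hq hn,
      MulOpposite.unop_one, Equiv.Perm.one_apply, Fin.mk.injEq] at h1
    subst h1
    rw [descWord_self, val_nil, mul_one] at hx1 ⊢
    exact ih (by omega) y hy hx1

end CoxeterRels

end Group

/-! ### The relations of the cycle and the transposition -/

theorem permB_apply {m : ℕ} (p : Fin m) :
    (permB m p : ℕ) = if (p : ℕ) + 1 = m then 0 else (p : ℕ) + 1 := by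
  have := p.isLt
  obtain ⟨n, rfl⟩ : ∃ n, m = n + 1 := ⟨m - 1, by omega⟩
  rw [permB, coe_finRotate]
  simp only [Fin.ext_iff, Fin.val_last, Nat.add_right_cancel_iff]

theorem permB_pow_apply {m n : ℕ} {p : Fin m} (h : (p : ℕ) + n < m) :
    (permB m ^ n) p = ⟨p + n, h⟩ := by
  induction n with
  | zero => simp
  | succ n ih =>
    rw [pow_succ', Equiv.Perm.mul_apply, ih (by omega)]
    apply Fin.ext
    rw [permB_apply]
    simp only
    rw [if_neg (by omega)]
    omega

theorem permA_sq {m : ℕ} (hm : 2 ≤ m) : permA hm * permA hm = 1 := Equiv.swap_mul_self _ _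

theorem permB_pow_self {m : ℕ} (hm : 2 ≤ m) : permB m ^ m = 1 := by
  have h0 : (permB m ^ m) ⟨0, by omega⟩ = ⟨0, by omega⟩ := by
    obtain ⟨n, rfl⟩ : ∃ n, m = n + 1 := ⟨m - 1, by omega⟩
    rw [pow_succ', Equiv.Perm.mul_apply, permB_pow_apply (by simp)]
    apply Fin.ext
    rw [permB_apply]
    simp
  ext p
  have hp : p = (permB m ^ (p : ℕ)) ⟨0, by omega⟩ := by
    rw [permB_pow_apply (by simp)]
    simp
  conv_lhs => rw [hp]
  rw [← Equiv.Perm.mul_apply, ← pow_add, add_comm, pow_add, Equiv.Perm.mul_apply, h0, ← hp]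
  rfl

theorem permA_mul_permB_apply {m : ℕ} (hm : 2 ≤ m) {p : Fin m} (hp : 1 ≤ (p : ℕ)) :
    ((permA hm * permB m) p : ℕ) = if (p : ℕ) + 1 = m then 1 else (p : ℕ) + 1 := by
  have hB := permB_apply p
  rw [Equiv.Perm.mul_apply, permA]
  split_ifs at hB ⊢ with h
  · rw [show permB m p = ⟨0, by omega⟩ from Fin.ext hB, Equiv.swap_apply_left]
  · rw [Equiv.swap_apply_of_ne_of_ne, hB] <;>
    · rw [Ne, Fin.ext_iff, hB]
      simp only
      omega

theorem permA_mul_permB_pow_apply {m n : ℕ} (hm : 2 ≤ m) (h : 1 + n < m) :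
    ((permA hm * permB m) ^ n) ⟨1, by omega⟩ = ⟨1 + n, h⟩ := by
  induction n with
  | zero => simp
  | succ n ih =>
    rw [pow_succ', Equiv.Perm.mul_apply, ih (by omega)]
    apply Fin.ext
    rw [permA_mul_permB_apply hm (by simp)]
    simp only
    rw [if_neg (by omega)]
    omega

theorem permA_mul_permB_pow {m : ℕ} (hm : 2 ≤ m) : (permA hm * permB m) ^ (m - 1) = 1 := by
  have hfix : (permA hm * permB m) ⟨0, by omega⟩ = ⟨0, by omega⟩ := by
    have hB := permB_apply (⟨0, by omega⟩ : Fin m)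
    rw [if_neg (by simp only; omega)] at hB
    rw [Equiv.Perm.mul_apply, permA, show permB m ⟨0, by omega⟩ = ⟨1, by omega⟩ from Fin.ext hB,
      Equiv.swap_apply_right]
  have hone : ((permA hm * permB m) ^ (m - 1)) ⟨1, by omega⟩ = ⟨1, by omega⟩ := by
    obtain ⟨n, rfl⟩ : ∃ n, m = n + 2 := ⟨m - 2, by omega⟩
    rw [show n + 2 - 1 = n + 1 by omega, pow_succ', Equiv.Perm.mul_apply,
      permA_mul_permB_pow_apply hm (by omega)]
    apply Fin.ext
    rw [permA_mul_permB_apply hm (by simp)]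
    simp only
    rw [if_pos (by omega)]
  ext p
  rcases Nat.eq_zero_or_pos (p : ℕ) with h0 | hpos
  · rw [show p = ⟨0, by omega⟩ from Fin.ext h0, Equiv.Perm.pow_apply_eq_self_of_apply_eq_self hfix]
    rfl
  · have hp : p = ((permA hm * permB m) ^ ((p : ℕ) - 1)) ⟨1, by omega⟩ := by
      rw [permA_mul_permB_pow_apply hm (by omega)]
      apply Fin.ext
      simp only
      omega
    conv_lhs => rw [hp]
    rw [← Equiv.Perm.mul_apply, ← pow_add, add_comm, pow_add, Equiv.Perm.mul_apply, hone, ← hp]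
    rfl

theorem adjSwap_perm {m : ℕ} (hm : 2 ≤ m) {i : ℕ} (hi : i + 1 < m) :
    adjSwap (MulOpposite.op (permA hm)) (MulOpposite.op (permB m)) i =
      MulOpposite.op (Equiv.swap ⟨i, by omega⟩ ⟨i + 1, hi⟩) := by
  have h0 : (permB m ^ i) ⟨0, by omega⟩ = ⟨i, by omega⟩ := by
    rw [permB_pow_apply (by simp only; omega)]; simp
  have h1 : (permB m ^ i) ⟨1, by omega⟩ = ⟨i + 1, by omega⟩ := by
    rw [permB_pow_apply (by simp only; omega)]; simp [add_comm]
  rw [← h0, ← h1, Equiv.swap_apply_apply]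
  apply MulOpposite.unop_injective
  simp [adjSwap, permA, mul_assoc]

theorem mooreRels_perm {m : ℕ} (hm : 2 ≤ m) :
    MooreRels m (MulOpposite.op (permA hm)) (MulOpposite.op (permB m)) where
  sq := by
    rw [pow_two, ← MulOpposite.op_mul, permA_sq]; rfl
  pow := by rw [← MulOpposite.op_pow, permB_pow_self hm]; rfl
  mul_pow := by rw [← MulOpposite.op_mul, ← MulOpposite.op_pow, permA_mul_permB_pow]; rfl
  cube := by
    have hd : (MulOpposite.op (permB m))⁻¹ * MulOpposite.op (permA hm) * MulOpposite.op (permB m) =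
      adjSwap (MulOpposite.op (permA hm)) (MulOpposite.op (permB m)) 1 := by simp [adjSwap]
    rcases eq_or_lt_of_le hm with rfl | hm'
    · rw [show permB 2 = permA hm by revert hm; decide]
      simp [← MulOpposite.op_mul, permA_sq]
    · rw [hd, adjSwap_perm hm hm', ← MulOpposite.op_mul, ← MulOpposite.op_pow, permA,
        Equiv.swap_comm (⟨0, by omega⟩ : Fin m)]
      have h3 := Equiv.Perm.isThreeCycle_swap_mul_swap_same
        (a := (⟨1, by omega⟩ : Fin m)) (b := ⟨2, hm'⟩) (c := ⟨0, by omega⟩)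
        (by simp) (by simp) (by simp)
      have := pow_orderOf_eq_one (Equiv.swap (⟨1, by omega⟩ : Fin m) ⟨2, hm'⟩ *
        Equiv.swap ⟨1, by omega⟩ ⟨0, by omega⟩)
      rw [h3.orderOf] at this
      rw [this]
      rfl
  comm j h2 hj := by
    change (MulOpposite.op (permA hm) *
      adjSwap (MulOpposite.op (permA hm)) (MulOpposite.op (permB m)) j) ^ 2 = 1
    rw [adjSwap_perm hm (by omega), ← MulOpposite.op_mul, ← MulOpposite.op_pow, permA]
    have hc : Equiv.Perm.Disjoint (Equiv.swap (⟨j, by omega⟩ : Fin m) ⟨j + 1, by omega⟩)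
        (Equiv.swap ⟨0, by omega⟩ ⟨1, by omega⟩) := by
      rw [Equiv.Perm.disjoint_iff_disjoint_support, Equiv.Perm.support_swap (by simp),
        Equiv.Perm.support_swap (by simp)]
      simp only [Finset.disjoint_insert_left, Finset.disjoint_singleton_left, Finset.mem_insert,
        Finset.mem_singleton, Fin.mk.injEq]
      omega
    rw [hc.commute.mul_pow, pow_two, pow_two, Equiv.swap_mul_self, Equiv.swap_mul_self]
    rfl

/-- The transposition and the cycle generate the symmetric group. -/
theorem closure_perm {m : ℕ} (hm : 2 ≤ m) :
    Subgroup.closure {MulOpposite.op (permA hm), MulOpposite.op (permB m)} = ⊤ := by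
  have h1 : Subgroup.closure {permB m, permA hm} = ⊤ := by
    obtain ⟨n, rfl⟩ : ∃ n, m = n + 2 := ⟨m - 2, by omega⟩
    have := Equiv.Perm.closure_cycle_adjacent_swap (σ := permB (n + 2)) isCycle_finRotate
      support_finRotate 0
    rwa [show permB (n + 2) 0 = 1 by rw [permB, finRotate_apply, zero_add]] at this
  rw [eq_top_iff]
  intro x _
  have hx : x.unop ∈ Subgroup.closure {permB m, permA hm} := by rw [h1]; trivial
  refine Subgroup.closure_induction (p := fun y _ => MulOpposite.op y ∈ Subgroup.closure
    {MulOpposite.op (permA hm), MulOpposite.op (permB m)}) ?_ (one_mem _) ?_ ?_ hx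
  · rintro y (rfl | rfl)
    · exact Subgroup.subset_closure (by simp)
    · exact Subgroup.subset_closure (by simp)
  · intro u v _ _ hu hv
    rw [MulOpposite.op_mul]
    exact mul_mem hv hu
  · intro u _ hu
    rw [MulOpposite.op_inv]
    exact inv_mem hu

/-- Moore's relations define the symmetric group, which acts on the right. -/
theorem MooreRels.exists_hom {G : Type*} [Group G] {m : ℕ} (hm : 2 ≤ m) {a b : G}
    (h : MooreRels m a b) : ∃ θ : (Equiv.Perm (Fin m))ᵐᵒᵖ →* G,
      θ (MulOpposite.op (permA hm)) = a ∧ θ (MulOpposite.op (permB m)) = b := by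
  -- The graph of `θ` is the subgroup generated by the graph of its restriction to the generators.
  set A : G × (Equiv.Perm (Fin m))ᵐᵒᵖ := (a, MulOpposite.op (permA hm)) with hA
  set B : G × (Equiv.Perm (Fin m))ᵐᵒᵖ := (b, MulOpposite.op (permB m)) with hB
  have hP := mooreRels_perm hm
  have hAB : MooreRels m A B := ⟨Prod.ext h.sq hP.sq, Prod.ext h.pow hP.pow,
    Prod.ext h.mul_pow hP.mul_pow, Prod.ext h.cube hP.cube,
    fun j h2 hj => Prod.ext (h.comm j h2 hj) (hP.comm j h2 hj)⟩
  have hle : Subgroup.closure {A, B} ≤ parabolic (adjSwap A B) (m - 1) := by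
    rw [Subgroup.closure_le]
    rintro x (rfl | rfl)
    · have := mem_parabolic (adjSwap A B) (show 0 < m - 1 by omega)
      rwa [show adjSwap A B 0 = A by simp [adjSwap]] at this
    · conv => enter [2]; rw [← hAB.val_adjSwap (by omega)]
      refine Subgroup.list_prod_mem _ fun y hy => ?_
      obtain ⟨i, hi, rfl⟩ := List.mem_map.1 hy
      exact mem_parabolic _ (mem_descWord.1 hi).2
  let S := Subgroup.closure {A, B}
  let π : S →* (Equiv.Perm (Fin m))ᵐᵒᵖ := (MonoidHom.snd _ _).comp S.subtype
  have hinj : Function.Injective π := by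
    rw [injective_iff_map_eq_one]
    rintro ⟨x, hx⟩ hx1
    obtain ⟨N, rfl⟩ : ∃ N, m = N + 1 := ⟨m - 1, by omega⟩
    refine Subtype.ext (hAB.coxeterRels.eq_one_of_map_eq_one (MonoidHom.snd _ _)
      (fun i hi => ?_) N le_rfl x (hle hx) hx1)
    rw [← adjSwap_perm hm (by omega)]
    rfl
  have hsurj : Function.Surjective π := by
    rw [← MonoidHom.range_eq_top, eq_top_iff, ← closure_perm hm, Subgroup.closure_le]
    rintro x (rfl | rfl)
    · exact ⟨⟨A, Subgroup.subset_closure (by simp)⟩, rfl⟩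
    · exact ⟨⟨B, Subgroup.subset_closure (by simp)⟩, rfl⟩
  let e := MulEquiv.ofBijective π ⟨hinj, hsurj⟩
  refine ⟨((MonoidHom.fst _ _).comp S.subtype).comp e.symm.toMonoidHom, ?_, ?_⟩
  · have : e.symm (MulOpposite.op (permA hm)) = ⟨A, Subgroup.subset_closure (by simp)⟩ := by
      rw [MulEquiv.symm_apply_eq]; rfl
    simp [this, hA]
  · have : e.symm (MulOpposite.op (permB m)) = ⟨B, Subgroup.subset_closure (by simp)⟩ := by
      rw [MulEquiv.symm_apply_eq]; rfl
    simp [this, hB]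


/-! ### Words in the letters `x_i` -/

theorem xs_eq (k s t : ℕ) (hst : s ≤ t) (ht : t ≤ k) :
    xs k s t = ((List.range' s (t - s)).map fun n =>
      if h : n < k then (x n h : Word k) else 1).prod := by
  have h1 : (List.finRange k).map Fin.val = List.range' 0 k := by
    rw [List.map_coe_finRange_eq_range, List.range_eq_range']
  have h2 : (List.range' 0 k).filter (fun j => s ≤ j ∧ j < t) = List.range' s (t - s) := by
    have e1 : List.range' 0 k = List.range' 0 s ++ (List.range' s (t - s) ++ List.range' t (k - t)) := by
      have a1 := List.range'_append_1 (s := s) (m := t - s) (n := k - t)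
      have a2 := List.range'_append_1 (s := 0) (m := s) (n := k - s)
      rw [show s + (t - s) = t by omega, show t - s + (k - t) = k - s by omega] at a1
      rw [a1, ← show s + (k - s) = k by omega, ← a2]
      simp
    rw [e1, List.filter_append, List.filter_append, List.filter_eq_nil_iff.2, List.filter_eq_self.2,
      List.filter_eq_nil_iff.2, List.nil_append, List.append_nil]
    all_goals
      intro a ha
      rw [List.mem_range'_1] at ha
      simp only [decide_eq_true_eq]
      omega
  rw [← h2, ← h1, List.filter_map, List.map_map, xs]
  congr 1
  refine List.map_congr_left fun j _ => ?_
  simp [x]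

section Map

variable {N : Type*} [Monoid N] {k : ℕ} (F : Word k →* N) (hk : 0 < k)

/-- The image of the letter of code `j`, under a homomorphism on the words. -/
def chainGen (j : ℕ) : N := F (FreeMonoid.of (Letter.x ⟨(k - j) % k, Nat.mod_lt _ hk⟩))

theorem map_x_zero : F (x 0 hk) = chainGen F hk 0 := by
  simp [chainGen, x]

theorem map_x {i : ℕ} (_hi : 1 ≤ i) (hik : i < k) : F (x i hik) = chainGen F hk (k - i) := by
  have : (k - (k - i)) % k = i := by rw [Nat.sub_sub_self hik.le, Nat.mod_eq_of_lt hik]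
  simp only [chainGen, x, this]

theorem map_xs {s t : ℕ} (hs : 1 ≤ s) (hst : s ≤ t) (ht : t ≤ k) :
    F (xs k s t) = val (chainGen F hk) (descWord (k + 1 - t) (k + 1 - s)) := by
  rw [xs_eq k s t hst ht, map_list_prod, List.map_map]
  induction t, hst using Nat.le_induction with
  | base => simp [descWord_self]
  | succ t hst ih =>
    have h1 : List.range' s (t + 1 - s) = List.range' s (t - s) ++ [t] := by
      rw [Nat.succ_sub hst, List.range'_1_concat, Nat.add_sub_cancel' hst]
    rw [h1, List.map_append, List.prod_append, ih (by omega),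
      descWord_concat (s := k + 1 - (t + 1)) (by omega), val_append,
      show k + 1 - (t + 1) + 1 = k + 1 - t by omega]
    simp only [List.map_cons, List.map_nil, List.prod_singleton, Function.comp_apply,
      dif_pos (show t < k by omega), map_x F hk (show 1 ≤ t by omega), val_cons, val_nil, mul_one,
      show k + 1 - (t + 1) = k - t by omega]

theorem map_xs_zero {t : ℕ} (ht0 : 1 ≤ t) (ht : t ≤ k) :
    F (xs k 0 t) = chainGen F hk 0 * val (chainGen F hk) (descWord (k + 1 - t) k) := by
  have h1 := map_xs F hk le_rfl ht0 ht
  rw [xs_eq k 1 t ht0 ht, Nat.add_sub_cancel] at h1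
  rw [← h1, xs_eq k 0 t (Nat.zero_le t) ht, ← map_x_zero F hk, ← map_mul,
    show List.range' 0 (t - 0) = 0 :: List.range' 1 (t - 1) by
      rw [show t - 0 = (t - 1) + 1 by omega, List.range'_succ]]
  simp [dif_pos hk]

theorem xs_self (s : ℕ) (hs : s ≤ k) : xs k s s = 1 := by simp [xs_eq k s s le_rfl hs]

theorem chainRels_of_relW (hk2 : 2 ≤ k) (h : ∀ u v, RelW k u v → F u = F v) :
    ChainRels (chainGen F hk) k where
  shift j h2 hj := by
    have := h _ _ (RelW.w1 (k - j) (by omega))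
    rwa [map_mul, map_mul, map_x_zero F hk, map_x F hk (by omega) (by omega),
      map_x F hk (by omega) (by omega), show k - (k - j) = j by omega,
      show k - (k - j + 1) = j - 1 by omega] at this
  comm i j hi hij hj := by
    have := h _ _ (RelW.w2 (k - j) (k - i) (by omega))
    rwa [map_mul, map_mul, map_x F hk (by omega) (by omega), map_x F hk (by omega) (by omega),
      show k - (k - j) = j by omega, show k - (k - i) = i by omega] at this
  zero_last := by
    have := h _ _ (RelW.w3_left hk2)
    rwa [map_mul, map_pow, map_x_zero F hk, map_x F hk le_rfl (by omega), pow_two] at this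
  one_zero := by
    have := h _ _ (RelW.w3_right hk2)
    rw [map_mul, map_pow, map_x_zero F hk, map_x F hk (by omega) (by omega), pow_two,
      show k - (k - 1) = 1 by omega] at this
    exact this.symm
  braid_left j hj hjk := by
    have := h _ _ (RelW.w4_left (k - (j + 1)) (by omega))
    rwa [map_mul, map_mul, map_x F hk (by omega) (by omega), map_x F hk (by omega) (by omega),
      show k - (k - (j + 1)) = j + 1 by omega, show k - (k - (j + 1) + 1) = j by omega] at this
  braid_right j hj hjk := by
    have := h _ _ (RelW.w4_right (k - (j + 1)) (by omega))
    rw [map_mul, map_mul, map_mul, map_x F hk (by omega) (by omega),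
      map_x F hk (by omega) (by omega),
      show k - (k - (j + 1)) = j + 1 by omega, show k - (k - (j + 1) + 1) = j by omega] at this
    exact this.symm
  zero_desc := by
    have := h _ _ (RelW.w5 0 (by omega))
    rwa [map_mul, map_mul, xs_self 0 (by omega), map_one, mul_one, map_xs_zero F hk (by omega) le_rfl,
      map_x_zero F hk, show k + 1 - k = 1 by omega] at this
  killer_succ j hj hjk := by
    have := h _ _ (RelW.w5 (k - j) (by omega))
    rw [map_mul, map_mul, map_xs_zero F hk (by omega) (by omega),
      map_xs F hk (by omega) (by omega) le_rfl, map_x F hk (by omega) (by omega),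
      show k + 1 - k = 1 by omega, show k + 1 - (k - j) = j + 1 by omega,
      show k - (k - j) = j by omega] at this
    rw [descWord_concat hjk, val_append, val_cons, val_nil, mul_one]
    simpa only [mul_assoc] using this
  killer_self j hj hjk := by
    have := h _ _ (RelW.w6 (k - j) (by omega))
    rw [map_mul, map_mul, map_pow, map_xs_zero F hk (by omega) (by omega),
      map_xs F hk (by omega) (by omega) le_rfl, map_x F hk (by omega) (by omega),
      show k + 1 - k = 1 by omega, show k + 1 - (k - j) = j + 1 by omega,
      show k + 1 - (k - j + 1) = j by omega, show k - (k - j) = j by omega, pow_two] at this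
    rw [← ChainRels.desc_mul_self hjk]
    simpa only [mul_assoc] using this

theorem relW_of_chainRels (h : ChainRels (chainGen F hk) k) {u v : Word k} (huv : RelW k u v) :
    F u = F v := by
  cases huv with
  | w1 i hi =>
    have := h.shift (k - i) (by omega) (by omega)
    rwa [map_mul, map_mul, map_x_zero F hk, map_x F hk (by omega) (by omega),
      map_x F hk (by omega) (by omega)]
  | w2 i j hij =>
    rw [map_mul, map_mul, map_x F hk (by omega) (by omega), map_x F hk (by omega) (by omega)]
    exact h.comm (k - j) (k - i) (by omega) (by omega) (by omega)
  | w3_left hk2 =>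
    rw [map_mul, map_pow, map_x_zero F hk, map_x F hk le_rfl (by omega), pow_two, h.zero_last]
  | w3_right hk2 =>
    rw [map_mul, map_pow, map_x_zero F hk, map_x F hk (by omega) (by omega), pow_two,
      show k - (k - 1) = 1 by omega, h.one_zero]
  | w4_left i hi =>
    have := h.braid_left (k - (i + 1)) (by omega) (by omega)
    rwa [show k - (i + 1) + 1 = k - i by omega, ← map_x F hk hi.1 (by omega),
      ← map_x F hk (by omega) (by omega), ← map_mul, ← map_mul] at this
  | w4_right i hi =>
    have := h.braid_right (k - (i + 1)) (by omega) (by omega)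
    rw [show k - (i + 1) + 1 = k - i by omega, ← map_x F hk hi.1 (by omega),
      ← map_x F hk (by omega) (by omega), ← map_mul, ← map_mul, ← map_mul] at this
    exact this.symm
  | w5 i hi =>
    rcases Nat.eq_zero_or_pos i with rfl | hi0
    · rw [map_mul, map_mul, xs_self 0 (by omega), map_one, mul_one,
        map_xs_zero F hk (by omega) le_rfl, map_x_zero F hk, show k + 1 - k = 1 by omega,
        h.zero_desc]
    · have := h.killer_succ (k - i) (by omega) (by omega)
      rw [descWord_concat (s := k - i) (by omega), val_append, val_cons, val_nil, mul_one] at this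
      rw [map_mul, map_mul, map_xs_zero F hk (by omega) (by omega),
        map_xs F hk (by omega) (by omega) le_rfl, map_x F hk (by omega) (by omega),
        show k + 1 - k = 1 by omega, show k + 1 - i = k - i + 1 by omega]
      simpa only [mul_assoc] using this
  | w6 i hi =>
    have := h.killer_self (k - i) (by omega) (by omega)
    rw [← ChainRels.desc_mul_self (by omega)] at this
    rw [map_mul, map_mul, map_pow, map_xs_zero F hk (by omega) (by omega),
      map_xs F hk (by omega) (by omega) le_rfl, map_x F hk (by omega) (by omega),
      show k + 1 - k = 1 by omega, show k + 1 - i = k - i + 1 by omega,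
      show k + 1 - (i + 1) = k - i by omega, pow_two]
    simpa only [mul_assoc] using this

end Map

/-! ### The action of the generators on the points -/

/-- The point of position `s` in the interval of index `i`, both zero-based. -/
def pt {k m : ℕ} (i : Fin k) (s : Fin m) : Fin (k * m) := finProdFinEquiv (i, s)

theorem exists_pt {k m : ℕ} (p : Fin (k * m)) : ∃ (i : Fin k) (s : Fin m), p = pt i s :=
  ⟨(finProdFinEquiv.symm p).1, (finProdFinEquiv.symm p).2,
    (finProdFinEquiv.apply_symm_apply p).symm⟩

theorem pt_inj {k m : ℕ} {i j : Fin k} {s t : Fin m} : pt i s = pt j t ↔ i = j ∧ s = t := by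
  simp [pt]

@[simp] theorem divNat_pt {k m : ℕ} (i : Fin k) (s : Fin m) : (pt i s).divNat = i :=
  congrArg Prod.fst (finProdFinEquiv.symm_apply_apply (i, s))

@[simp] theorem modNat_pt {k m : ℕ} (i : Fin k) (s : Fin m) : (pt i s).modNat = s :=
  congrArg Prod.snd (finProdFinEquiv.symm_apply_apply (i, s))

theorem SymInv.ext {Ω : Type} {α β : SymInv Ω} (h : ∀ p q, α.Maps p q ↔ β.Maps p q) : α = β :=
  PEquiv.ext fun p => Option.ext fun q => h p q

theorem SymInv.Maps.right_unique {Ω : Type} {α : SymInv Ω} {p q q' : Ω} (h : α.Maps p q)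
    (h' : α.Maps p q') : q = q' := Option.some_injective _ (h.symm.trans h')

theorem SymInv.Maps.left_unique {Ω : Type} {α : SymInv Ω} {p p' q : Ω} (h : α.Maps p q)
    (h' : α.Maps p' q) : p = p' := PEquiv.inj α h h'

/-- `α` acts on the intervals as `f`, in the one-based encoding with `0` for "undefined", and on the
positions of the points of the interval of index `i` as `z i`. -/
def Acts {k m : ℕ} (α : SymInv (Fin (k * m))) (f : ℕ → ℕ) (z : Fin k → Equiv.Perm (Fin m)) : Prop :=
  ∀ i s j t, α.Maps (pt i s) (pt j t) ↔ f (i + 1) = j + 1 ∧ t = z i s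

namespace Acts

variable {k m : ℕ} {α β : SymInv (Fin (k * m))} {f f' : ℕ → ℕ} {z z' : Fin k → Equiv.Perm (Fin m)}

theorem ext (h : Acts α f z) (h' : Acts β f' z') (hf : ∀ i : Fin k, f (i + 1) = f' (i + 1))
    (hz : ∀ i : Fin k, f (i + 1) ≠ 0 → z i = z' i) : α = β := by
  refine SymInv.ext fun p q => ?_
  obtain ⟨i, s, rfl⟩ := exists_pt p
  obtain ⟨j, t, rfl⟩ := exists_pt q
  rw [h, h', ← hf]
  refine and_congr_right fun hi => ?_
  rw [hz i (by omega)]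

theorem map_eq (hm : 0 < m) (h : Acts α f z) (h' : Acts α f' z') {i : Fin k} (hf : f (i + 1) ≤ k)
    (hf0 : f (i + 1) ≠ 0) : f (i + 1) = f' (i + 1) ∧ z i = z' i := by
  have key : ∀ s, f' (i + 1) = f (i + 1) ∧ z i s = z' i s := by
    intro s
    have hj : f (i + 1) = ((⟨f (i + 1) - 1, by omega⟩ : Fin k) : ℕ) + 1 := by simp only; omega
    have := (h' _ _ _ _).1 ((h i s ⟨f (i + 1) - 1, by omega⟩ (z i s)).2 ⟨hj, rfl⟩)
    exact ⟨this.1.trans hj.symm, this.2⟩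
  exact ⟨(key ⟨0, hm⟩).1.symm, Equiv.ext fun s => (key s).2⟩

theorem mul (h : Acts α f 1) (h' : Acts β f' 1) (hf : ∀ i, 1 ≤ i → i ≤ k → f i ≤ k)
    (h0 : f' 0 = 0) : Acts (α * β) (f' ∘ f) 1 := by
  intro i s j t
  rw [SymInv.maps_mul]
  constructor
  · rintro ⟨q, hq, hq'⟩
    obtain ⟨l, u, rfl⟩ := exists_pt q
    rw [h] at hq
    rw [h'] at hq'
    exact ⟨by rw [Function.comp_apply, hq.1, hq'.1], by rw [hq'.2, hq.2]; rfl⟩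
  · rintro ⟨hi, rfl⟩
    rw [Function.comp_apply] at hi
    have hne : f (i + 1) ≠ 0 := fun h1 => by rw [h1, h0] at hi; omega
    have hle := hf (i + 1) (by omega) (by omega)
    refine ⟨pt ⟨f (i + 1) - 1, by omega⟩ t, (h _ _ _ _).2 ⟨by simp only; omega, rfl⟩,
      (h' _ _ _ _).2 ⟨?_, rfl⟩⟩
    simp only
    rwa [Nat.sub_add_cancel (by omega)]

end Acts

theorem maps_unitBar {k m : ℕ} (z : Fin k → Equiv.Perm (Fin m)) (i : Fin k) (s : Fin m) (j : Fin k)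
    (t : Fin m) : (unitBar z).Maps (pt i s) (pt j t) ↔ j = i ∧ t = z i s := by
  change some _ = some _ ↔ _
  rw [Option.some_inj]
  simp [pt, eq_comm]

/-- The permutations of the positions in all intervals, acting on the right. -/
abbrev UnitGroup (k m : ℕ) : Type := Fin k → (Equiv.Perm (Fin m))ᵐᵒᵖ

theorem maps_unitBar_mul {k m : ℕ} (z : Fin k → Equiv.Perm (Fin m)) (α : SymInv (Fin (k * m)))
    (i : Fin k) (s : Fin m) (q : Fin (k * m)) :
    (unitBar z * α).Maps (pt i s) q ↔ α.Maps (pt i (z i s)) q := by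
  rw [SymInv.maps_mul]
  constructor
  · rintro ⟨p, hp, hpq⟩
    obtain ⟨j, t, rfl⟩ := exists_pt p
    rw [maps_unitBar] at hp
    obtain ⟨rfl, rfl⟩ := hp
    exact hpq
  · exact fun h => ⟨_, (maps_unitBar z i s i _).2 ⟨rfl, rfl⟩, h⟩

theorem Acts.unitBar_mul {k m : ℕ} {α : SymInv (Fin (k * m))} {f : ℕ → ℕ} (h : Acts α f 1)
    (z : Fin k → Equiv.Perm (Fin m)) : Acts (unitBar z * α) f z := by
  intro i s j t
  rw [maps_unitBar_mul, h]
  rfl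

theorem Acts.mul_unitBar {k m : ℕ} {α : SymInv (Fin (k * m))} {f : ℕ → ℕ} (h : Acts α f 1)
    (y z : Fin k → Equiv.Perm (Fin m)) (hyz : ∀ i j : Fin k, f (i + 1) = j + 1 → y j = z i) :
    Acts (α * unitBar y) f z := by
  intro i s j t
  rw [SymInv.maps_mul]
  constructor
  · rintro ⟨p, hp, hpq⟩
    obtain ⟨l, u, rfl⟩ := exists_pt p
    rw [h] at hp
    rw [maps_unitBar] at hpq
    obtain ⟨rfl, rfl⟩ := hpq
    refine ⟨hp.1, ?_⟩
    rw [hyz i j hp.1, hp.2]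
    rfl
  · rintro ⟨hi, rfl⟩
    exact ⟨pt j s, (h _ _ _ _).2 ⟨hi, rfl⟩, (maps_unitBar _ _ _ _ _).2 ⟨rfl, by rw [hyz i j hi]⟩⟩

/-- `unitBar` as a homomorphism on the direct power of the symmetric group. -/
def unitHom (k m : ℕ) : UnitGroup k m →* SymInv (Fin (k * m)) where
  toFun z := unitBar fun i => (z i).unop
  map_one' := SymInv.ext fun p q => by
    obtain ⟨i, s, rfl⟩ := exists_pt p
    obtain ⟨j, t, rfl⟩ := exists_pt q
    rw [maps_unitBar, SymInv.maps_one, pt_inj]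
    simp [eq_comm]
  map_mul' y z := SymInv.ext fun p q => by
    obtain ⟨i, s, rfl⟩ := exists_pt p
    obtain ⟨j, t, rfl⟩ := exists_pt q
    rw [maps_unitBar_mul, maps_unitBar, maps_unitBar]
    simp

theorem bBar_eq {k m : ℕ} (i : Fin k) :
    bBar k m i = unitHom k m (Pi.mulSingle i (MulOpposite.op (permB m))) := by
  refine congrArg unitBar (funext fun j => ?_)
  by_cases h : j = i
  · subst h; simp
  · simp [h]

theorem cBar_eq {k m : ℕ} (hm : 2 ≤ m) (i : Fin k) :
    cBar k hm i = unitHom k m (Pi.mulSingle i (MulOpposite.op (permA hm) * MulOpposite.op (permB m))) := by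
  refine congrArg unitBar (funext fun j => ?_)
  by_cases h : j = i
  · subst h; simp; rfl
  · simp [h]

theorem acts_xBar {k m : ℕ} (hk : 0 < k) {j : ℕ} (hj : j < k) :
    Acts (xBar k m ⟨(k - j) % k, Nat.mod_lt _ hk⟩) (chainStep j) 1 := by
  intro i s l t
  rw [xBar, ofGraph_maps, divNat_pt, divNat_pt, modNat_pt, modNat_pt, eq_comm (a := s)]
  refine and_congr ?_ Iff.rfl
  unfold XGraph chainStep
  rcases Nat.eq_zero_or_pos j with rfl | hj0
  · simp only [Nat.sub_zero, Nat.mod_self, if_true]; omega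
  · simp only [Nat.mod_eq_of_lt (show k - j < k by omega)]
    split_ifs <;> first | omega | (rw [iff_false]; omega)


/-! ### The relations between the letters `b_i`, `c_i` and `x_i` -/

/-- The relations `U` for one value of `i`. -/
structure URels {N : Type*} [Monoid N] (m : ℕ) (β γ : N) : Prop where
  sq : (γ * β ^ (m - 1)) ^ 2 = 1
  pow : β ^ m = 1
  mul_pow : (β * γ * β ^ (m - 1)) ^ (m - 1) = 1
  cube : (γ * β ^ (m - 2) * γ) ^ 3 = 1
  comm : ∀ j, 2 ≤ j → j + 2 ≤ m → (γ * β ^ (m - j - 1) * γ * β ^ (j - 1)) ^ 2 = 1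

theorem URels.map {N N' : Type*} [Monoid N] [Monoid N'] {m : ℕ} {β γ : N} (h : URels m β γ)
    (f : N →* N') : URels m (f β) (f γ) where
  sq := by simpa using congrArg f h.sq
  pow := by simpa using congrArg f h.pow
  mul_pow := by simpa using congrArg f h.mul_pow
  cube := by simpa using congrArg f h.cube
  comm j h2 hj := by simpa using congrArg f (h.comm j h2 hj)

theorem URels.of_map {N N' : Type*} [Monoid N] [Monoid N'] {m : ℕ} {β γ : N} {f : N →* N'}
    (hf : Function.Injective f) (h : URels m (f β) (f γ)) : URels m β γ where
  sq := hf (by simpa using h.sq)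
  pow := hf (by simpa using h.pow)
  mul_pow := hf (by simpa using h.mul_pow)
  cube := hf (by simpa using h.cube)
  comm j h2 hj := hf (by simpa using h.comm j h2 hj)

theorem uRels_iff_mooreRels {G : Type*} [Group G] {m : ℕ} (hm : 2 ≤ m) {β γ : G} :
    URels m β γ ↔ MooreRels m (γ * β⁻¹) β := by
  have hpow : β ^ m = 1 → ∀ i ≤ m, β ^ (m - i) = (β ^ i)⁻¹ := by
    intro h i hi
    rw [eq_inv_iff_mul_eq_one, ← pow_add, Nat.sub_add_cancel hi, h]
  have e1 : β ^ m = 1 → γ * β ^ (m - 1) = γ * β⁻¹ := by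
    intro h; rw [hpow h 1 (by omega), pow_one]
  have e2 : β ^ m = 1 → β * γ * β ^ (m - 1) = β * (γ * β⁻¹) := by
    intro h; rw [hpow h 1 (by omega), pow_one, mul_assoc]
  have e3 : β ^ m = 1 → γ * β ^ (m - 2) * γ = γ * β⁻¹ * (β⁻¹ * (γ * β⁻¹) * β) := by
    intro h; rw [hpow h 2 (by omega), pow_two]; group
  have e4 : β ^ m = 1 → ∀ j, 2 ≤ j → j + 2 ≤ m → γ * β ^ (m - j - 1) * γ * β ^ (j - 1) =
      γ * β⁻¹ * ((β ^ j)⁻¹ * (γ * β⁻¹) * β ^ j) := by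
    intro h j h2 hj
    obtain ⟨j, rfl⟩ : ∃ i, j = i + 1 := ⟨j - 1, by omega⟩
    have e : β⁻¹ * β ^ (j + 1) = β ^ j := by rw [pow_succ', inv_mul_cancel_left]
    rw [Nat.sub_sub, hpow h (j + 1 + 1) (by omega), Nat.add_sub_cancel, pow_succ β (j + 1)]
    simp only [mul_inv_rev, mul_assoc, e]
  constructor
  · intro h
    exact ⟨e1 h.pow ▸ h.sq, h.pow, e2 h.pow ▸ h.mul_pow, e3 h.pow ▸ h.cube,
      fun j h2 hj => e4 h.pow j h2 hj ▸ h.comm j h2 hj⟩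
  · intro h
    exact ⟨(e1 h.pow).symm ▸ h.sq, h.pow, (e2 h.pow).symm ▸ h.mul_pow, (e3 h.pow).symm ▸ h.cube,
      fun j h2 hj => (e4 h.pow j h2 hj).symm ▸ h.comm j h2 hj⟩

/-- The relations between the generators `g` of the monoid of the chain and elements `E p` which act
on the interval of index `p` only. -/
structure MixRels {N : Type*} [Monoid N] (k : ℕ) (g : ℕ → N) (E : Fin k → N) : Prop where
  left : ∀ j < k, ∀ p : Fin k, chainStep j (p + 1) = 0 → E p * g j = g j
  right : ∀ j < k, ∀ q : Fin k, (∀ p : Fin k, chainStep j (p + 1) ≠ q + 1) → g j * E q = g j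
  swap : ∀ j < k, ∀ p q : Fin k, chainStep j (p + 1) = q + 1 → g j * E q = E p * g j

section Map

variable {N : Type*} [Monoid N] {k : ℕ} (F : Word k →* N) (hk : 0 < k) (m : ℕ)

theorem map_b {i : ℕ} (h : 1 ≤ i ∧ i ≤ k) (p : Fin k) (hp : i = p + 1) :
    F (b i h) = F (FreeMonoid.of (Letter.b p)) := by
  subst hp; rfl

theorem map_c {i : ℕ} (h : 1 ≤ i ∧ i ≤ k) (p : Fin k) (hp : i = p + 1) :
    F (c i h) = F (FreeMonoid.of (Letter.c p)) := by
  subst hp; rfl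

theorem uRels_of_relU (h : ∀ u v, RelU k m u v → F u = F v) (p : Fin k) :
    URels m (F (FreeMonoid.of (Letter.b p))) (F (FreeMonoid.of (Letter.c p))) := by
  have hp : 1 ≤ (p : ℕ) + 1 ∧ (p : ℕ) + 1 ≤ k := by omega
  have h1 := h _ _ (RelU.u1 _ hp)
  have h2 := h _ _ (RelU.u2 _ hp)
  have h3 := h _ _ (RelU.u3 _ hp)
  have h4 := h _ _ (RelU.u4 _ hp)
  have h5 := fun j hj => h _ _ (RelU.u5 _ j hp hj)
  simp only [map_mul, map_pow, map_one] at h1 h2 h3 h4 h5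
  exact ⟨h1, h2, h3, h4, fun j h2 hj => h5 j ⟨h2, hj⟩⟩

theorem relU_of_uRels
    (h : ∀ p, URels m (F (FreeMonoid.of (Letter.b p))) (F (FreeMonoid.of (Letter.c p))))
    (hbb : ∀ p q, p ≠ q → Commute (F (FreeMonoid.of (Letter.b p))) (F (FreeMonoid.of (Letter.b q))))
    (hcc : ∀ p q, p ≠ q → Commute (F (FreeMonoid.of (Letter.c p))) (F (FreeMonoid.of (Letter.c q))))
    (hbc : ∀ p q, p ≠ q → Commute (F (FreeMonoid.of (Letter.b p))) (F (FreeMonoid.of (Letter.c q))))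
    {u v : Word k} (huv : RelU k m u v) : F u = F v := by
  cases huv with
  | u1 i hi => simp only [map_mul, map_pow, map_one]; exact (h ⟨i - 1, by omega⟩).sq
  | u2 i hi => simp only [map_pow, map_one]; exact (h ⟨i - 1, by omega⟩).pow
  | u3 i hi => simp only [map_mul, map_pow, map_one]; exact (h ⟨i - 1, by omega⟩).mul_pow
  | u4 i hi => simp only [map_mul, map_pow, map_one]; exact (h ⟨i - 1, by omega⟩).cube
  | u5 i j hi hj =>
    simp only [map_mul, map_pow, map_one]
    exact (h ⟨i - 1, by omega⟩).comm j hj.1 hj.2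
  | u6_bb i j hij =>
    rw [map_mul, map_mul]
    exact hbb ⟨i - 1, by omega⟩ ⟨j - 1, by omega⟩ (by rw [Ne, Fin.mk.injEq]; omega)
  | u6_cc i j hij =>
    rw [map_mul, map_mul]
    exact hcc ⟨i - 1, by omega⟩ ⟨j - 1, by omega⟩ (by rw [Ne, Fin.mk.injEq]; omega)
  | u6_bc i j hi hj hij =>
    rw [map_mul, map_mul]
    exact hbc ⟨i - 1, by omega⟩ ⟨j - 1, by omega⟩ (by rw [Ne, Fin.mk.injEq]; omega)

theorem mixRels_of_relU'_b (h : ∀ u v, RelU' k m u v → F u = F v) :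
    MixRels k (chainGen F hk) fun p => F (FreeMonoid.of (Letter.b p)) where
  left j hj p hp := by
    rw [chainStep] at hp
    rcases Nat.eq_zero_or_pos j with rfl | hj0
    · rw [if_pos rfl] at hp
      have := h _ _ (RelU'.u1_b hk)
      rwa [map_mul, map_b F _ p (by omega), map_x_zero F hk] at this
    · rw [if_neg (by omega)] at hp
      have hp' : (p : ℕ) = j := by split_ifs at hp; omega
      have := h _ _ (RelU'.u4_b (j + 1) (by omega))
      rwa [map_mul, map_b F _ p (by omega), map_x F hk (by omega) (by omega),
        show k - (k - (j + 1) + 1) = j by omega] at this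
  right j hj q hq := by
    rcases Nat.eq_zero_or_pos j with rfl | hj0
    · have hq' : (q : ℕ) + 1 = k := by
        by_contra hne
        have := hq ⟨q + 1, by omega⟩
        simp [chainStep] at this
      have := h _ _ (RelU'.u3_b 0 (by omega))
      rwa [map_mul, map_b F _ q (by omega), map_x_zero F hk] at this
    · have hq' : (q : ℕ) + 1 = j := by
        by_contra hne
        by_cases hqj : (q : ℕ) = j
        · have := hq ⟨j - 1, by omega⟩
          rw [chainStep, if_neg (by omega), if_pos (by simp only; omega)] at this
          omega
        · have := hq q
          rw [chainStep, if_neg (by omega), if_neg hne, if_neg (by omega)] at this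
          omega
      have := h _ _ (RelU'.u3_b (k - j) (by omega))
      rwa [map_mul, map_b F _ q (by omega), map_x F hk (by omega) (by omega),
        show k - (k - j) = j by omega] at this
  swap j hj p q hpq := by
    rw [chainStep] at hpq
    rcases Nat.eq_zero_or_pos j with rfl | hj0
    · rw [if_pos rfl] at hpq
      have := h _ _ (RelU'.u2_b (q + 1) (by omega))
      rwa [map_mul, map_mul, map_b F _ q rfl, map_b F _ p (by omega), map_x_zero F hk] at this
    · rw [if_neg (by omega)] at hpq
      by_cases hp : (p : ℕ) + 1 = j
      · rw [if_pos hp] at hpq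
        have := h _ _ (RelU'.u5_b (k - j) (by omega))
        rwa [map_mul, map_mul, map_b F _ q (by omega), map_b F _ p (by omega),
          map_x F hk (by omega) (by omega), show k - (k - j) = j by omega] at this
      · rw [if_neg hp] at hpq
        have hp' : (p : ℕ) ≠ j ∧ p = q := by split_ifs at hpq; omega
        obtain ⟨hp', rfl⟩ := hp'
        have := h _ _ (RelU'.u6_b (k - j) (p + 1) (by omega) (by omega) (by omega))
        rwa [map_mul, map_mul, map_b F _ p rfl, map_x F hk (by omega) (by omega),
          show k - (k - j) = j by omega] at this

theorem mixRels_of_relU'_c (h : ∀ u v, RelU' k m u v → F u = F v) :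
    MixRels k (chainGen F hk) fun p =>
      F (FreeMonoid.of (Letter.c p)) * F (FreeMonoid.of (Letter.b p)) ^ (m - 1) where
  left j hj p hp := by
    rw [chainStep] at hp
    rcases Nat.eq_zero_or_pos j with rfl | hj0
    · rw [if_pos rfl] at hp
      have := h _ _ (RelU'.u1_c hk)
      rwa [map_mul, map_mul, map_pow, map_b F _ p (by omega), map_c F _ p (by omega),
        map_x_zero F hk] at this
    · rw [if_neg (by omega)] at hp
      have hp' : (p : ℕ) = j := by split_ifs at hp; omega
      have := h _ _ (RelU'.u4_c (j + 1) (by omega))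
      rwa [map_mul, map_mul, map_pow, map_b F _ p (by omega), map_c F _ p (by omega),
        map_x F hk (by omega) (by omega), show k - (k - (j + 1) + 1) = j by omega] at this
  right j hj q hq := by
    rw [← mul_assoc]
    rcases Nat.eq_zero_or_pos j with rfl | hj0
    · have hq' : (q : ℕ) + 1 = k := by
        by_contra hne
        have := hq ⟨q + 1, by omega⟩
        simp [chainStep] at this
      have := h _ _ (RelU'.u3_c 0 (by omega))
      rwa [map_mul, map_mul, map_pow, map_b F _ q (by omega), map_c F _ q (by omega),
        map_x_zero F hk] at this
    · have hq' : (q : ℕ) + 1 = j := by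
        by_contra hne
        by_cases hqj : (q : ℕ) = j
        · have := hq ⟨j - 1, by omega⟩
          rw [chainStep, if_neg (by omega), if_pos (by simp only; omega)] at this
          omega
        · have := hq q
          rw [chainStep, if_neg (by omega), if_neg hne, if_neg (by omega)] at this
          omega
      have := h _ _ (RelU'.u3_c (k - j) (by omega))
      rwa [map_mul, map_mul, map_pow, map_b F _ q (by omega), map_c F _ q (by omega),
        map_x F hk (by omega) (by omega), show k - (k - j) = j by omega] at this
  swap j hj p q hpq := by
    rw [← mul_assoc]
    rw [chainStep] at hpq
    rcases Nat.eq_zero_or_pos j with rfl | hj0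
    · rw [if_pos rfl] at hpq
      have := h _ _ (RelU'.u2_c (q + 1) (by omega))
      rwa [map_mul, map_mul, map_mul, map_mul, map_pow, map_pow, map_b F _ q rfl, map_c F _ q rfl,
        map_b F _ p (by omega), map_c F _ p (by omega), map_x_zero F hk] at this
    · rw [if_neg (by omega)] at hpq
      by_cases hp : (p : ℕ) + 1 = j
      · rw [if_pos hp] at hpq
        have := h _ _ (RelU'.u5_c (k - j) (by omega))
        rwa [map_mul, map_mul, map_mul, map_mul, map_pow, map_pow, map_b F _ q (by omega),
          map_c F _ q (by omega), map_b F _ p (by omega), map_c F _ p (by omega),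
          map_x F hk (by omega) (by omega), show k - (k - j) = j by omega] at this
      · rw [if_neg hp] at hpq
        have hp' : (p : ℕ) ≠ j ∧ p = q := by split_ifs at hpq; omega
        obtain ⟨hp', rfl⟩ := hp'
        have := h _ _ (RelU'.u6_c (k - j) (p + 1) (by omega) (by omega) (by omega))
        rwa [map_mul, map_mul, map_mul, map_mul, map_pow, map_b F _ p rfl, map_c F _ p rfl,
          map_x F hk (by omega) (by omega), show k - (k - j) = j by omega] at this

theorem relU'_of_mixRels
    (hB : MixRels k (chainGen F hk) fun p => F (FreeMonoid.of (Letter.b p)))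
    (hA : MixRels k (chainGen F hk) fun p =>
      F (FreeMonoid.of (Letter.c p)) * F (FreeMonoid.of (Letter.b p)) ^ (m - 1))
    {u v : Word k} (huv : RelU' k m u v) : F u = F v := by
  cases huv with
  | u1_c hk1 =>
    rw [map_mul, map_mul, map_pow, map_x_zero F hk]
    exact hA.left 0 hk ⟨0, hk⟩ (by simp [chainStep])
  | u1_b hk1 =>
    rw [map_mul, map_x_zero F hk]
    exact hB.left 0 hk ⟨0, hk⟩ (by simp [chainStep])
  | u2_c i hi =>
    rw [map_mul, map_mul, map_mul, map_mul, map_pow, map_pow, map_x_zero F hk, mul_assoc]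
    exact hA.swap 0 hk ⟨i, by omega⟩ ⟨i - 1, by omega⟩
      (by rw [chainStep, if_pos rfl]; simp only; omega)
  | u2_b i hi =>
    rw [map_mul, map_mul, map_x_zero F hk]
    exact hB.swap 0 hk ⟨i, by omega⟩ ⟨i - 1, by omega⟩
      (by rw [chainStep, if_pos rfl]; simp only; omega)
  | u3_c i hi =>
    rw [map_mul, map_mul, map_pow, mul_assoc]
    rcases Nat.eq_zero_or_pos i with rfl | hi0
    · rw [map_x_zero F hk]
      exact hA.right 0 hk ⟨k - 1, by omega⟩
        (by intro p; rw [chainStep, if_pos rfl]; simp only; omega)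
    · rw [map_x F hk hi0 hi]
      refine hA.right (k - i) (by omega) ⟨k - i - 1, by omega⟩ fun p => ?_
      rw [chainStep, if_neg (by omega)]
      simp only
      split_ifs <;> omega
  | u3_b i hi =>
    rw [map_mul]
    rcases Nat.eq_zero_or_pos i with rfl | hi0
    · rw [map_x_zero F hk]
      exact hB.right 0 hk ⟨k - 1, by omega⟩
        (by intro p; rw [chainStep, if_pos rfl]; simp only; omega)
    · rw [map_x F hk hi0 hi]
      refine hB.right (k - i) (by omega) ⟨k - i - 1, by omega⟩ fun p => ?_
      rw [chainStep, if_neg (by omega)]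
      simp only
      split_ifs <;> omega
  | u4_c i hi =>
    rw [map_mul, map_mul, map_pow, map_x F hk (by omega) (by omega)]
    refine hA.left _ (by omega) ⟨i - 1, by omega⟩ ?_
    rw [chainStep, if_neg (by omega), if_neg (by simp only; omega), if_pos (by simp only; omega)]
  | u4_b i hi =>
    rw [map_mul, map_x F hk (by omega) (by omega)]
    refine hB.left _ (by omega) ⟨i - 1, by omega⟩ ?_
    rw [chainStep, if_neg (by omega), if_neg (by simp only; omega), if_pos (by simp only; omega)]
  | u5_c i hi =>
    rw [map_mul, map_mul, map_mul, map_mul, map_pow, map_pow, map_x F hk hi.1 (by omega), mul_assoc]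
    refine hA.swap (k - i) (by omega) ⟨k - i - 1, by omega⟩ ⟨k - i + 1 - 1, by omega⟩ ?_
    rw [chainStep, if_neg (by omega), if_pos (by simp only; omega)]
    simp
  | u5_b i hi =>
    rw [map_mul, map_mul, map_x F hk hi.1 (by omega)]
    refine hB.swap (k - i) (by omega) ⟨k - i - 1, by omega⟩ ⟨k - i + 1 - 1, by omega⟩ ?_
    rw [chainStep, if_neg (by omega), if_pos (by simp only; omega)]
    simp
  | u6_c i j hi hj hij =>
    rw [map_mul, map_mul, map_mul, map_mul, map_pow, map_x F hk hi.1 (by omega), mul_assoc]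
    refine hA.swap (k - i) (by omega) ⟨j - 1, by omega⟩ ⟨j - 1, by omega⟩ ?_
    rw [chainStep, if_neg (by omega), if_neg (by simp only; omega), if_neg (by simp only; omega)]
  | u6_b i j hi hj hij =>
    rw [map_mul, map_mul, map_x F hk hi.1 (by omega)]
    refine hB.swap (k - i) (by omega) ⟨j - 1, by omega⟩ ⟨j - 1, by omega⟩ ?_
    rw [chainStep, if_neg (by omega), if_neg (by simp only; omega), if_neg (by simp only; omega)]

end Map

/-! ### The relations hold in `POI_{k×m}` -/

section Standard

variable {k m : ℕ} (hk : 0 < k) (hm : 2 ≤ m)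

/-- The standard generators. -/
noncomputable def letterBar : Letter k → SymInv (Fin (k * m))
  | Letter.b i => bBar k m i
  | Letter.c i => cBar k hm i
  | Letter.x i => xBar k m i

theorem acts_one : Acts (1 : SymInv (Fin (k * m))) id 1 := by
  intro i s j t
  rw [SymInv.maps_one, pt_inj]
  simp only [id, Pi.one_apply, Equiv.Perm.one_apply]
  constructor
  · rintro ⟨rfl, rfl⟩; exact ⟨rfl, rfl⟩
  · rintro ⟨h, rfl⟩; exact ⟨Fin.ext (by omega), rfl⟩

theorem acts_chainGen {j : ℕ} (hj : j < k) :
    Acts (chainGen (FreeMonoid.lift (letterBar (k := k) hm)) hk j) (chainStep j) 1 := by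
  rw [chainGen, FreeMonoid.lift_eval_of]
  exact acts_xBar hk hj

theorem acts_val {w : List ℕ} (hw : ∀ j ∈ w, j < k) :
    Acts (val (chainGen (FreeMonoid.lift (letterBar (k := k) hm)) hk) w) (chainAct w) 1 := by
  induction w with
  | nil => exact acts_one
  | cons j w ih =>
    have hj : j < k := hw j (by simp)
    rw [val_cons]
    exact (acts_chainGen hk hm hj).mul (ih fun i hi => hw i (List.mem_cons_of_mem _ hi))
      (fun i _ hi => chainStep_le hj hi) (chainAct_zero w)

theorem val_standard_eq {w w' : List ℕ} (hw : ∀ j ∈ w, j < k) (hw' : ∀ j ∈ w', j < k)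
    (h : ∀ p, 1 ≤ p → p ≤ k → chainAct w p = chainAct w' p) :
    val (chainGen (FreeMonoid.lift (letterBar (m := m) hm)) hk) w =
      val (chainGen (FreeMonoid.lift (letterBar (m := m) hm)) hk) w' :=
  (acts_val hk hm hw).ext (acts_val hk hm hw') (fun i => h _ (by omega) (by omega)) fun _ _ => rfl

theorem chainStep_cases (j p : ℕ) : (j = 0 ∧ chainStep j p = p - 1) ∨
    (j ≠ 0 ∧ p = j ∧ chainStep j p = j + 1) ∨ (j ≠ 0 ∧ p = j + 1 ∧ chainStep j p = 0) ∨
    (j ≠ 0 ∧ p ≠ j ∧ p ≠ j + 1 ∧ chainStep j p = p) := by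
  unfold chainStep; split_ifs <;> omega

theorem chainAct_descWord_cases {s t : ℕ} (p : ℕ) (hs : 1 ≤ s) (hst : s ≤ t) :
    (s ≤ p ∧ p < t ∧ chainAct (descWord s t) p = p + 1) ∨
    (p = t ∧ s < t ∧ chainAct (descWord s t) p = 0) ∨
    ((p < s ∨ t < p ∨ s = t) ∧ chainAct (descWord s t) p = p) := by
  rw [chainAct_descWord hs hst]; split_ifs <;> omega

theorem chainRels_standard (hk2 : 2 ≤ k) :
    ChainRels (chainGen (FreeMonoid.lift (letterBar (k := k) hm)) hk) k where
  shift j h2 hj := by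
    have := val_standard_eq hk hm (w := [j, 0]) (w' := [0, j - 1]) (by simp; omega) (by simp; omega)
      (fun p _ _ => by
        have h1 := chainStep_cases j p
        have h2 := chainStep_cases 0 (chainStep j p)
        have h3 := chainStep_cases 0 p
        have h4 := chainStep_cases (j - 1) (chainStep 0 p)
        simp only [chainAct_cons, chainAct_nil]
        omega)
    simpa [mul_assoc] using this
  comm i j hi hij hj := by
    have := val_standard_eq hk hm (w := [i, j]) (w' := [j, i]) (by simp; omega) (by simp; omega)
      (fun p _ _ => by
        have h1 := chainStep_cases i p
        have h2 := chainStep_cases j (chainStep i p)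
        have h3 := chainStep_cases j p
        have h4 := chainStep_cases i (chainStep j p)
        simp only [chainAct_cons, chainAct_nil]
        omega)
    simpa [Commute, SemiconjBy] using this
  zero_last := by
    have := val_standard_eq hk hm (w := [0, 0, k - 1]) (w' := [0, 0]) (by simp; omega)
      (by simp; omega) (fun p _ _ => by
        have h1 := chainStep_cases 0 p
        have h2 := chainStep_cases 0 (chainStep 0 p)
        have h3 := chainStep_cases (k - 1) (chainStep 0 (chainStep 0 p))
        simp only [chainAct_cons, chainAct_nil]
        omega)
    simpa [mul_assoc] using this
  one_zero := by
    have := val_standard_eq hk hm (w := [1, 0, 0]) (w' := [0, 0]) (by simp; omega)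
      (by simp; omega) (fun p _ _ => by
        have h1 := chainStep_cases 1 p
        have h2 := chainStep_cases 0 (chainStep 1 p)
        have h3 := chainStep_cases 0 (chainStep 0 (chainStep 1 p))
        have h4 := chainStep_cases 0 p
        have h5 := chainStep_cases 0 (chainStep 0 p)
        simp only [chainAct_cons, chainAct_nil]
        omega)
    simpa [mul_assoc] using this
  braid_left j hj hjk := by
    have := val_standard_eq hk hm (w := [j, j + 1, j]) (w' := [j, j + 1]) (by simp; omega)
      (by simp; omega) (fun p _ _ => by
        have h1 := chainStep_cases j p
        have h2 := chainStep_cases (j + 1) (chainStep j p)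
        have h3 := chainStep_cases j (chainStep (j + 1) (chainStep j p))
        simp only [chainAct_cons, chainAct_nil]
        omega)
    simpa [mul_assoc] using this
  braid_right j hj hjk := by
    have := val_standard_eq hk hm (w := [j + 1, j, j + 1]) (w' := [j, j + 1]) (by simp; omega)
      (by simp; omega) (fun p _ _ => by
        have h1 := chainStep_cases (j + 1) p
        have h2 := chainStep_cases j (chainStep (j + 1) p)
        have h3 := chainStep_cases (j + 1) (chainStep j (chainStep (j + 1) p))
        have h4 := chainStep_cases j p
        have h5 := chainStep_cases (j + 1) (chainStep j p)
        simp only [chainAct_cons, chainAct_nil]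
        omega)
    simpa [mul_assoc] using this
  zero_desc := by
    have := val_standard_eq hk hm (w := 0 :: (descWord 1 k ++ [0])) (w' := [0])
      (fun i hi => by
        simp only [List.mem_append, List.mem_cons, mem_descWord, List.not_mem_nil,
          or_false] at hi
        omega) (by simpa using hk) (fun p _ _ => by
        have h1 := chainStep_cases 0 p
        have h2 := chainAct_descWord_cases (chainStep 0 p) le_rfl hk
        have h3 := chainStep_cases 0 (chainAct (descWord 1 k) (chainStep 0 p))
        simp only [chainAct_cons, chainAct_nil, chainAct_append]
        omega)
    simpa [mul_assoc] using this
  killer_succ j hj hjk := by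
    have := val_standard_eq hk hm (w := descWord 1 (j + 1) ++ 0 :: descWord j k) (w' := [j])
      (fun i hi => by
        simp only [List.mem_append, List.mem_cons, mem_descWord] at hi
        omega) (by simpa using hjk) (fun p _ _ => by
        have h1 := chainAct_descWord_cases (s := 1) (t := j + 1) p le_rfl (by omega)
        have h2 := chainStep_cases 0 (chainAct (descWord 1 (j + 1)) p)
        have h3 := chainAct_descWord_cases (chainStep 0 (chainAct (descWord 1 (j + 1)) p)) hj hjk.le
        have h4 := chainStep_cases j p
        simp only [chainAct_cons, chainAct_nil, chainAct_append]
        omega)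
    simpa [mul_assoc] using this
  killer_self j hj hjk := by
    have := val_standard_eq hk hm (w := descWord 1 j ++ 0 :: (descWord j k ++ [j])) (w' := [j, j])
      (fun i hi => by
        simp only [List.mem_append, List.mem_cons, mem_descWord, List.not_mem_nil,
          or_false] at hi
        omega) (by simpa using hjk) (fun p _ _ => by
        have h1 := chainAct_descWord_cases (s := 1) (t := j) p le_rfl hj
        have h2 := chainStep_cases 0 (chainAct (descWord 1 j) p)
        have h3 := chainAct_descWord_cases (chainStep 0 (chainAct (descWord 1 j) p)) hj hjk.le
        have h4 := chainStep_cases j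
          (chainAct (descWord j k) (chainStep 0 (chainAct (descWord 1 j) p)))
        have h5 := chainStep_cases j p
        have h6 := chainStep_cases j (chainStep j p)
        simp only [chainAct_cons, chainAct_nil, chainAct_append]
        omega)
    simpa [mul_assoc, killer] using this

/-- The unit which acts on the interval of index `p` as `σ`. -/
def singleUnit (k : ℕ) {m : ℕ} (σ : (Equiv.Perm (Fin m))ᵐᵒᵖ) (p : Fin k) : SymInv (Fin (k * m)) :=
  unitHom k m (Pi.mulSingle p σ)

theorem mixRels_standard (σ : (Equiv.Perm (Fin m))ᵐᵒᵖ) :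
    MixRels k (chainGen (FreeMonoid.lift (letterBar (k := k) hm)) hk) (singleUnit k σ) where
  left j hj p hp := by
    refine ((acts_chainGen hk hm hj).unitBar_mul _).ext (acts_chainGen hk hm hj) (fun _ => rfl)
      fun i hi => ?_
    rw [Pi.mulSingle_eq_of_ne (fun e => hi (by rw [e, hp]))]
    rfl
  right j hj q hq := by
    refine Acts.ext ((acts_chainGen hk hm hj).mul_unitBar _ 1 fun i l hl => ?_)
      (acts_chainGen hk hm hj) (fun _ => rfl) fun _ _ => rfl
    rw [Pi.mulSingle_eq_of_ne (fun e => hq i (by rw [hl, e]))]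
    rfl
  swap j hj p q hpq := by
    refine Acts.ext ((acts_chainGen hk hm hj).mul_unitBar _ _ fun i l hl => ?_)
      ((acts_chainGen hk hm hj).unitBar_mul _) (fun _ => rfl) fun _ _ => rfl
    by_cases hip : i = p
    · subst hip
      rw [show l = q from Fin.ext (by omega)]
      simp
    · have hlq : l ≠ q := fun e => hip (Fin.ext (by
        have := chainStep_inj (hl.trans ((e ▸ hpq).symm)) (by omega)
        omega))
      rw [Pi.mulSingle_eq_of_ne hip, Pi.mulSingle_eq_of_ne hlq]

theorem relU_standard {u v : Word k} (huv : RelU k m u v) :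
    FreeMonoid.lift (letterBar hm) u = FreeMonoid.lift (letterBar hm) v := by
  have hU : URels m (MulOpposite.op (permB m)) (MulOpposite.op (permA hm) * MulOpposite.op (permB m)) := by
    rw [uRels_iff_mooreRels hm, mul_inv_cancel_right]
    exact mooreRels_perm hm
  have hb : ∀ p, FreeMonoid.lift (letterBar (k := k) hm) (FreeMonoid.of (Letter.b p)) =
      unitHom k m (Pi.mulSingle p (MulOpposite.op (permB m))) := fun p => by
    rw [FreeMonoid.lift_eval_of]; exact bBar_eq p
  have hc : ∀ p, FreeMonoid.lift (letterBar (k := k) hm) (FreeMonoid.of (Letter.c p)) =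
      unitHom k m (Pi.mulSingle p (MulOpposite.op (permA hm) * MulOpposite.op (permB m))) :=
    fun p => by rw [FreeMonoid.lift_eval_of]; exact cBar_eq hm p
  refine relU_of_uRels _ m (fun p => ?_) (fun p q hpq => ?_) (fun p q hpq => ?_)
    (fun p q hpq => ?_) huv
  · rw [hb, hc]
    have := (hU.map (MonoidHom.mulSingle (fun _ : Fin k => (Equiv.Perm (Fin m))ᵐᵒᵖ) p)).map
      (unitHom k m)
    simpa only [MonoidHom.mulSingle_apply] using this
  · rw [hb, hb]
    exact (Pi.mulSingle_commute hpq _ _).map (unitHom k m)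
  · rw [hc, hc]
    exact (Pi.mulSingle_commute hpq _ _).map (unitHom k m)
  · rw [hb, hc]
    exact (Pi.mulSingle_commute hpq _ _).map (unitHom k m)

include hk in
theorem relU'_standard {u v : Word k} (huv : RelU' k m u v) :
    FreeMonoid.lift (letterBar hm) u = FreeMonoid.lift (letterBar hm) v := by
  refine relU'_of_mixRels _ hk m ?_ ?_ huv
  · convert mixRels_standard hk hm (MulOpposite.op (permB m)) using 2 with p
    simp only [FreeMonoid.lift_eval_of, letterBar, bBar_eq, singleUnit]
  · convert mixRels_standard hk hm (MulOpposite.op (permA hm)) using 2 with p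
    simp only [FreeMonoid.lift_eval_of, letterBar, bBar_eq, cBar_eq, singleUnit]
    rw [← map_pow, ← map_mul, ← Pi.mulSingle_pow, ← Pi.mulSingle_mul, mul_assoc, ← pow_succ',
      Nat.sub_add_cancel (by omega), (mooreRels_perm hm).pow, mul_one]

theorem rel_standard (hk2 : 2 ≤ k) (u v : Word k) (huv : Rel k m u v) :
    FreeMonoid.lift (letterBar hm) u = FreeMonoid.lift (letterBar hm) v := by
  rcases huv with h | h | h
  · exact relU_standard hm h
  · exact relW_of_chainRels _ _ (chainRels_standard (by omega) hm hk2) h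
  · exact relU'_standard (by omega) hm h

end Standard


/-! ### The group of units and the normal form of the elements of the presented monoid -/

theorem perm_mem {m : ℕ} (hm : 2 ≤ m) {S : Subgroup (Equiv.Perm (Fin m))ᵐᵒᵖ}
    (hA : MulOpposite.op (permA hm) ∈ S) (hB : MulOpposite.op (permB m) ∈ S)
    (σ : (Equiv.Perm (Fin m))ᵐᵒᵖ) : σ ∈ S := by
  have : (⊤ : Subgroup (Equiv.Perm (Fin m))ᵐᵒᵖ) ≤ S := by
    rw [← closure_perm hm, Subgroup.closure_le]
    rintro x (rfl | rfl) <;> assumption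
  exact this trivial

theorem map_val {N N' : Type*} [Monoid N] [Monoid N'] (f : N →* N') (g : ℕ → N) (w : List ℕ) :
    f (val g w) = val (fun j => f (g j)) w := by
  rw [val, map_list_prod, List.map_map]
  rfl

/-- The elements which satisfy the relations `MixRels` form a subgroup. -/
def mixSubgroup {N : Type*} [Monoid N] {k m : ℕ} (g : ℕ → N) (Φ : UnitGroup k m →* Nˣ) :
    Subgroup (Equiv.Perm (Fin m))ᵐᵒᵖ where
  carrier := {σ | MixRels k g fun p => (Φ (Pi.mulSingle p σ) : N)}
  one_mem' := by
    refine ⟨fun j hj p hp => ?_, fun j hj q hq => ?_, fun j hj p q hpq => ?_⟩ <;> simp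
  mul_mem' := by
    intro σ τ hσ hτ
    refine ⟨fun j hj p hp => ?_, fun j hj q hq => ?_, fun j hj p q hpq => ?_⟩
    · rw [Pi.mulSingle_mul, map_mul, Units.val_mul, mul_assoc, hτ.left j hj p hp, hσ.left j hj p hp]
    · rw [Pi.mulSingle_mul, map_mul, Units.val_mul, ← mul_assoc, hσ.right j hj q hq,
        hτ.right j hj q hq]
    · rw [Pi.mulSingle_mul, Pi.mulSingle_mul, map_mul, map_mul, Units.val_mul, Units.val_mul,
        ← mul_assoc, hσ.swap j hj p q hpq, mul_assoc, hτ.swap j hj p q hpq, mul_assoc]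
  inv_mem' := by
    intro σ hσ
    refine ⟨fun j hj p hp => ?_, fun j hj q hq => ?_, fun j hj p q hpq => ?_⟩
    · rw [Pi.mulSingle_inv, map_inv, Units.inv_mul_eq_iff_eq_mul, hσ.left j hj p hp]
    · rw [Pi.mulSingle_inv, map_inv, Units.mul_inv_eq_iff_eq_mul, hσ.right j hj q hq]
    · rw [Pi.mulSingle_inv, Pi.mulSingle_inv, map_inv, map_inv, Units.mul_inv_eq_iff_eq_mul, mul_assoc,
        hσ.swap j hj p q hpq, Units.inv_mul_cancel_left]

section Presented

variable {N : Type*} [Monoid N] {k m : ℕ} (F : Word k →* N) (hk : 0 < k) (hm : 2 ≤ m)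
  (hF : ∀ u v, Rel k m u v → F u = F v)

include hm hF

theorem exists_hom_single (p : Fin k) : ∃ θ : (Equiv.Perm (Fin m))ᵐᵒᵖ →* Nˣ,
    (θ (MulOpposite.op (permA hm)) : N) =
      F (FreeMonoid.of (Letter.c p)) * F (FreeMonoid.of (Letter.b p)) ^ (m - 1) ∧
    (θ (MulOpposite.op (permB m)) : N) = F (FreeMonoid.of (Letter.b p)) := by
  have hU := uRels_of_relU F m (fun u v h => hF u v (Or.inl h)) p
  generalize F (FreeMonoid.of (Letter.b p)) = β at *
  generalize F (FreeMonoid.of (Letter.c p)) = γ at *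
  have hβ : IsUnit β := IsUnit.of_pow_eq_one hU.pow (by omega)
  have hγ : IsUnit γ := by
    obtain ⟨u, hu⟩ := IsUnit.of_pow_eq_one hU.mul_pow (by omega)
    have h1 : β ^ (m - 1) * β = 1 := by rw [← pow_succ, Nat.sub_add_cancel (by omega), hU.pow]
    have h2 : γ = β ^ (m - 1) * (β * γ * β ^ (m - 1)) * β := by
      rw [mul_assoc, mul_assoc, h1, mul_one, ← mul_assoc, h1, one_mul]
    rw [h2, ← hu]
    exact ((hβ.pow _).mul u.isUnit).mul hβ
  obtain ⟨β, rfl⟩ := hβ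
  obtain ⟨γ, rfl⟩ := hγ
  have hU' : URels m β γ := URels.of_map (f := Units.coeHom N) Units.val_injective hU
  obtain ⟨θ, hA, hB⟩ := ((uRels_iff_mooreRels hm).1 hU').exists_hom hm
  have h1 : β⁻¹ = β ^ (m - 1) := by
    rw [inv_eq_iff_mul_eq_one, ← pow_succ', Nat.sub_add_cancel (by omega), hU'.pow]
  exact ⟨θ, by rw [hA, h1, Units.val_mul, Units.val_pow_eq_pow_val], by rw [hB]⟩

theorem exists_unitGroup_hom : ∃ Φ : UnitGroup k m →* Nˣ, ∀ p,
    (Φ (Pi.mulSingle p (MulOpposite.op (permA hm))) : N) =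
      F (FreeMonoid.of (Letter.c p)) * F (FreeMonoid.of (Letter.b p)) ^ (m - 1) ∧
    (Φ (Pi.mulSingle p (MulOpposite.op (permB m))) : N) = F (FreeMonoid.of (Letter.b p)) := by
  choose θ hA hB using exists_hom_single F hm hF
  have hbb : ∀ p q, p < q →
      Commute (F (FreeMonoid.of (Letter.b p))) (F (FreeMonoid.of (Letter.b q))) := by
    intro p q hpq
    have := hF _ _ (Or.inl (RelU.u6_bb (p + 1) (q + 1) (by omega)))
    rwa [map_mul, map_mul] at this
  have hcc : ∀ p q, p < q →
      Commute (F (FreeMonoid.of (Letter.c p))) (F (FreeMonoid.of (Letter.c q))) := by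
    intro p q hpq
    have := hF _ _ (Or.inl (RelU.u6_cc (p + 1) (q + 1) (by omega)))
    rwa [map_mul, map_mul] at this
  have hbc : ∀ p q, p ≠ q →
      Commute (F (FreeMonoid.of (Letter.b p))) (F (FreeMonoid.of (Letter.c q))) := by
    intro p q hpq
    have := hF _ _ (Or.inl (RelU.u6_bc (p + 1) (q + 1) (by omega) (by omega) (by omega)))
    rwa [map_mul, map_mul] at this
  have hbb' : ∀ p q, p ≠ q →
      Commute (F (FreeMonoid.of (Letter.b p))) (F (FreeMonoid.of (Letter.b q))) := fun p q hpq =>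
    (lt_or_gt_of_ne hpq).elim (hbb p q) fun h => (hbb q p h).symm
  have hcc' : ∀ p q, p ≠ q →
      Commute (F (FreeMonoid.of (Letter.c p))) (F (FreeMonoid.of (Letter.c q))) := fun p q hpq =>
    (lt_or_gt_of_ne hpq).elim (hcc p q) fun h => (hcc q p h).symm
  have hcomm : Pairwise fun p q => ∀ σ τ, Commute (θ p σ) (θ q τ) := by
    intro p q hpq
    have h1 : ∀ y : Nˣ, Commute (θ p (MulOpposite.op (permA hm))) y →
        Commute (θ p (MulOpposite.op (permB m))) y → ∀ σ, Commute (θ p σ) y := by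
      intro y hA' hB' σ
      have := perm_mem hm (S := (Subgroup.centralizer {y}).comap (θ p))
        (by rw [Subgroup.mem_comap, Subgroup.mem_centralizer_singleton_iff]; exact hA')
        (by rw [Subgroup.mem_comap, Subgroup.mem_centralizer_singleton_iff]; exact hB') σ
      rwa [Subgroup.mem_comap, Subgroup.mem_centralizer_singleton_iff] at this
    have h2 : ∀ y : Nˣ, Commute y (θ q (MulOpposite.op (permA hm))) →
        Commute y (θ q (MulOpposite.op (permB m))) → ∀ σ, Commute y (θ q σ) := by
      intro y hA' hB' σ
      have := perm_mem hm (S := (Subgroup.centralizer {y}).comap (θ q))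
        (by rw [Subgroup.mem_comap, Subgroup.mem_centralizer_singleton_iff]; exact hA'.symm)
        (by rw [Subgroup.mem_comap, Subgroup.mem_centralizer_singleton_iff]; exact hB'.symm) σ
      rw [Subgroup.mem_comap, Subgroup.mem_centralizer_singleton_iff] at this
      exact Commute.symm this
    have cbb := hbb' p q hpq
    have ccc := hcc' p q hpq
    have cbc := hbc p q hpq
    have ccb := (hbc q p hpq.symm).symm
    intro σ τ
    refine h1 _ (h2 _ (Commute.units_of_val ?_) (Commute.units_of_val ?_) τ)
      (h2 _ (Commute.units_of_val ?_) (Commute.units_of_val ?_) τ) σ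
    · rw [hA, hA]
      exact (ccc.mul_right (ccb.pow_right _)).mul_left ((cbc.mul_right (cbb.pow_right _)).pow_left _)
    · rw [hA, hB]
      exact ccb.mul_left (cbb.pow_left _)
    · rw [hB, hA]
      exact cbc.mul_right (cbb.pow_right _)
    · rw [hB, hB]
      exact cbb
  refine ⟨MonoidHom.noncommPiCoprod θ hcomm, fun p => ?_⟩
  rw [MonoidHom.noncommPiCoprod_mulSingle, MonoidHom.noncommPiCoprod_mulSingle]
  exact ⟨hA p, hB p⟩

section Hom

variable {Φ : UnitGroup k m →* Nˣ} (hA : ∀ p, (Φ (Pi.mulSingle p (MulOpposite.op (permA hm))) : N) =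
      F (FreeMonoid.of (Letter.c p)) * F (FreeMonoid.of (Letter.b p)) ^ (m - 1))
    (hB : ∀ p, (Φ (Pi.mulSingle p (MulOpposite.op (permB m))) : N) = F (FreeMonoid.of (Letter.b p)))

include hA hB

theorem mixRels_all (σ : (Equiv.Perm (Fin m))ᵐᵒᵖ) :
    MixRels k (chainGen F hk) fun p => (Φ (Pi.mulSingle p σ) : N) := by
  have hF' : ∀ u v, RelU' k m u v → F u = F v := fun u v h => hF u v (Or.inr (Or.inr h))
  refine perm_mem hm (S := mixSubgroup (chainGen F hk) Φ) ?_ ?_ σ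
  · change MixRels k _ _
    rw [funext hA]
    exact mixRels_of_relU'_c F hk m hF'
  · change MixRels k _ _
    rw [funext hB]
    exact mixRels_of_relU'_b F hk m hF'

/-- Units can be moved from the right of a letter `x_i` to its left. -/
theorem gen_mul_unit {j : ℕ} (hj : j < k) (z : UnitGroup k m) :
    ∃ z', chainGen F hk j * Φ z = Φ z' * chainGen F hk j := by
  let S : Subgroup (UnitGroup k m) :=
    { carrier := {z | ∃ z', chainGen F hk j * Φ z = Φ z' * chainGen F hk j}
      one_mem' := ⟨1, by simp⟩
      mul_mem' := by
        rintro y z ⟨y', hy⟩ ⟨z', hz⟩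
        exact ⟨y' * z', by
          rw [map_mul, map_mul, Units.val_mul, Units.val_mul, ← mul_assoc, hy, mul_assoc, hz,
            mul_assoc]⟩
      inv_mem' := by
        rintro z ⟨z', hz⟩
        exact ⟨z'⁻¹, by
          rw [map_inv, map_inv, Units.mul_inv_eq_iff_eq_mul, mul_assoc, hz,
            Units.inv_mul_cancel_left]⟩ }
  refine Submonoid.pi_mem_of_mulSingle_mem (H := S) z fun q => ?_
  have hmix := mixRels_all F hk hm hF hA hB (z q)
  by_cases hq : ∃ p : Fin k, chainStep j (p + 1) = q + 1
  · obtain ⟨p, hp⟩ := hq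
    exact ⟨_, hmix.swap j hj p q hp⟩
  · push Not at hq
    exact ⟨1, by rw [hmix.right j hj q hq]; simp⟩

/-- Every element is the product of a unit and of a word in the letters `x_i`. -/
theorem exists_normal_form (u : Word k) : ∃ (z : UnitGroup k m) (w : List ℕ),
    (∀ j ∈ w, j < k) ∧ F u = Φ z * val (chainGen F hk) w := by
  induction u using FreeMonoid.inductionOn' with
  | one => exact ⟨1, [], by simp, by simp⟩
  | of_mul l u ih =>
    obtain ⟨z, w, hw, hu⟩ := ih
    rw [map_mul, hu]
    cases l with
    | b p => exact ⟨Pi.mulSingle p _ * z, w, hw, by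
        rw [← hB, map_mul, Units.val_mul, mul_assoc]⟩
    | c p =>
      refine ⟨Pi.mulSingle p (MulOpposite.op (permA hm) * MulOpposite.op (permB m)) * z, w, hw, ?_⟩
      have hU := uRels_of_relU F m (fun u v h => hF u v (Or.inl h)) p
      rw [Pi.mulSingle_mul, map_mul, map_mul, Units.val_mul, Units.val_mul, hA, hB, mul_assoc (F _),
        ← pow_succ, Nat.sub_add_cancel (by omega), hU.pow, mul_one, mul_assoc]
    | x i =>
      obtain ⟨j, hj, hij⟩ : ∃ j < k, F (FreeMonoid.of (Letter.x i)) = chainGen F hk j := by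
        rcases Nat.eq_zero_or_pos (i : ℕ) with h0 | h0
        · refine ⟨0, hk, ?_⟩
          rw [← map_x_zero, show i = ⟨0, hk⟩ from Fin.ext h0]
          rfl
        · exact ⟨k - i, by omega, map_x F hk h0 i.isLt⟩
      obtain ⟨z', hz'⟩ := gen_mul_unit F hk hm hF hA hB hj z
      refine ⟨z', j :: w, fun l hl => ?_, ?_⟩
      · rcases List.mem_cons.1 hl with rfl | hl
        · exact hj
        · exact hw l hl
      · rw [hij, ← mul_assoc, hz', val_cons, mul_assoc]

theorem single_mul_val (σ : (Equiv.Perm (Fin m))ᵐᵒᵖ) {w : List ℕ} (hw : ∀ j ∈ w, j < k) (p : Fin k)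
    (hp : chainAct w (p + 1) = 0) :
    Φ (Pi.mulSingle p σ) * val (chainGen F hk) w = val (chainGen F hk) w := by
  have hmix := mixRels_all F hk hm hF hA hB σ
  induction w generalizing p with
  | nil => simp at hp
  | cons j w ih =>
    have hj : j < k := hw j (by simp)
    rw [val_cons, ← mul_assoc]
    by_cases h0 : chainStep j (p + 1) = 0
    · rw [hmix.left j hj p h0]
    · have hle : chainStep j (p + 1) ≤ k := chainStep_le hj (by omega)
      have hq : chainStep j (p + 1) = ((⟨chainStep j (p + 1) - 1, by omega⟩ : Fin k) : ℕ) + 1 := by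
        simp only; omega
      rw [← hmix.swap j hj p _ hq, mul_assoc, ih (fun i hi => hw i (List.mem_cons_of_mem _ hi)) _ _]
      rw [← hq]
      exact hp

/-- A word in the letters `x_i` absorbs the units which act trivially on its domain. -/
theorem unit_mul_val {w : List ℕ} (hw : ∀ j ∈ w, j < k) (z : UnitGroup k m)
    (hz : ∀ p : Fin k, chainAct w (p + 1) ≠ 0 → z p = 1) :
    Φ z * val (chainGen F hk) w = val (chainGen F hk) w := by
  let S : Submonoid (UnitGroup k m) :=
    { carrier := {z | Φ z * val (chainGen F hk) w = val (chainGen F hk) w}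
      one_mem' := by simp
      mul_mem' := by
        intro y z hy hz
        change _ = _ at hy hz
        change _ = _
        rw [map_mul, Units.val_mul, mul_assoc, hz, hy] }
  refine Submonoid.pi_mem_of_mulSingle_mem (H := S) z fun p => ?_
  by_cases hp : chainAct w (p + 1) = 0
  · exact single_mul_val F hk hm hF hA hB (z p) hw p hp
  · rw [hz p hp, Pi.mulSingle_one]
    exact one_mem S

variable {π : N →* SymInv (Fin (k * m))} (hπ : ∀ u, π (F u) = FreeMonoid.lift (letterBar hm) u)

include hπ

omit hF in
theorem map_unit (z : UnitGroup k m) : π (Φ z) = unitHom k m z := by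
  let S := MonoidHom.eqLocus ((π.comp (Units.coeHom N)).comp Φ) (unitHom k m)
  change z ∈ S
  refine Submonoid.pi_mem_of_mulSingle_mem (H := S) z fun p => ?_
  refine perm_mem hm (S := S.comap (MonoidHom.mulSingle (fun _ => (Equiv.Perm (Fin m))ᵐᵒᵖ) p))
    ?_ ?_ (z p)
  · change π (Φ (Pi.mulSingle p _)) = unitHom k m (Pi.mulSingle p _)
    rw [hA, map_mul, map_pow, hπ, hπ, FreeMonoid.lift_eval_of, FreeMonoid.lift_eval_of]
    change cBar k hm p * bBar k m p ^ (m - 1) = _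
    rw [bBar_eq, cBar_eq, ← map_pow, ← map_mul, ← Pi.mulSingle_pow, ← Pi.mulSingle_mul, mul_assoc,
      ← pow_succ', Nat.sub_add_cancel (by omega), (mooreRels_perm hm).pow, mul_one]
  · change π (Φ (Pi.mulSingle p _)) = unitHom k m (Pi.mulSingle p _)
    rw [hB, hπ, FreeMonoid.lift_eval_of]
    exact bBar_eq p

omit hF in
theorem acts_normal_form (z : UnitGroup k m) {w : List ℕ} (hw : ∀ j ∈ w, j < k) :
    Acts (π (Φ z * val (chainGen F hk) w)) (chainAct w) fun i => (z i).unop := by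
  have hg : (fun j => π (chainGen F hk j)) = chainGen (FreeMonoid.lift (letterBar hm)) hk :=
    funext fun j => hπ _
  rw [map_mul, map_unit F hm hA hB hπ, map_val, hg]
  exact (acts_val hk hm hw).unitBar_mul _

end Hom

/-- The presented monoid embeds into the symmetric inverse monoid. -/
theorem injective_of_rel (hk2 : 2 ≤ k) (hsurj : Function.Surjective F) {π : N →* SymInv (Fin (k * m))}
    (hπ : ∀ u, π (F u) = FreeMonoid.lift (letterBar hm) u) : Function.Injective π := by
  have hk : 0 < k := by omega
  obtain ⟨Φ, hΦ⟩ := exists_unitGroup_hom F hm hF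
  have hA := fun p => (hΦ p).1
  have hB := fun p => (hΦ p).2
  intro a a' haa
  obtain ⟨u, rfl⟩ := hsurj a
  obtain ⟨u', rfl⟩ := hsurj a'
  obtain ⟨z, w, hw, hu⟩ := exists_normal_form F hk hm hF hA hB u
  obtain ⟨z', w', hw', hu'⟩ := exists_normal_form F hk hm hF hA hB u'
  rw [hu, hu'] at haa ⊢
  have h1 := acts_normal_form F hk hm hA hB hπ z hw
  have h2 := acts_normal_form F hk hm hA hB hπ z' hw'
  rw [← haa] at h2
  have key : ∀ p : Fin k, chainAct w (p + 1) ≠ 0 →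
      chainAct w (p + 1) = chainAct w' (p + 1) ∧ (z p).unop = (z' p).unop := fun p hp =>
    h1.map_eq (by omega) h2 (chainAct_le hw (by omega)) hp
  have key' : ∀ p : Fin k, chainAct w' (p + 1) ≠ 0 →
      chainAct w' (p + 1) = chainAct w (p + 1) ∧ (z' p).unop = (z p).unop := fun p hp =>
    h2.map_eq (by omega) h1 (chainAct_le hw' (by omega)) hp
  have hact : ∀ p, 1 ≤ p → p ≤ k → chainAct w p = chainAct w' p := by
    intro p hp1 hpk
    have e := key ⟨p - 1, by omega⟩
    have e' := key' ⟨p - 1, by omega⟩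
    simp only [Nat.sub_add_cancel hp1] at e e'
    by_cases h0 : chainAct w p = 0
    · by_contra hne
      exact hne (e' (fun h => hne (h0.trans h.symm))).1.symm
    · exact (e h0).1
  have hval := (chainRels_of_relW F hk hk2 fun u v h => hF u v (Or.inr (Or.inl h))).val_eq_of_act_eq
    hk hw hw' hact
  rw [← hval]
  have habs := unit_mul_val F hk hm hF hA hB hw (z'⁻¹ * z) fun p hp => by
    rw [Pi.mul_apply, Pi.inv_apply, MulOpposite.unop_injective (key p hp).2, inv_mul_cancel]
  rw [map_mul, map_inv, Units.val_mul, mul_assoc, Units.inv_mul_eq_iff_eq_mul] at habs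
  exact habs

end Presented

/-! ### Stable partial permutations -/

section Stable

variable {k m : ℕ}

theorem mem_POI_of_acts {α : SymInv (Fin (k * m))} {f : ℕ → ℕ} {z : Fin k → Equiv.Perm (Fin m)}
    (h : Acts α f z)
    (hmono : ∀ p q, p ≤ q → f p ≠ 0 → f q ≠ 0 → f p ≤ f q) : α ∈ POI k m := by
  refine ⟨fun p q hpq => ?_, fun p q p' q' hp hq hle => ?_⟩
  · obtain ⟨i, s, rfl⟩ := exists_pt p
    obtain ⟨j, t, rfl⟩ := exists_pt q
    rw [h] at hpq
    simp only [divNat_pt]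
    refine ⟨fun r hr => ?_, Set.ext fun r => ⟨?_, fun hr => ?_⟩⟩
    · obtain ⟨i', s', rfl⟩ := exists_pt r
      obtain rfl : i' = i := by simpa using hr
      exact ⟨_, (h i' s' j (z i' s')).2 ⟨hpq.1, rfl⟩⟩
    · rintro ⟨r', hr', hrr⟩
      obtain ⟨i', s', rfl⟩ := exists_pt r
      obtain ⟨j', t', rfl⟩ := exists_pt r'
      obtain rfl : j' = i := by simpa using hr'
      rw [h] at hrr
      simp only [Set.mem_ofPred_eq, divNat_pt]
      exact Fin.ext (by have := hrr.1.symm.trans hpq.1; omega)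
    · obtain ⟨j', t', rfl⟩ := exists_pt r
      obtain rfl : j' = j := by simpa using hr
      exact ⟨pt i ((z i).symm t'), by simp, (h _ _ _ _).2 ⟨hpq.1, by simp⟩⟩
  · obtain ⟨i, s, rfl⟩ := exists_pt p
    obtain ⟨j, t, rfl⟩ := exists_pt q
    obtain ⟨i', s', rfl⟩ := exists_pt p'
    obtain ⟨j', t', rfl⟩ := exists_pt q'
    rw [h] at hp hq
    simp only [divNat_pt, Fin.le_def] at hle ⊢
    have := hmono (i + 1) (j + 1) (by omega) (by omega) (by omega)
    omega

/-- A stable partial permutation acts on the intervals and on the positions. -/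
theorem exists_acts (hm : 0 < m) {α : SymInv (Fin (k * m))} (hα : α ∈ POI k m) :
    ∃ (f : ℕ → ℕ) (z : Fin k → Equiv.Perm (Fin m)), Acts α f z ∧ (∀ p, 1 ≤ p → p ≤ k → f p ≤ k) ∧
      ∀ p q, 1 ≤ p → q ≤ k → p < q → f p ≠ 0 → f q ≠ 0 → f p < f q := by
  classical
  obtain ⟨hst, hmono⟩ := hα
  -- The block of a point with an image is mapped onto the block of the image.
  have key : ∀ i : Fin k, ∃ (v : ℕ) (σ : Equiv.Perm (Fin m)), v ≤ k ∧
      ∀ s j t, α.Maps (pt i s) (pt j t) ↔ v = j + 1 ∧ t = σ s := by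
    intro i
    by_cases hi : ∃ (s : Fin m) (q : Fin (k * m)), α.Maps (pt i s) q
    · obtain ⟨s₀, q, hq⟩ := hi
      obtain ⟨j, t₀, rfl⟩ := exists_pt q
      obtain ⟨hdom, himg⟩ := hst _ _ hq
      simp only [divNat_pt] at hdom himg
      have hex : ∀ s, ∃ t, α.Maps (pt i s) (pt j t) := by
        intro s
        obtain ⟨r, hr⟩ := hdom (show pt i s ∈ _ by simp)
        have hr' : r ∈ α.image {y | y.divNat = i} := ⟨pt i s, by simp, hr⟩
        rw [himg] at hr'
        obtain ⟨j', t, rfl⟩ := exists_pt r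
        obtain rfl : j' = j := by simpa using hr'
        exact ⟨t, hr⟩
      choose σ hσ using hex
      have hinj : Function.Injective σ := fun s s' hs => by
        have := (hσ s).left_unique (hs ▸ hσ s')
        exact (pt_inj.1 this).2
      refine ⟨j + 1, Equiv.ofBijective σ (Finite.injective_iff_bijective.1 hinj), by omega,
        fun s j' t => ⟨fun h => ?_, ?_⟩⟩
      · obtain ⟨rfl, rfl⟩ := pt_inj.1 (h.right_unique (hσ s))
        exact ⟨rfl, rfl⟩
      · rintro ⟨hj, rfl⟩
        obtain rfl : j = j' := Fin.ext (by omega)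
        exact hσ s
    · refine ⟨0, 1, Nat.zero_le _, fun s j t => ⟨fun h => absurd ⟨s, _, h⟩ hi, fun h => ?_⟩⟩
      exact absurd h.1 (by omega)
  choose v σ hv hvσ using key
  refine ⟨fun p => if h : p - 1 < k then v ⟨p - 1, h⟩ else 0, σ, fun i s j t => ?_,
    fun p hp1 hpk => ?_, fun p q hp1 hqk hpq hp hq => ?_⟩
  · rw [hvσ]
    simp
  · simp only [dif_pos (show p - 1 < k by omega)]
    exact hv _
  · simp only [dif_pos (show p - 1 < k by omega)] at hp ⊢
    simp only [dif_pos (show q - 1 < k by omega)] at hq ⊢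
    set i : Fin k := ⟨p - 1, by omega⟩ with hi
    set j : Fin k := ⟨q - 1, by omega⟩ with hj
    have hij : i < j := by rw [Fin.lt_def]; simp only [hi, hj]; omega
    have hvi := hv i
    have hvj := hv j
    have h1 : ∀ t, α.Maps (pt i ((σ i).symm t)) (pt ⟨v i - 1, by omega⟩ t) := fun t =>
      (hvσ _ _ _ _).2 ⟨by simp only; omega, by simp⟩
    have h2 : ∀ t, α.Maps (pt j ((σ j).symm t)) (pt ⟨v j - 1, by omega⟩ t) := fun t =>
      (hvσ _ _ _ _).2 ⟨by simp only; omega, by simp⟩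
    have hle := hmono _ _ _ _ (h1 ⟨0, hm⟩) (h2 ⟨0, hm⟩) (by simpa using hij.le)
    simp only [divNat_pt, Fin.mk_le_mk] at hle
    have hne : v i ≠ v j := by
      intro e
      have h3 := h2 ⟨0, hm⟩
      simp only [← e] at h3
      exact hij.ne (pt_inj.1 ((h1 ⟨0, hm⟩).left_unique h3)).1
    omega

end Stable

/-- The isomorphism of the presented monoid onto `POI_{k×m}`. -/
theorem exists_mulEquiv {k m : ℕ} (hk : 2 ≤ k) (hm : 2 ≤ m) :
    ∃ e : PresentedMonoid (Rel k m) ≃* POI k m, ∀ l : Letter k,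
      (e (PresentedMonoid.of (Rel k m) l) : SymInv (Fin (k * m))) = letterBar hm l := by
  have hk0 : 0 < k := by omega
  let F : Word k →* PresentedMonoid (Rel k m) := PresentedMonoid.mk (Rel k m)
  have hF : ∀ u v, Rel k m u v → F u = F v := fun u v h => PresentedMonoid.mk_eq_mk_of_rel h
  have hsurj : Function.Surjective F := PresentedMonoid.surjective_mk
  let π : PresentedMonoid (Rel k m) →* SymInv (Fin (k * m)) :=
    PresentedMonoid.lift (letterBar hm) (rel_standard hm hk)
  have hπ : ∀ u, π (F u) = FreeMonoid.lift (letterBar hm) u := fun u => rfl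
  have hinj : Function.Injective π := injective_of_rel F hm hF hk hsurj hπ
  obtain ⟨Φ, hΦ⟩ := exists_unitGroup_hom F hm hF
  have hA := fun p => (hΦ p).1
  have hB := fun p => (hΦ p).2
  have hmem : ∀ a, π a ∈ POI k m := by
    intro a
    obtain ⟨u, rfl⟩ := hsurj a
    obtain ⟨z, w, hw, hu⟩ := exists_normal_form F hk0 hm hF hA hB u
    rw [hu]
    refine mem_POI_of_acts (acts_normal_form F hk0 hm hA hB hπ z hw) fun p q hpq hp hq => ?_
    rcases eq_or_lt_of_le hpq with rfl | hlt
    · exact le_rfl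
    · exact (chainAct_lt hlt hq).le
  have honto : Function.Surjective (π.codRestrict (POI k m) hmem) := by
    rintro ⟨α, hα⟩
    obtain ⟨f, z, hfz, hle, hmono⟩ := exists_acts (by omega) hα
    obtain ⟨w, hw, hwf⟩ := exists_word hk hle hmono
    refine ⟨Φ (fun i => MulOpposite.op (z i)) * val (chainGen F hk0) w, Subtype.ext ?_⟩
    exact (acts_normal_form F hk0 hm hA hB hπ _ hw).ext hfz
      (fun i => hwf _ (by omega) (by omega)) fun _ _ => rfl
  refine ⟨MulEquiv.ofBijective (π.codRestrict (POI k m) hmem)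
    ⟨fun a a' h => hinj (congrArg Subtype.val h), honto⟩, fun l => ?_⟩
  rfl


/-! ### Additive weights of words -/

section Weight

variable {k : ℕ}

/-- The sum of the values of `f` at the letters of a word. -/
def wt (f : Letter k → ℕ) (w : Word k) : ℕ := ((FreeMonoid.toList w).map f).sum

theorem wt_one (f : Letter k → ℕ) : wt f 1 = 0 := rfl

theorem wt_mul (f : Letter k → ℕ) (u v : Word k) : wt f (u * v) = wt f u + wt f v := by
  simp [wt]

theorem wt_pow (f : Letter k → ℕ) (u : Word k) (n : ℕ) : wt f (u ^ n) = n * wt f u := by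
  induction n with
  | zero => simp [wt_one]
  | succ n ih => rw [pow_succ, wt_mul, ih, Nat.succ_mul]

/-- The one-based index of the letter if it is some `b_i`, and `0` otherwise. -/
def idxB : Letter k → ℕ
  | Letter.b i => i + 1
  | _ => 0

/-- The one-based index of the letter if it is some `c_i`, and `0` otherwise. -/
def idxC : Letter k → ℕ
  | Letter.c i => i + 1
  | _ => 0

/-- The index of the letter if it is some `x_i`, and `0` otherwise. -/
def idxX : Letter k → ℕ
  | Letter.x i => i
  | _ => 0

/-- `1` if the letter is some `b_i`, and `0` otherwise. -/
def isB : Letter k → ℕ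
  | Letter.b _ => 1
  | _ => 0

/-- `1` if the letter is some `c_i`, and `0` otherwise. -/
def isC : Letter k → ℕ
  | Letter.c _ => 1
  | _ => 0

/-- `1` if the letter is some `x_i`, and `0` otherwise. -/
def isX : Letter k → ℕ
  | Letter.x _ => 1
  | _ => 0

theorem wt_b (f : Letter k → ℕ) (i : ℕ) (h : 1 ≤ i ∧ i ≤ k) :
    wt f (b i h) = f (Letter.b ⟨i - 1, by omega⟩) := by simp [wt, b]

theorem wt_c (f : Letter k → ℕ) (i : ℕ) (h : 1 ≤ i ∧ i ≤ k) :
    wt f (c i h) = f (Letter.c ⟨i - 1, by omega⟩) := by simp [wt, c]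

theorem wt_x (f : Letter k → ℕ) (i : ℕ) (h : i < k) : wt f (x i h) = f (Letter.x ⟨i, h⟩) := by
  simp [wt, x]

theorem wt_isX_xs (s t : ℕ) (hst : s ≤ t) (ht : t ≤ k) : wt isX (xs k s t) = t - s := by
  have key : ∀ l : List ℕ, (∀ n ∈ l, n < k) →
      wt isX ((l.map fun n => if h : n < k then (x n h : Word k) else 1).prod) = l.length := by
    intro l hl
    induction l with
    | nil => rfl
    | cons n l ih =>
      rw [List.map_cons, List.prod_cons, wt_mul, ih fun i hi => hl i (List.mem_cons_of_mem _ hi),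
        dif_pos (hl n (by simp)), wt_x, List.length_cons, isX, add_comm]
  rw [xs_eq k s t hst ht, key, List.length_range']
  intro n hn
  rw [List.mem_range'_1] at hn
  omega

/-- The pairs `i < j` of elements of `{0, …, n - 1}`. -/
abbrev Below (n : ℕ) : Type := (j : Fin n) × Fin (j : ℕ)

theorem card_below (n : ℕ) : Fintype.card (Below n) * 2 = n * (n - 1) := by
  rw [Fintype.card_sigma]
  simp only [Fintype.card_fin]
  rw [Fin.sum_univ_eq_sum_range (fun i => i), Finset.sum_range_id_mul_two]

theorem below_ext {n : ℕ} {p q : Below n} (h1 : (p.1 : ℕ) = q.1) (h2 : (p.2 : ℕ) = q.2) : p = q := by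
  obtain ⟨j, i⟩ := p
  obtain ⟨j', i'⟩ := q
  obtain rfl : j = j' := Fin.ext h1
  obtain rfl : i = i' := Fin.ext h2
  rfl

end Weight

/-! ### The number of the relations between units and the letters `x_i` -/

section CountMix

variable {k : ℕ}

/-- The indices of the relations `U'` for one of the two families `c_i b_i^{m-1}` and `b_i`, sorted by
the form of the relation. -/
abbrev MixIndex (k : ℕ) : Type :=
  Unit ⊕ Fin (k - 1) ⊕ Fin k ⊕ Fin (k - 1) ⊕ Fin (k - 1) ⊕ Fin (k - 1) × Fin (k - 2)

/-- The `t`-th element of `{1, …, k}` other than `k - i` and `k - i + 1`. -/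
def skipTwo (k i t : ℕ) : ℕ := if t + 1 < k - i then t + 1 else t + 3

theorem skipTwo_spec {i t : ℕ} (hi : 1 ≤ i ∧ i + 1 ≤ k) (ht : t < k - 2) :
    (1 ≤ skipTwo k i t ∧ skipTwo k i t ≤ k) ∧
      (skipTwo k i t ≠ k - i ∧ skipTwo k i t ≠ k - i + 1) := by
  unfold skipTwo
  split_ifs <;> omega

/-- The relations `U'` for the family of words `z`, which is either `c_i b_i^{m-1}` or `b_i`. -/
def mixPair (hk : 2 ≤ k) (z : (i : ℕ) → 1 ≤ i ∧ i ≤ k → Word k) : MixIndex k → Word k × Word k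
  | .inl _ => (z 1 (by omega) * x 0, x 0)
  | .inr (.inl i) => (x 0 * z (i + 1) (by omega), z (i + 2) (by omega) * x 0)
  | .inr (.inr (.inl i)) => (x i * z (k - i) (by omega), x i)
  | .inr (.inr (.inr (.inl i))) =>
    (z (i + 2) (by omega) * x (k - (i + 2) + 1), x (k - (i + 2) + 1))
  | .inr (.inr (.inr (.inr (.inl i)))) =>
    (x (i + 1) * z (k - (i + 1) + 1) (by omega), z (k - (i + 1)) (by omega) * x (i + 1))
  | .inr (.inr (.inr (.inr (.inr (i, t))))) =>
    have h : 1 ≤ skipTwo k (i + 1) t ∧ skipTwo k (i + 1) t ≤ k :=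
      (skipTwo_spec (by omega) t.2).1
    (x (i + 1) * z (skipTwo k (i + 1) t) h, z (skipTwo k (i + 1) t) h * x (i + 1))

/-- The relations are told apart by the sums of the indices of the letters `x_i` on the left and of
the words `z i` on either side. -/
theorem mixPair_injective (hk : 2 ≤ k) (z : (i : ℕ) → 1 ≤ i ∧ i ≤ k → Word k) (f : Letter k → ℕ)
    (hf : ∀ i, f (Letter.x i) = 0) (hz : ∀ i h, wt f (z i h) = i)
    (hz' : ∀ i h, wt idxX (z i h) = 0) : Function.Injective (mixPair hk z) := by
  intro p q h
  have h1 : wt f (mixPair hk z p).1 = wt f (mixPair hk z q).1 := by rw [h]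
  have h2 : wt f (mixPair hk z p).2 = wt f (mixPair hk z q).2 := by rw [h]
  have h3 : wt idxX (mixPair hk z p).1 = wt idxX (mixPair hk z q).1 := by rw [h]
  clear h
  rcases p with _ | i | i | i | i | ⟨i, t⟩ <;> rcases q with _ | i' | i' | i' | i' | ⟨i', t'⟩ <;>
    simp only [mixPair, wt_mul, wt_x, hf, hz, hz', idxX, add_zero, zero_add, skipTwo] at h1 h2 h3 <;>
    first
    | rfl
    | (exfalso; omega)
    | (obtain rfl : i = i' := Fin.ext (by omega); rfl)
    | skip
  obtain rfl : i = i' := Fin.ext (by omega)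
  obtain rfl : t = t' := Fin.ext (by split_ifs at h1 <;> omega)
  rfl

theorem card_mixIndex (hk : 2 ≤ k) : Fintype.card (MixIndex k) = k ^ 2 + k := by
  obtain ⟨n, rfl⟩ : ∃ n, k = n + 2 := ⟨k - 2, by omega⟩
  simp only [Fintype.card_sum, Fintype.card_prod, Fintype.card_fin, Fintype.card_unit,
    Nat.add_sub_cancel, show n + 2 - 1 = n + 1 from rfl]
  ring

theorem setOf_relU' (hk : 2 ≤ k) (m : ℕ) : {p : Word k × Word k | RelU' k m p.1 p.2} =
    Set.range (mixPair hk fun i h => c i h * b i h ^ (m - 1)) ∪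
      Set.range (mixPair hk fun i h => b i h) := by
  have skip : ∀ i j, 1 ≤ i ∧ i + 1 ≤ k → 1 ≤ j ∧ j ≤ k → j ≠ k - i ∧ j ≠ k - i + 1 →
      ∃ t : Fin (k - 2), skipTwo k (i - 1 + 1) t = j := by
    intro i j hi hj hij
    by_cases h : j < k - i
    · exact ⟨⟨j - 1, by omega⟩, by simp only [skipTwo]; split_ifs <;> omega⟩
    · exact ⟨⟨j - 3, by omega⟩, by simp only [skipTwo]; split_ifs <;> omega⟩
  have hl : ∀ (p : MixIndex k) (u v : Word k),
      mixPair hk (fun i h => c i h * b i h ^ (m - 1)) p = (u, v) →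
        (u, v) ∈ Set.range (mixPair hk fun i h => c i h * b i h ^ (m - 1)) ∪
          Set.range (mixPair hk fun i h => b i h) := fun p u v h => .inl ⟨p, h⟩
  ext ⟨u, v⟩
  constructor
  · intro h
    replace h : RelU' k m u v := h
    induction h with
    | u1_c => exact hl (.inl ()) _ _ rfl
    | u1_b => exact .inr ⟨.inl (), rfl⟩
    | u2_c i h =>
      obtain ⟨i, rfl⟩ : ∃ n, i = n + 1 := ⟨i - 1, by omega⟩
      exact hl (.inr (.inl ⟨i, by omega⟩)) _ _ (by simp only [mixPair, mul_assoc])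
    | u2_b i h =>
      obtain ⟨i, rfl⟩ : ∃ n, i = n + 1 := ⟨i - 1, by omega⟩
      exact .inr ⟨.inr (.inl ⟨i, by omega⟩), rfl⟩
    | u3_c i h => exact hl (.inr (.inr (.inl ⟨i, h⟩))) _ _ (by simp only [mixPair, mul_assoc])
    | u3_b i h => exact .inr ⟨.inr (.inr (.inl ⟨i, h⟩)), rfl⟩
    | u4_c i h =>
      obtain ⟨i, rfl⟩ : ∃ n, i = n + 2 := ⟨i - 2, by omega⟩
      exact hl (.inr (.inr (.inr (.inl ⟨i, by omega⟩)))) _ _ rfl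
    | u4_b i h =>
      obtain ⟨i, rfl⟩ : ∃ n, i = n + 2 := ⟨i - 2, by omega⟩
      exact .inr ⟨.inr (.inr (.inr (.inl ⟨i, by omega⟩))), rfl⟩
    | u5_c i h =>
      obtain ⟨i, rfl⟩ : ∃ n, i = n + 1 := ⟨i - 1, by omega⟩
      exact hl (.inr (.inr (.inr (.inr (.inl ⟨i, by omega⟩))))) _ _ (by
        simp only [mixPair, mul_assoc])
    | u5_b i h =>
      obtain ⟨i, rfl⟩ : ∃ n, i = n + 1 := ⟨i - 1, by omega⟩
      exact .inr ⟨.inr (.inr (.inr (.inr (.inl ⟨i, by omega⟩)))), rfl⟩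
    | u6_c i j hi hj hij =>
      obtain ⟨t, rfl⟩ := skip i j hi hj hij
      obtain ⟨i, rfl⟩ : ∃ n, i = n + 1 := ⟨i - 1, by omega⟩
      exact hl (.inr (.inr (.inr (.inr (.inr (⟨i, by omega⟩, t)))))) _ _ (by
        simp only [mixPair, mul_assoc, Nat.add_sub_cancel])
    | u6_b i j hi hj hij =>
      obtain ⟨t, rfl⟩ := skip i j hi hj hij
      obtain ⟨i, rfl⟩ : ∃ n, i = n + 1 := ⟨i - 1, by omega⟩
      exact .inr ⟨.inr (.inr (.inr (.inr (.inr (⟨i, by omega⟩, t))))), rfl⟩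
  · change _ → RelU' k m u v
    rintro (⟨p, h⟩ | ⟨p, h⟩) <;> rcases p with _ | i | i | i | i | ⟨i, t⟩ <;>
      obtain ⟨rfl, rfl⟩ := Prod.ext_iff.1 h <;> simp only [mixPair, ← mul_assoc]
    · exact .u1_c (by omega)
    · exact .u2_c _ (by omega)
    · exact .u3_c _ (by omega)
    · exact .u4_c _ (by omega)
    · exact .u5_c _ (by omega)
    · have hi : 1 ≤ (i : ℕ) + 1 ∧ (i : ℕ) + 1 + 1 ≤ k := by omega
      exact .u6_c _ _ hi (skipTwo_spec hi t.2).1 (skipTwo_spec hi t.2).2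
    · exact .u1_b (by omega)
    · exact .u2_b _ (by omega)
    · exact .u3_b _ (by omega)
    · exact .u4_b _ (by omega)
    · exact .u5_b _ (by omega)
    · have hi : 1 ≤ (i : ℕ) + 1 ∧ (i : ℕ) + 1 + 1 ≤ k := by omega
      exact .u6_b _ _ hi (skipTwo_spec hi t.2).1 (skipTwo_spec hi t.2).2

theorem ncard_relU' (hk : 2 ≤ k) (m : ℕ) :
    {p : Word k × Word k | RelU' k m p.1 p.2}.ncard = 2 * (k ^ 2 + k) := by
  rw [setOf_relU' hk, Set.ncard_union_eq _ (Set.finite_range _) (Set.finite_range _),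
    Set.ncard_range_of_injective, Set.ncard_range_of_injective, Nat.card_eq_fintype_card,
    card_mixIndex hk, two_mul]
  · refine mixPair_injective hk _ idxB (fun _ => rfl) (fun i h => ?_) fun i h => ?_
    · simp only [wt_b, idxB]; omega
    · simp only [wt_b, idxX]
  · refine mixPair_injective hk _ idxC (fun _ => rfl) (fun i h => ?_) fun i h => ?_
    · simp only [wt_mul, wt_pow, wt_b, wt_c, idxC]; omega
    · simp only [wt_mul, wt_pow, wt_b, wt_c, idxX, mul_zero, add_zero]
  -- The relations for `c_i b_i^{m-1}` contain some `c_i` on the left, those for `b_i` do not.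
  · rw [Set.disjoint_left]
    rintro _ ⟨p, rfl⟩ ⟨q, h⟩
    have h1 := congrArg (fun p => wt isC p.1) h
    rcases p with _ | i | i | i | i | ⟨i, t⟩ <;> rcases q with _ | i' | i' | i' | i' | ⟨i', t'⟩ <;>
      simp [mixPair, wt_mul, wt_x, wt_b, wt_c, wt_pow, isC] at h1

end CountMix

/-! ### The number of the relations between the letters `x_i` -/

section CountW

variable {k : ℕ}

/-- The indices of the relations `W`, sorted by the form of the relation. -/
abbrev ChainIndex (k : ℕ) : Type :=
  Fin (k - 2) ⊕ Below (k - 2) ⊕ Unit ⊕ Unit ⊕ Fin (k - 2) ⊕ Fin (k - 2) ⊕ Fin k ⊕ Fin (k - 1)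

/-- The relations `W`. -/
def chainPair (hk : 2 ≤ k) : ChainIndex k → Word k × Word k
  | .inl i => (x (i + 1) * x 0, x 0 * x (i + 1 + 1))
  | .inr (.inl p) =>
    have := p.1.2
    (x (p.1 + 2) * x (p.2 + 1), x (p.2 + 1) * x (p.1 + 2))
  | .inr (.inr (.inl _)) => (x 0 ^ 2 * x 1, x 0 ^ 2)
  | .inr (.inr (.inr (.inl _))) => (x 0 ^ 2, x (k - 1) * x 0 ^ 2)
  | .inr (.inr (.inr (.inr (.inl i)))) =>
    (x (i + 1 + 1) * x (i + 1) * x (i + 1 + 1), x (i + 1 + 1) * x (i + 1))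
  | .inr (.inr (.inr (.inr (.inr (.inl i))))) =>
    (x (i + 1 + 1) * x (i + 1), x (i + 1) * x (i + 1 + 1) * x (i + 1))
  | .inr (.inr (.inr (.inr (.inr (.inr (.inl i)))))) => (xs k i k * xs k 0 i * x i, x i)
  | .inr (.inr (.inr (.inr (.inr (.inr (.inr i)))))) =>
    (xs k (i + 1 + 1) k * xs k 0 (i + 1) * x (i + 1) ^ 2, x (i + 1) ^ 2)

theorem x_mul_x_inj {i j i' j' : ℕ} {hi : i < k} {hj : j < k} {hi' : i' < k} {hj' : j' < k}
    (h : (x i hi * x j hj : Word k) = x i' hi' * x j' hj') : i = i' ∧ j = j' := by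
  have h' : [Letter.x (⟨i, hi⟩ : Fin k), Letter.x ⟨j, hj⟩] = [Letter.x ⟨i', hi'⟩, Letter.x ⟨j', hj'⟩] := h
  simpa using h'

theorem b_mul_b_inj {i j i' j' : ℕ} {hi : 1 ≤ i ∧ i ≤ k} {hj : 1 ≤ j ∧ j ≤ k} {hi' : 1 ≤ i' ∧ i' ≤ k}
    {hj' : 1 ≤ j' ∧ j' ≤ k} (h : (b i hi * b j hj : Word k) = b i' hi' * b j' hj') :
    i = i' ∧ j = j' := by
  have h' : [Letter.b (⟨i - 1, by omega⟩ : Fin k), Letter.b ⟨j - 1, by omega⟩] =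
    [Letter.b ⟨i' - 1, by omega⟩, Letter.b ⟨j' - 1, by omega⟩] := h
  simp at h'
  omega

theorem c_mul_c_inj {i j i' j' : ℕ} {hi : 1 ≤ i ∧ i ≤ k} {hj : 1 ≤ j ∧ j ≤ k} {hi' : 1 ≤ i' ∧ i' ≤ k}
    {hj' : 1 ≤ j' ∧ j' ≤ k} (h : (c i hi * c j hj : Word k) = c i' hi' * c j' hj') :
    i = i' ∧ j = j' := by
  have h' : [Letter.c (⟨i - 1, by omega⟩ : Fin k), Letter.c ⟨j - 1, by omega⟩] =
    [Letter.c ⟨i' - 1, by omega⟩, Letter.c ⟨j' - 1, by omega⟩] := h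
  simp at h'
  omega

/-- Except for the commutation relations `x_j x_i = x_i x_j`, the relations are told apart by the lengths
of both sides and by the sums of the indices of their letters. -/
theorem chainPair_injective (hk : 2 ≤ k) : Function.Injective (chainPair hk) := by
  intro p q h
  have h1 : wt isX (chainPair hk p).1 = wt isX (chainPair hk q).1 := by rw [h]
  have h2 : wt isX (chainPair hk p).2 = wt isX (chainPair hk q).2 := by rw [h]
  have h3 : wt idxX (chainPair hk p).1 = wt idxX (chainPair hk q).1 := by rw [h]
  have h4 : wt idxX (chainPair hk p).2 = wt idxX (chainPair hk q).2 := by rw [h]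
  have hxs : ∀ s t, s ≤ t ∧ t ≤ k → wt isX (xs k s t) = t - s := fun s t h =>
    wt_isX_xs s t h.1 h.2
  rcases p with i | ⟨j, i⟩ | _ | _ | i | i | i | i <;>
    rcases q with i' | ⟨j', i'⟩ | _ | _ | i' | i' | i' | i' <;>
    simp only [chainPair, wt_mul, wt_pow, wt_x, isX, idxX] at h1 h2 h3 h4 <;>
    first
    | rfl
    | (exfalso; omega)
    | (obtain rfl : i = i' := Fin.ext (by omega); rfl)
    | (exfalso; rw [hxs _ _ (by omega), hxs _ _ (by omega)] at h1; omega)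
    | skip
  obtain ⟨e1, e2⟩ := x_mul_x_inj (congrArg Prod.fst h)
  rw [below_ext (p := ⟨j, i⟩) (q := ⟨j', i'⟩) (by simpa using e1) (by simpa using e2)]

theorem card_chainIndex (hk : 2 ≤ k) : Fintype.card (ChainIndex k) * 2 + 4 = k ^ 2 + 5 * k := by
  obtain ⟨n, rfl⟩ : ∃ n, k = n + 2 := ⟨k - 2, by omega⟩
  have h := card_below n
  simp only [Fintype.card_sum, Fintype.card_fin, Fintype.card_unit,
    Nat.add_sub_cancel, show n + 2 - 1 = n + 1 from rfl]
  rcases n with _ | n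
  · simp
  · rw [Nat.add_sub_cancel] at h
    nlinarith

theorem setOf_relW (hk : 2 ≤ k) :
    {p : Word k × Word k | RelW k p.1 p.2} = Set.range (chainPair hk) := by
  ext ⟨u, v⟩
  constructor
  · intro h
    replace h : RelW k u v := h
    induction h with
    | w1 i h =>
      obtain ⟨i, rfl⟩ : ∃ n, i = n + 1 := ⟨i - 1, by omega⟩
      exact ⟨.inl ⟨i, by omega⟩, rfl⟩
    | w2 i j h =>
      obtain ⟨i, rfl⟩ : ∃ n, i = n + 1 := ⟨i - 1, by omega⟩
      obtain ⟨j, rfl⟩ : ∃ n, j = n + 2 := ⟨j - 2, by omega⟩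
      exact ⟨.inr (.inl ⟨⟨j, by omega⟩, ⟨i, by simp only; omega⟩⟩), rfl⟩
    | w3_left => exact ⟨.inr (.inr (.inl ())), rfl⟩
    | w3_right => exact ⟨.inr (.inr (.inr (.inl ()))), rfl⟩
    | w4_left i h =>
      obtain ⟨i, rfl⟩ : ∃ n, i = n + 1 := ⟨i - 1, by omega⟩
      exact ⟨.inr (.inr (.inr (.inr (.inl ⟨i, by omega⟩)))), rfl⟩
    | w4_right i h =>
      obtain ⟨i, rfl⟩ : ∃ n, i = n + 1 := ⟨i - 1, by omega⟩
      exact ⟨.inr (.inr (.inr (.inr (.inr (.inl ⟨i, by omega⟩))))), rfl⟩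
    | w5 i h => exact ⟨.inr (.inr (.inr (.inr (.inr (.inr (.inl ⟨i, h⟩)))))), rfl⟩
    | w6 i h =>
      obtain ⟨i, rfl⟩ : ∃ n, i = n + 1 := ⟨i - 1, by omega⟩
      exact ⟨.inr (.inr (.inr (.inr (.inr (.inr (.inr ⟨i, by omega⟩)))))), rfl⟩
  · change _ → RelW k u v
    rintro ⟨p, h⟩
    rcases p with i | ⟨j, i⟩ | _ | _ | i | i | i | i <;>
      obtain ⟨rfl, rfl⟩ := Prod.ext_iff.1 h <;> simp only [chainPair]
    · exact .w1 _ (by omega)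
    · have := j.2
      exact .w2 _ _ (by omega)
    · exact .w3_left hk
    · exact .w3_right hk
    · exact .w4_left _ (by omega)
    · exact .w4_right _ (by omega)
    · exact .w5 _ (by omega)
    · exact .w6 _ (by omega)

end CountW

/-! ### The number of the relations between the letters `b_i` and `c_i` -/

section CountU

variable {k m : ℕ}

/-- The indices of the relations `U`, sorted by the form of the relation. -/
abbrev UnitIndex (k m : ℕ) : Type :=
  Fin k ⊕ Fin k ⊕ Fin k ⊕ Fin k ⊕ Fin k × Fin (m - 3) ⊕ Below k ⊕ Below k ⊕ Fin k × Fin (k - 1)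

/-- The `t`-th element of `{1, …, k}` other than `i + 1`. -/
def skipOne (i t : ℕ) : ℕ := if t < i then t + 1 else t + 2

theorem skipOne_spec {i t : ℕ} (hi : i < k) (ht : t < k - 1) :
    (1 ≤ skipOne i t ∧ skipOne i t ≤ k) ∧ i + 1 ≠ skipOne i t := by
  unfold skipOne
  split_ifs <;> omega

/-- The relations `U`. -/
def unitPair : UnitIndex k m → Word k × Word k
  | .inl i => ((c (i + 1) * b (i + 1) ^ (m - 1)) ^ 2, 1)
  | .inr (.inl i) => (b (i + 1) ^ m, 1)
  | .inr (.inr (.inl i)) => ((b (i + 1) * c (i + 1) * b (i + 1) ^ (m - 1)) ^ (m - 1), 1)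
  | .inr (.inr (.inr (.inl i))) => ((c (i + 1) * b (i + 1) ^ (m - 2) * c (i + 1)) ^ 3, 1)
  | .inr (.inr (.inr (.inr (.inl (i, j))))) =>
    ((c (i + 1) * b (i + 1) ^ (m - (j.val + 2) - 1) * c (i + 1) * b (i + 1) ^ (j.val + 2 - 1)) ^ 2, 1)
  | .inr (.inr (.inr (.inr (.inr (.inl p))))) =>
    (b (p.2 + 1) * b (p.1 + 1), b (p.1 + 1) * b (p.2 + 1))
  | .inr (.inr (.inr (.inr (.inr (.inr (.inl p)))))) =>
    (c (p.2 + 1) * c (p.1 + 1), c (p.1 + 1) * c (p.2 + 1))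
  | .inr (.inr (.inr (.inr (.inr (.inr (.inr (i, t))))))) =>
    have h : 1 ≤ skipOne i t ∧ skipOne i t ≤ k := (skipOne_spec i.2 t.2).1
    (b (i + 1) * c (skipOne i t) h, c (skipOne i t) h * b (i + 1))

/-- The number of letters `β` in front of the first `γ` is determined by the word. This tells the
relations `(c_i b_i^{m-j-1} c_i b_i^{j-1})^2 = 1` with the same `i` apart, in which the letters occur
equally often for all `j`. -/
theorem pow_mul_of_mul_inj {α : Type*} {β γ : α} (hβγ : β ≠ γ) (n n' : ℕ) {w w' : FreeMonoid α}
    (h : FreeMonoid.of β ^ n * (FreeMonoid.of γ * w) =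
      FreeMonoid.of β ^ n' * (FreeMonoid.of γ * w')) : n = n' := by
  induction n generalizing n' with
  | zero =>
    rcases n' with _ | n'
    · rfl
    · rw [pow_zero, one_mul, pow_succ', mul_assoc] at h
      exact absurd (List.cons.inj h).1.symm hβγ
  | succ n ih =>
    rcases n' with _ | n'
    · rw [pow_zero, one_mul, pow_succ', mul_assoc] at h
      exact absurd (List.cons.inj h).1 hβγ
    · rw [pow_succ', pow_succ', mul_assoc, mul_assoc] at h
      rw [ih n' (mul_left_cancel h)]

/-- The form of a relation is determined by the numbers of letters `b_i` and `c_i`; then its parameters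
are determined by the sums of indices and the order of the letters. -/
theorem unitPair_injective (hm : 2 ≤ m) :
    Function.Injective (unitPair : UnitIndex k m → Word k × Word k) := by
  intro p q h
  have h1 : wt isB (unitPair p).1 = wt isB (unitPair q).1 := by rw [h]
  have h2 : wt isC (unitPair p).1 = wt isC (unitPair q).1 := by rw [h]
  have h3 : wt isB (unitPair p).2 = wt isB (unitPair q).2 := by rw [h]
  have h4 : wt isC (unitPair p).2 = wt isC (unitPair q).2 := by rw [h]
  have h5 : wt idxC (unitPair p).1 = wt idxC (unitPair q).1 := by rw [h]
  have h6 : wt idxB (unitPair p).1 = wt idxB (unitPair q).1 := by rw [h]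
  -- The number of letters `b_i` in the relation `(b_i c_i b_i^{m-1})^{m-1} = 1` exceeds that in
  -- the other relations with the same number of letters `c_i`.
  have hsq : m = 2 ∨ 3 * (m - 1) ≤ (m - 1) * (1 + (m - 1)) := by
    rcases eq_or_ne m 2 with h | h
    · exact .inl h
    · rw [mul_comm]; exact .inr (Nat.mul_le_mul_left _ (by omega))
  generalize hP : (m - 1) * (1 + (m - 1)) = P at hsq
  rcases p with i | i | i | i | ⟨i, j⟩ | ⟨j, i⟩ | ⟨j, i⟩ | ⟨i, j⟩ <;>
    rcases q with i' | i' | i' | i' | ⟨i', j'⟩ | ⟨j', i'⟩ | ⟨j', i'⟩ | ⟨i', j'⟩ <;>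
    simp only [unitPair, wt_mul, wt_pow, wt_one, wt_b, wt_c, isB, isC, mul_one, mul_zero,
      add_zero, zero_add, hP] at h1 h2 h3 h4 <;>
    first
    | (exfalso; omega)
    | skip
  all_goals
    simp only [unitPair, wt_mul, wt_pow, wt_b, wt_c, idxB, idxC, mul_zero, add_zero, zero_add,
      Nat.add_sub_cancel] at h5 h6
  · obtain rfl : i = i' := Fin.ext (by omega)
    rfl
  · obtain rfl : i = i' := Fin.ext (by simpa using Nat.eq_of_mul_eq_mul_left (by omega) h6)
    rfl
  · obtain rfl : i = i' := Fin.ext (by simpa using Nat.eq_of_mul_eq_mul_left (by omega) h5)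
    rfl
  · obtain rfl : i = i' := Fin.ext (by omega)
    rfl
  · obtain rfl : i = i' := Fin.ext (by omega)
    have e := congrArg Prod.fst h
    simp only [unitPair, sq, mul_assoc] at e
    have := pow_mul_of_mul_inj (by simp) _ _ (mul_left_cancel e)
    obtain rfl : j = j' := Fin.ext (by omega)
    rfl
  · obtain ⟨e1, e2⟩ := b_mul_b_inj (congrArg Prod.fst h)
    rw [below_ext (p := ⟨j, i⟩) (q := ⟨j', i'⟩) (by simpa using e2) (by simpa using e1)]
  · obtain ⟨e1, e2⟩ := c_mul_c_inj (congrArg Prod.fst h)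
    rw [below_ext (p := ⟨j, i⟩) (q := ⟨j', i'⟩) (by simpa using e2) (by simpa using e1)]
  · obtain rfl : i = i' := Fin.ext (by omega)
    have e : j.val = j'.val := by
      have := i.2
      have h1 := (skipOne_spec i.2 j.2).1
      have h2 := (skipOne_spec i.2 j'.2).1
      unfold skipOne at *
      split_ifs at * <;> omega
    rw [Fin.ext e]

theorem card_unitIndex :
    Fintype.card (UnitIndex k m) = 4 * k + k * (m - 3) + 2 * (k * (k - 1)) := by
  have h := card_below k
  simp only [Fintype.card_sum, Fintype.card_fin, Fintype.card_prod]
  omega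

theorem setOf_relU : {p : Word k × Word k | RelU k m p.1 p.2} =
    Set.range (unitPair : UnitIndex k m → Word k × Word k) := by
  ext ⟨u, v⟩
  constructor
  · intro h
    replace h : RelU k m u v := h
    induction h with
    | u1 i h =>
      obtain ⟨i, rfl⟩ : ∃ n, i = n + 1 := ⟨i - 1, by omega⟩
      exact ⟨.inl ⟨i, by omega⟩, rfl⟩
    | u2 i h =>
      obtain ⟨i, rfl⟩ : ∃ n, i = n + 1 := ⟨i - 1, by omega⟩
      exact ⟨.inr (.inl ⟨i, by omega⟩), rfl⟩
    | u3 i h =>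
      obtain ⟨i, rfl⟩ : ∃ n, i = n + 1 := ⟨i - 1, by omega⟩
      exact ⟨.inr (.inr (.inl ⟨i, by omega⟩)), rfl⟩
    | u4 i h =>
      obtain ⟨i, rfl⟩ : ∃ n, i = n + 1 := ⟨i - 1, by omega⟩
      exact ⟨.inr (.inr (.inr (.inl ⟨i, by omega⟩))), rfl⟩
    | u5 i j h hj =>
      obtain ⟨i, rfl⟩ : ∃ n, i = n + 1 := ⟨i - 1, by omega⟩
      obtain ⟨j, rfl⟩ : ∃ n, j = n + 2 := ⟨j - 2, by omega⟩
      exact ⟨.inr (.inr (.inr (.inr (.inl (⟨i, by omega⟩, ⟨j, by omega⟩))))), rfl⟩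
    | u6_bb i j h =>
      obtain ⟨i, rfl⟩ : ∃ n, i = n + 1 := ⟨i - 1, by omega⟩
      obtain ⟨j, rfl⟩ : ∃ n, j = n + 1 := ⟨j - 1, by omega⟩
      exact ⟨.inr (.inr (.inr (.inr (.inr (.inl ⟨⟨j, by omega⟩, ⟨i, by simp only; omega⟩⟩))))), rfl⟩
    | u6_cc i j h =>
      obtain ⟨i, rfl⟩ : ∃ n, i = n + 1 := ⟨i - 1, by omega⟩
      obtain ⟨j, rfl⟩ : ∃ n, j = n + 1 := ⟨j - 1, by omega⟩
      exact ⟨.inr (.inr (.inr (.inr (.inr (.inr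
        (.inl ⟨⟨j, by omega⟩, ⟨i, by simp only; omega⟩⟩)))))), rfl⟩
    | u6_bc i j hi hj hij =>
      obtain ⟨i, rfl⟩ : ∃ n, i = n + 1 := ⟨i - 1, by omega⟩
      obtain ⟨t, rfl⟩ : ∃ t : Fin (k - 1), skipOne i t = j := by
        by_cases h : j < i + 1
        · exact ⟨⟨j - 1, by omega⟩, by simp only [skipOne]; split_ifs <;> omega⟩
        · exact ⟨⟨j - 2, by omega⟩, by simp only [skipOne]; split_ifs <;> omega⟩
      exact ⟨.inr (.inr (.inr (.inr (.inr (.inr (.inr (⟨i, by omega⟩, t))))))), rfl⟩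
  · change _ → RelU k m u v
    rintro ⟨p, h⟩
    rcases p with i | i | i | i | ⟨i, j⟩ | ⟨j, i⟩ | ⟨j, i⟩ | ⟨i, j⟩ <;>
      obtain ⟨rfl, rfl⟩ := Prod.ext_iff.1 h <;> simp only [unitPair]
    · exact .u1 _ (by omega)
    · exact .u2 _ (by omega)
    · exact .u3 _ (by omega)
    · exact .u4 _ (by omega)
    · exact .u5 _ _ (by omega) (by omega)
    · exact .u6_bb _ _ (by omega)
    · exact .u6_cc _ _ (by omega)
    · exact .u6_bc _ _ (by omega) (skipOne_spec i.2 j.2).1 (skipOne_spec i.2 j.2).2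

end CountU

/-! ### The total number of relations -/

section Count

variable {k m : ℕ}

theorem wt_isX_of_relU {u v : Word k} (h : RelU k m u v) : wt isX u = 0 := by
  induction h <;> simp [wt_mul, wt_pow, wt_b, wt_c, isX]

theorem wt_isX_of_relW {u v : Word k} (h : RelW k u v) : 2 ≤ wt isX u := by
  induction h with
  | w5 i h =>
    rw [wt_mul, wt_mul, wt_isX_xs _ _ (by omega) le_rfl, wt_isX_xs _ _ (by omega) (by omega), wt_x,
      isX]
    omega
  | w6 i h =>
    rw [wt_mul, wt_mul, wt_isX_xs _ _ (by omega) le_rfl, wt_isX_xs _ _ (by omega) (by omega), wt_pow,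
      wt_x, isX]
    omega
  | _ => simp [wt_mul, wt_pow, wt_x, isX]

theorem wt_isX_of_relU' {u v : Word k} (h : RelU' k m u v) : wt isX u = 1 := by
  induction h <;> simp [wt_mul, wt_pow, wt_b, wt_c, wt_x, isX]

theorem ncard_rel (hk : 2 ≤ k) (hm : 2 ≤ m) :
    2 * {p : Word k × Word k | Rel k m p.1 p.2}.ncard + 4 =
      5 * k ^ 2 + 17 * k + 4 * (k * (k - 1)) + 2 * (k * (m - 3)) := by
  have e : {p : Word k × Word k | Rel k m p.1 p.2} = {p | RelU k m p.1 p.2} ∪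
    ({p | RelW k p.1 p.2} ∪ {p | RelU' k m p.1 p.2}) := rfl
  have hU : {p : Word k × Word k | RelU k m p.1 p.2}.Finite := by
    rw [setOf_relU]; exact Set.finite_range _
  have hW : {p : Word k × Word k | RelW k p.1 p.2}.Finite := by
    rw [setOf_relW hk]; exact Set.finite_range _
  have hU' : {p : Word k × Word k | RelU' k m p.1 p.2}.Finite := by
    rw [setOf_relU' hk]; exact (Set.finite_range _).union (Set.finite_range _)
  have cU : {p : Word k × Word k | RelU k m p.1 p.2}.ncard =
      4 * k + k * (m - 3) + 2 * (k * (k - 1)) := by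
    rw [setOf_relU, Set.ncard_range_of_injective (unitPair_injective hm), Nat.card_eq_fintype_card,
      card_unitIndex]
  have cW : {p : Word k × Word k | RelW k p.1 p.2}.ncard * 2 + 4 = k ^ 2 + 5 * k := by
    rw [setOf_relW hk, Set.ncard_range_of_injective (chainPair_injective hk),
      Nat.card_eq_fintype_card, card_chainIndex hk]
  rw [e, Set.ncard_union_eq _ hU (hW.union hU'), Set.ncard_union_eq _ hW hU', ncard_relU' hk, cU]
  · nlinarith
  · rw [Set.disjoint_left]
    intro p h h'
    have h1 := wt_isX_of_relW h
    have h2 := wt_isX_of_relU' h'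
    omega
  · rw [Set.disjoint_left]
    rintro p h (h' | h')
    · have h1 := wt_isX_of_relU h
      have h2 := wt_isX_of_relW h'
      omega
    · have h1 := wt_isX_of_relU h
      have h2 := wt_isX_of_relU' h'
      omega

theorem card_letter (k : ℕ) : Nat.card (Letter k) = 3 * k := by
  let e : Fin k ⊕ Fin k ⊕ Fin k ≃ Letter k :=
    { toFun := Sum.elim Letter.b (Sum.elim Letter.c Letter.x)
      invFun := fun l => match l with
        | .b i => .inl i
        | .c i => .inr (.inl i)
        | .x i => .inr (.inr i)
      left_inv := by rintro (i | i | i) <;> rfl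
      right_inv := by rintro (i | i | i) <;> rfl }
  rw [← Nat.card_congr e, Nat.card_eq_fintype_card]
  simp only [Fintype.card_sum, Fintype.card_fin]
  omega

end Count

end POIPresentation

theorem theorem3p11 (k m : ℕ) (hk : 2 ≤ k) (hm : 2 ≤ m) :
    (∃ e : PresentedMonoid (POIPresentation.Rel k m) ≃* POIPresentation.POI k m,
      ∀ i : Fin k,
        (e (PresentedMonoid.of (POIPresentation.Rel k m) (POIPresentation.Letter.b i)) : POIPresentation.SymInv (Fin (k * m))) = POIPresentation.bBar k m i ∧
        (e (PresentedMonoid.of (POIPresentation.Rel k m) (POIPresentation.Letter.c i)) : POIPresentation.SymInv (Fin (k * m))) = POIPresentation.cBar k hm i ∧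
        (e (PresentedMonoid.of (POIPresentation.Rel k m) (POIPresentation.Letter.x i)) : POIPresentation.SymInv (Fin (k * m))) = POIPresentation.xBar k m i) ∧
    Nat.card (POIPresentation.Letter k) = 3 * k ∧
    (3 ≤ m →
      (({p : POIPresentation.Word k × POIPresentation.Word k | POIPresentation.Rel k m p.1 p.2}.ncard : ℕ) : ℚ) =
        (9 * (k : ℚ) ^ 2 + (2 * (m : ℚ) + 7) * k - 4) / 2) ∧
    (m = 2 →
      (({p : POIPresentation.Word k × POIPresentation.Word k | POIPresentation.Rel k m p.1 p.2}.ncard : ℕ) : ℚ) =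
        (9 * (k : ℚ) ^ 2 + 13 * (k : ℚ) - 4) / 2) := by
  obtain ⟨e, he⟩ := POIPresentation.exists_mulEquiv hk hm
  refine ⟨⟨e, fun i => ⟨he (.b i), he (.c i), he (.x i)⟩⟩, ?_, ?_, ?_⟩
  · exact POIPresentation.card_letter k
  · intro hm3
    have h := POIPresentation.ncard_rel hk hm
    obtain ⟨j, rfl⟩ : ∃ j, k = j + 1 := ⟨k - 1, by omega⟩
    obtain ⟨l, rfl⟩ : ∃ l, m = l + 3 := ⟨m - 3, by omega⟩
    simp only [Nat.add_sub_cancel] at h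
    have h' := congrArg (Nat.cast : ℕ → ℚ) h
    push_cast at h' ⊢
    linarith
  · rintro rfl
    have h := POIPresentation.ncard_rel hk hm
    obtain ⟨j, rfl⟩ : ∃ j, k = j + 1 := ⟨k - 1, by omega⟩
    simp only [Nat.add_sub_cancel, show 2 - 3 = 0 from rfl, mul_zero, add_zero] at h
    have h' := congrArg (Nat.cast : ℕ → ℚ) h
    push_cast at h' ⊢
    linarith
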